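/- Let $\sigma\in\{1,-1\}$. For $u:\mathbb R\to\mathbb C$ put $v(x)=i\sigma\,\overline{u(-x)}$, $Q=\begin{pmatrix}0&u\\ v&0\end{pmatrix}$ and $\langle x\rangle=\sqrt{1+x^2}$. Derivatives are weak derivatives; $L^{2,1}(\mathbb R)$ has the norm $\|\langle\cdot\rangle f\|_{L^2}$, $H^m(\mathbb R)$ the norm $\sum_{j=0}^m\|\partial_x^jf\|_{L^2}$, $H^{1,1}(\mathbb R)$ the norm $\|\langle\cdot\rangle f\|_{L^2}+\|\langle\cdot\rangle\partial_xf\|_{L^2}$, and $H^2\cap H^{1,1}$ the sum of the two norms. For $u\in H^{1,1}(\mathbb R)$ and $k\in\mathbb R\cup i\mathbb R$ the Jost functions $\varphi_\pm(\cdot,k),\psi_\pm(\cdot,k)\in L^\infty(\mathbb R;\mathbb C^2)$ are the unique bounded solutions of $$\varphi_\pm(x,k)=e_1+k\int_{\pm\infty}^x\begin{pmatrix}1&0\\0&e^{2ik^2(x-y)}\end{pmatrix}Q(y)\varphi_\pm(y,k)\,dy,$$ $$\psi_\pm(x,k)=e_2+k\int_{\pm\infty}^x\begin{pmatrix}e^{-2ik^2(x-y)}&0\\0&1\end{pmatrix}Q(y)\psi_\pm(y,k)\,dy,$$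 and the scattering data $a,b,c,d$ are the unique numbers such that, for all $x\in\mathbb R$, $$\big[\varphi_-(x,k)e^{-ik^2x},\ \psi_-(x,k)e^{ik^2x}\big]=\big[\varphi_+(x,k)e^{-ik^2x},\ \psi_+(x,k)e^{ik^2x}\big]\begin{pmatrix}a(k)&c(k)\\ b(k)&d(k)\end{pmatrix}.$$ Put $a_\infty=e^{-\frac1{2i}\int_{\mathbb R}uv\,dy}$ and $d_\infty=e^{\frac1{2i}\int_{\mathbb R}uv\,dy}$. The functions below are regarded as functions of $z=k^2\in\mathbb R$, with $k$ an arbitrary choice of square root of $z$; the subscript $z$ marks spaces of functions of $z$. (0) For $u\in H^{1,1}(\mathbb R)$ the Jost functions and the scattering data are well defined, i.e. they exist and are unique, for every $k\in\mathbb R\cup i\mathbb R$. (1) If $u\in H^{1,1}(\mathbb R)$, then $a(k)-a_\infty,\ d(k)-d_\infty,\ kb(k),\ k^{-1}b(k),\ kc(k),\ k^{-1}c(k)$ belong to $H^1_z(\mathbb R)$, and the map from $u$ to these six functions is Lipschitz continuous on bounded sets from $H^{1,1}(\mathbb R)$ to $H^1_z(\mathbb R)$: for every $\gamma\ge 0$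 there is a constant $C(\gamma)$ such that for all $u,\tilde u\in H^{1,1}(\mathbb R)$ of norm at most $\gamma$ the $H^1_z$-norm of the difference of each of the six functions is at most $C(\gamma)\|u-\tilde u\|_{H^{1,1}}$. (2) If $u\in H^2(\mathbb R)\cap H^{1,1}(\mathbb R)$, then $kb(k),\ k^{-1}b(k),\ kc(k),\ k^{-1}c(k)$ belong to $L^{2,1}_z(\mathbb R)$, and the map from $u$ to these four functions is, in the same sense, Lipschitz continuous on bounded sets from $H^2(\mathbb R)\cap H^{1,1}(\mathbb R)$ to $L^{2,1}_z(\mathbb R)$. -/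

import Mathlib

open MeasureTheory Set
open scoped ENNReal NNReal ContDiff ComplexConjugate

noncomputable section

namespace NDNLS

/-! ### Function spaces on the real line -/

/-- The weight `⟨x⟩ = √(1 + x²)`. -/
def bracket (x : ℝ) : ℝ := Real.sqrt (1 + x ^ 2)

/-- `f ∈ L^{p,s}(ℝ)`. -/
def MemWeightedLp (p : ℝ≥0∞) (s : ℕ) (f : ℝ → ℂ) : Prop :=
  MemLp (fun x => bracket x ^ s • f x) p volume

/-- The norm of `L^{p,s}(ℝ)`, with values in `[0, ∞]`. -/
def weightedLpNorm (p : ℝ≥0∞) (s : ℕ) (f : ℝ → ℂ) : ℝ≥0∞ :=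
  eLpNorm (fun x => bracket x ^ s • f x) p volume

/-- `g` is a weak derivative of order `j` of `f` (`f` and `g` are meant to be locally
integrable, which every use below guarantees). -/
def HasWeakDeriv (j : ℕ) (f g : ℝ → ℂ) : Prop :=
  ∀ θ : ℝ → ℝ, ContDiff ℝ ∞ θ → HasCompactSupport θ →
    ∫ x, iteratedDeriv j θ x • f x = (-1 : ℂ) ^ j * ∫ x, θ x • g x

open Classical in
/-- The weak derivative of order `j` of `f` (unique up to a null set), zero if there is none. -/
def weakDeriv (j : ℕ) (f : ℝ → ℂ) : ℝ → ℂ :=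
  if h : ∃ g : ℝ → ℂ, LocallyIntegrable g volume ∧ HasWeakDeriv j f g then h.choose else 0

/-- `f ∈ H^{m,s}(ℝ)`: `⟨x⟩^s ∂_x^j f ∈ L²(ℝ)` for `j = 0, …, m`. -/
def MemWeightedSobolev (m s : ℕ) (f : ℝ → ℂ) : Prop :=
  MemWeightedLp 2 s f ∧
    ∀ j ∈ Finset.Icc 1 m, ∃ g : ℝ → ℂ, HasWeakDeriv j f g ∧ MemWeightedLp 2 s g

/-- The norm `∑_{j=0}^m ‖⟨x⟩^s ∂_x^j f‖_{L²}` of `H^{m,s}(ℝ)`, with values in `[0, ∞]`. -/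
def weightedSobolevNorm (m s : ℕ) (f : ℝ → ℂ) : ℝ≥0∞ :=
  weightedLpNorm 2 s f + ∑ j ∈ Finset.Icc 1 m, weightedLpNorm 2 s (weakDeriv j f)

/-- `H^m(ℝ) = H^{m,0}(ℝ)`. -/
abbrev MemSobolev (m : ℕ) (f : ℝ → ℂ) : Prop := MemWeightedSobolev m 0 f

/-- The norm of `H^m(ℝ)`. -/
abbrev sobolevNorm (m : ℕ) (f : ℝ → ℂ) : ℝ≥0∞ := weightedSobolevNorm m 0 f

/-! ### Jost functions -/

/-- The nonlocal reduction `v(x) = i σ conj (u (-x))`. -/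
def nonlocalPartner (σ : ℝ) (u : ℝ → ℂ) (x : ℝ) : ℂ := Complex.I * σ * conj (u (-x))

/-- The end of the line, `-∞` or `+∞`, at which a Jost function is normalised. -/
inductive Side
  | minus
  | plus

/-- `∫_{-∞}^x f(y) dy` and `∫_{+∞}^x f(y) dy = - ∫_x^{+∞} f(y) dy`. -/
def integralFrom : Side → (ℝ → ℂ) → ℝ → ℂ
  | Side.minus, f, x => ∫ y in Iic x, f y
  | Side.plus, f, x => -∫ y in Ioi x, f y

/-- `φ = φ_±(·, k)`: a bounded solution of
`φ(x) = e₁ + k ∫_{±∞}^x diag(1, e^{2ik²(x-y)}) Q(y) φ(y) dy`, `Q = [[0, u], [v, 0]]`. -/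
structure IsJostPhi (σ : ℝ) (s : Side) (u : ℝ → ℂ) (k : ℂ) (φ : ℝ → Fin 2 → ℂ) : Prop where
  bounded : ∀ i, MemLp (fun x => φ x i) ∞ volume
  eq_fst : ∀ x, φ x 0 = 1 + k * integralFrom s (fun y => u y * φ y 1) x
  eq_snd : ∀ x, φ x 1 = k * integralFrom s (fun y =>
    Complex.exp (2 * Complex.I * k ^ 2 * (x - y)) * (nonlocalPartner σ u y * φ y 0)) x

/-- `ψ = ψ_±(·, k)`: a bounded solution of
`ψ(x) = e₂ + k ∫_{±∞}^x diag(e^{-2ik²(x-y)}, 1) Q(y) ψ(y) dy`, `Q = [[0, u], [v, 0]]`. -/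
structure IsJostPsi (σ : ℝ) (s : Side) (u : ℝ → ℂ) (k : ℂ) (ψ : ℝ → Fin 2 → ℂ) : Prop where
  bounded : ∀ i, MemLp (fun x => ψ x i) ∞ volume
  eq_fst : ∀ x, ψ x 0 = k * integralFrom s (fun y =>
    Complex.exp (-(2 * Complex.I * k ^ 2 * (x - y))) * (u y * ψ y 1)) x
  eq_snd : ∀ x, ψ x 1 = 1 + k * integralFrom s (fun y => nonlocalPartner σ u y * ψ y 0) x

open Classical in
/-- The Jost function `φ_±(x, k)`. -/
def jostPhi (σ : ℝ) (s : Side) (u : ℝ → ℂ) (k : ℂ) : ℝ → Fin 2 → ℂ :=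
  if h : ∃ φ, IsJostPhi σ s u k φ then h.choose else 0

open Classical in
/-- The Jost function `ψ_±(x, k)`. -/
def jostPsi (σ : ℝ) (s : Side) (u : ℝ → ℂ) (k : ℂ) : ℝ → Fin 2 → ℂ :=
  if h : ∃ ψ, IsJostPsi σ s u k ψ then h.choose else 0

/-- The matrix `[φ_±(x,k) e^{-ik²x}, ψ_±(x,k) e^{ik²x}]` with these two columns. -/
def jostMatrix (σ : ℝ) (s : Side) (u : ℝ → ℂ) (k : ℂ) (x : ℝ) : Matrix (Fin 2) (Fin 2) ℂ :=
  Matrix.of fun i j =>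
    ![jostPhi σ s u k x i * Complex.exp (-(Complex.I * k ^ 2 * x)),
      jostPsi σ s u k x i * Complex.exp (Complex.I * k ^ 2 * x)] j

/-! ### Scattering data -/

/-- `S` carries the solutions normalised at `+∞` to those normalised at `-∞`, for every `x`. -/
def IsScatteringMatrix (σ : ℝ) (u : ℝ → ℂ) (k : ℂ) (S : Matrix (Fin 2) (Fin 2) ℂ) : Prop :=
  ∀ x, jostMatrix σ Side.minus u k x = jostMatrix σ Side.plus u k x * S

open Classical in
/-- The scattering matrix `[[a(k), c(k)], [b(k), d(k)]]`. -/
def scatteringMatrix (σ : ℝ) (u : ℝ → ℂ) (k : ℂ) : Matrix (Fin 2) (Fin 2) ℂ :=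
  if h : ∃ S, IsScatteringMatrix σ u k S then h.choose else 0

def scatA (σ : ℝ) (u : ℝ → ℂ) (k : ℂ) : ℂ := scatteringMatrix σ u k 0 0
def scatB (σ : ℝ) (u : ℝ → ℂ) (k : ℂ) : ℂ := scatteringMatrix σ u k 1 0
def scatC (σ : ℝ) (u : ℝ → ℂ) (k : ℂ) : ℂ := scatteringMatrix σ u k 0 1
def scatD (σ : ℝ) (u : ℝ → ℂ) (k : ℂ) : ℂ := scatteringMatrix σ u k 1 1

/-- `a_∞ = exp(-(1/2i) ∫ u v)`. -/
def aInfty (σ : ℝ) (u : ℝ → ℂ) : ℂ :=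
  Complex.exp (-(1 / (2 * Complex.I) * ∫ y, u y * nonlocalPartner σ u y))

/-- `d_∞ = exp((1/2i) ∫ u v)`. -/
def dInfty (σ : ℝ) (u : ℝ → ℂ) : ℂ :=
  Complex.exp (1 / (2 * Complex.I) * ∫ y, u y * nonlocalPartner σ u y)

/-- The functions `k b, k⁻¹ b, k c, k⁻¹ c` of `z`, where `k = κ z` is a square root of `z`. -/
def offDiagonalData (σ : ℝ) (κ : ℝ → ℂ) (u : ℝ → ℂ) : Fin 4 → ℝ → ℂ :=
  ![fun z => κ z * scatB σ u (κ z),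
    fun z => (κ z)⁻¹ * scatB σ u (κ z),
    fun z => κ z * scatC σ u (κ z),
    fun z => (κ z)⁻¹ * scatC σ u (κ z)]

/-- The functions `a - a_∞, d - d_∞, k b, k⁻¹ b, k c, k⁻¹ c` of `z`, where `k = κ z`. -/
def scatteringData (σ : ℝ) (κ : ℝ → ℂ) (u : ℝ → ℂ) : Fin 6 → ℝ → ℂ :=
  Matrix.vecCons (fun z => scatA σ u (κ z) - aInfty σ u)
    (Matrix.vecCons (fun z => scatD σ u (κ z) - dInfty σ u) (offDiagonalData σ κ u))

end NDNLS

end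

/-!
The Jost functions solve `2 × 2` Volterra systems whose coefficients are integrable. On bounded
continuous functions the Volterra operator satisfies `‖Tⁿ‖ ≤ Hⁿ / n!`, so `1 - T` is invertible
(`isUnit_one_sub_volterra`), and the solution depends continuously on `z` and analytically on the
coefficients. Reflection `x ↦ -x` and exchange of the potentials reduce `φ_±` and `ψ_±` to the one
system normalised at `-∞`, for four pairs of potentials (`isJostPhi_iff_eq`, `isJostPsi_iff_eq`).
The entries of the scattering matrix are Wronskians of Jost functions; evaluated at `x = 0` they
are sums of products of two functions `halfF` and `halfR` of the half-line problem
(`isScatteringMatrix_iff`). It remains to study these functions of `z = k²`.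

In the spectral problem the potential is multiplied by `k`, which spoils uniform estimates. With
`E(x) = (1/2i) ∫_{-∞}^x u v`, a gauge transformation (`W11.sol_eq`) turns the problem into a
Zakharov–Shabat system, whose coefficients `e^{2izy} U`, `e^{-2izy} V` depend on `z` only through
the exponentials, with `U = u e^{2E}` and `V = (1/2i) (v' - u v² / 2i) e^{-2E}` in `L^{2,1}` for
`u, v ∈ H^{1,1}`. For the latter, Plancherel's theorem bounds the free term in `L²_z`, Minkowski's
and Gronwall's inequalities bound the remainder, and the weight `⟨x⟩` pays for one difference
quotient in `z` (`exists_sobBound_zs`). Working with difference quotients rather than derivatives in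
`z` makes the class of bounded elements of `H¹_z` visibly an algebra (`SobBound`). The constants
`a_∞`, `d_∞` are products of the values of gauge factors at `x = 0`.

Multiplication by `z` produces boundary terms at `x = 0`: only the combination `halfZ` of `z halfR`
and `v(0) halfF` is in `H¹_z`. In `k b = z · k⁻¹ b` the boundary terms of the two half-lines cancel
(`mul_bFn_eq`). For `u ∈ H²` one integration by parts in the Zakharov–Shabat system gains another
power of `z`, up to boundary terms which cancel in the same way (`exists_eLpNorm_sq_mul_bFn_le`).

Lipschitz continuity follows from these bounds without estimating any difference. The bounds hold
for arbitrary pairs `(u, v)`, so that the data can be continued to the complex line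
`τ ↦ (u + τ d, v + τ e)`, on which they are entire. If `d` and `e` have norm `δ`, the data are bounded
on the disc of radius `1 + 1/δ`, and Cauchy's formula bounds the difference of the values at `1` and
`0` by a multiple of `δ` (`eLpNorm_sub_le_mul`, `exists_pairData_lipschitz`,
`exists_offData_lipschitz`).
-/

noncomputable section

namespace NDNLS

open Filter Topology
open scoped BoundedContinuousFunction

/-! ### Absolutely continuous functions -/

theorem _root_.AbsolutelyContinuousOnInterval.of_dist_le {X Y : Type*} [PseudoMetricSpace X]
    [PseudoMetricSpace Y] {F : ℝ → X} {G : ℝ → Y} {a b K : ℝ}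
    (hG : AbsolutelyContinuousOnInterval G a b)
    (h : ∀ x ∈ uIcc a b, ∀ y ∈ uIcc a b, dist (F x) (F y) ≤ K * dist (G x) (G y)) :
    AbsolutelyContinuousOnInterval F a b := by
  unfold AbsolutelyContinuousOnInterval at hG ⊢
  refine squeeze_zero' (.of_forall fun _ => Finset.sum_nonneg fun _ _ => dist_nonneg) ?_
    (by simpa using hG.const_mul K)
  rw [eventually_inf_principal]
  filter_upwards with E hE
  rw [Finset.mul_sum]
  exact Finset.sum_le_sum fun i hi => h _ (hE.1 i hi).1 _ (hE.1 i hi).2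

/-- `F` is locally absolutely continuous and `f` is its derivative almost everywhere. -/
structure HasACDeriv (F f : ℝ → ℂ) : Prop where
  ac : ∀ a b, AbsolutelyContinuousOnInterval F a b
  locInt : LocallyIntegrable f volume
  ae_deriv : ∀ᵐ x, HasDerivAt F (f x) x

theorem _root_.MeasureTheory.LocallyIntegrable.intervalInt {f : ℝ → ℂ}
    (hf : LocallyIntegrable f volume) (a b : ℝ) : IntervalIntegrable f volume a b :=
  intervalIntegrable_iff.mpr <|
    (hf.integrableOn_isCompact isCompact_uIcc).mono_set uIoc_subset_uIcc

theorem HasACDeriv.of_integral {F f : ℝ → ℂ} (hf : LocallyIntegrable f volume)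
    (h : ∀ a b, ∫ t in a..b, f t = F b - F a) : HasACDeriv F f where
  locInt := hf
  ac a b := by
    have hN := (hf.intervalInt a b).norm.absolutelyContinuousOnInterval_intervalIntegral
      (c := a) left_mem_uIcc
    refine hN.of_dist_le (K := 1) fun x _ y _ => ?_
    have hi (c d : ℝ) := (hf.intervalInt c d).norm
    rw [one_mul, dist_comm, dist_eq_norm, ← h x y, dist_comm, Real.dist_eq,
      intervalIntegral.integral_interval_sub_left (hi _ _) (hi _ _)]
    exact intervalIntegral.norm_integral_le_abs_integral_norm
  ae_deriv := by
    filter_upwards [_root_.LocallyIntegrable.ae_hasDerivAt_integral hf] with x hx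
    have := (hx 0).const_add (F 0)
    refine this.congr_of_eventuallyEq (.of_forall fun y => ?_)
    simp [h 0 y]

theorem HasACDeriv.continuous {F f : ℝ → ℂ} (h : HasACDeriv F f) : Continuous F := by
  refine continuous_iff_continuousAt.2 fun x => ?_
  have := (h.ac (x - 1) (x + 1)).continuousOn
  rw [uIcc_of_le (by linarith)] at this
  exact this.continuousAt (Icc_mem_nhds (by linarith) (by linarith))

/-- The fundamental theorem of calculus: `F` minus a primitive of `f` is absolutely continuous with
derivative zero almost everywhere, hence constant. -/
theorem HasACDeriv.integral_eq {F f : ℝ → ℂ} (h : HasACDeriv F f) (a b : ℝ) :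
    ∫ t in a..b, f t = F b - F a := by
  have hp : HasACDeriv (fun x => ∫ t in a..x, f t) f := .of_integral h.locInt fun c d => by
    rw [intervalIntegral.integral_interval_sub_left (h.locInt.intervalInt _ _)
      (h.locInt.intervalInt _ _)]
  obtain ⟨C, hC⟩ := ((h.ac a b).sub (hp.ac a b)).const_of_ae_hasDerivAt_zero (by
    filter_upwards [h.ae_deriv, hp.ae_deriv] with x h1 h2 _
    simpa using h1.sub h2)
  have h1 := hC a left_mem_uIcc
  have h2 := hC b right_mem_uIcc
  simp only [Pi.sub_apply, intervalIntegral.integral_same, sub_zero] at h1 h2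
  rw [h1, ← h2]; ring

theorem HasACDeriv.mul {F f G g : ℝ → ℂ} (hF : HasACDeriv F f) (hG : HasACDeriv G g) :
    HasACDeriv (fun x => F x * G x) (fun x => f x * G x + F x * g x) where
  ac a b := (hF.ac a b).smul (hG.ac a b)
  locInt := by
    refine LocallyIntegrable.add ?_ ?_
    · refine locallyIntegrable_iff.2 fun k hk => ?_
      exact (hF.locInt.integrableOn_isCompact hk).mul_continuousOn hG.continuous.continuousOn hk
    · refine locallyIntegrable_iff.2 fun k hk => ?_
      exact (hG.locInt.integrableOn_isCompact hk).continuousOn_mul hF.continuous.continuousOn hk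
  ae_deriv := by filter_upwards [hF.ae_deriv, hG.ae_deriv] with x h1 h2 using h1.mul h2

theorem HasACDeriv.add {F f G g : ℝ → ℂ} (hF : HasACDeriv F f) (hG : HasACDeriv G g) :
    HasACDeriv (fun x => F x + G x) (fun x => f x + g x) where
  ac a b := (hF.ac a b).add (hG.ac a b)
  locInt := hF.locInt.add hG.locInt
  ae_deriv := by filter_upwards [hF.ae_deriv, hG.ae_deriv] with x h1 h2 using h1.add h2

theorem HasACDeriv.const (c : ℂ) : HasACDeriv (fun _ => c) (fun _ => 0) :=
  .of_integral continuous_const.locallyIntegrable fun a b => by simp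

theorem HasACDeriv.const_mul {F f : ℝ → ℂ} (hF : HasACDeriv F f) (c : ℂ) :
    HasACDeriv (fun x => c * F x) (fun x => c * f x) := by
  simpa using (HasACDeriv.const c).mul hF

theorem HasACDeriv.sub {F f G g : ℝ → ℂ} (hF : HasACDeriv F f) (hG : HasACDeriv G g) :
    HasACDeriv (fun x => F x - G x) (fun x => f x - g x) := by
  simpa [sub_eq_add_neg] using hF.add (hG.const_mul (-1))

theorem HasACDeriv.of_hasDerivAt {F f : ℝ → ℂ} (hF : ∀ x, HasDerivAt F (f x) x)
    (hf : Continuous f) : HasACDeriv F f :=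
  .of_integral hf.locallyIntegrable fun a b =>
    intervalIntegral.integral_eq_sub_of_hasDerivAt (fun x _ => hF x) (hf.intervalIntegrable a b)

theorem HasACDeriv.congr_deriv {F f g : ℝ → ℂ} (hF : HasACDeriv F f) (h : f =ᵐ[volume] g) :
    HasACDeriv F g where
  ac := hF.ac
  locInt := hF.locInt.congr h
  ae_deriv := by filter_upwards [hF.ae_deriv, h] with x h1 h2 using h2 ▸ h1

theorem HasACDeriv.cexp {F f : ℝ → ℂ} (hF : HasACDeriv F f) :
    HasACDeriv (fun x => Complex.exp (F x)) (fun x => Complex.exp (F x) * f x) where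
  ac a b := by
    obtain ⟨C, hC⟩ := (hF.ac a b).exists_bound
    refine (hF.ac a b).of_dist_le (K := Real.exp C) fun x hx y hy => ?_
    have := (convex_closedBall (0 : ℂ) C).norm_image_sub_le_of_norm_hasDerivWithin_le
      (f := Complex.exp) (f' := Complex.exp) (C := Real.exp C)
      (x := F y) (y := F x)
      (fun z _ => (Complex.hasDerivAt_exp z).hasDerivWithinAt)
      (fun z hz => by
        rw [Complex.norm_exp]
        exact Real.exp_le_exp.2 ((Complex.re_le_norm z).trans (by simpa using hz)))
      (by simpa using hC y hy) (by simpa using hC x hx)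
    simpa [dist_eq_norm] using this
  locInt := locallyIntegrable_iff.2 fun k hk => (hF.locInt.integrableOn_isCompact hk).continuousOn_mul
    (Complex.continuous_exp.comp hF.continuous).continuousOn hk
  ae_deriv := by filter_upwards [hF.ae_deriv] with x h1 using h1.cexp

/-- The fundamental theorem of calculus on a left half-line. -/
theorem HasACDeriv.integral_Iic {F f : ℝ → ℂ} (hF : HasACDeriv F f) (hf : Integrable f volume)
    (h0 : Tendsto F atBot (𝓝 0)) (x : ℝ) : ∫ t in Iic x, f t = F x := by
  have h1 := intervalIntegral_tendsto_integral_Iic (f := f) x (a := id) hf.integrableOn tendsto_id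
  refine tendsto_nhds_unique h1 ?_
  simp only [hF.integral_eq, id]
  simpa using (tendsto_const_nhds (x := F x)).sub h0

theorem hasACDeriv_integral_Iic {f : ℝ → ℂ} (hf : Integrable f volume) :
    HasACDeriv (fun x => ∫ t in Iic x, f t) f :=
  .of_integral hf.locallyIntegrable fun a b => by
    rw [intervalIntegral.integral_Iic_sub_Iic hf.integrableOn hf.integrableOn]

theorem tendsto_integral_Iic_atBot {f : ℝ → ℂ} (hf : Integrable f volume) :
    Tendsto (fun x => ∫ t in Iic x, f t) atBot (𝓝 0) := by
  have h1 := intervalIntegral_tendsto_integral_Iic (f := f) 0 (a := id) hf.integrableOn tendsto_id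
  have h2 := (tendsto_const_nhds (x := ∫ t in Iic 0, f t)).sub h1
  rw [sub_self] at h2
  refine h2.congr fun x => ?_
  rw [id, ← intervalIntegral.integral_Iic_sub_Iic hf.integrableOn hf.integrableOn]; ring

theorem norm_integral_Iic_le {f : ℝ → ℂ} (hf : Integrable f volume) (x : ℝ) :
    ‖∫ t in Iic x, f t‖ ≤ ∫ t, ‖f t‖ :=
  (norm_integral_le_integral_norm _).trans
    (setIntegral_le_integral hf.norm (.of_forall fun _ => norm_nonneg _))

/-! ### The Gronwall inequality for an integrable kernel -/

/-- Iterated integrals: `∫_{-∞}^x h Hⁿ / n! = Hⁿ⁺¹ / (n + 1)!` where `H(x) = ∫_{-∞}^x h`. -/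
theorem lintegral_Iic_mul_pow {h : ℝ → ℝ} (hi : Integrable h volume) (h0 : ∀ x, 0 ≤ h x)
    (n : ℕ) (x : ℝ) :
    ∫⁻ y in Iic x, ENNReal.ofReal (h y) * ENNReal.ofReal ((∫ t in Iic y, h t) ^ n / n.factorial) =
      ENNReal.ofReal ((∫ t in Iic x, h t) ^ (n + 1) / (n + 1).factorial) := by
  set H : ℝ → ℝ := fun x => ∫ t in Iic x, h t with hH
  have hH0 (x) : 0 ≤ H x := integral_nonneg h0
  have hC : HasACDeriv (fun x => (H x : ℂ)) (fun x => (h x : ℂ)) := by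
    simpa [hH, integral_complex_ofReal] using hasACDeriv_integral_Iic (hi.ofReal (𝕜 := ℂ))
  have hlim : Tendsto (fun x => (H x : ℂ)) atBot (𝓝 0) := by
    simpa [hH, integral_complex_ofReal] using tendsto_integral_Iic_atBot (hi.ofReal (𝕜 := ℂ))
  have hpow (m : ℕ) : HasACDeriv (fun x => (H x : ℂ) ^ (m + 1))
      (fun x => (m + 1) * (h x * (H x : ℂ) ^ m)) := by
    induction m with
    | zero => simpa using hC
    | succ m ih =>
      have := ih.mul hC
      refine ⟨?_, ?_, ?_⟩
      · simpa only [pow_succ] using this.ac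
      · refine this.locInt.congr (.of_forall fun y => ?_); push_cast; ring
      · simp only [pow_succ (_ : ℂ) (m + 1)]
        filter_upwards [this.ae_deriv] with y hy
        convert! hy using 1
        push_cast; ring
  have hint : Integrable (fun y => h y * (H y ^ n / n.factorial)) := by
    refine hi.mul_bdd (c := (∫ t, h t) ^ n / n.factorial) ?_ (.of_forall fun y => ?_)
    · have : Continuous H := by
        have := Complex.continuous_re.comp hC.continuous
        simpa [Function.comp_def] using this
      fun_prop
    · rw [Real.norm_of_nonneg (by have := hH0 y; positivity)]
      have := setIntegral_le_integral (s := Iic y) hi (.of_forall h0)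
      have h3 := hH0 y
      gcongr
  have key : ∫ y in Iic x, h y * (H y ^ n / n.factorial) = H x ^ (n + 1) / (n + 1).factorial := by
    have h1 := ((hpow n).const_mul (1 / (n + 1).factorial)).integral_Iic (by
      convert! hint.ofReal (𝕜 := ℂ) using 2 with y
      simp only [Complex.coe_algebraMap, Nat.factorial_succ]; push_cast; field_simp) (by
        simpa using (hlim.pow (n + 1)).const_mul (1 / ((n + 1).factorial : ℂ))) x
    have h2 : ∫ t in Iic x, ((h t * (H t ^ n / n.factorial) : ℝ) : ℂ) =
        ((H x ^ (n + 1) / (n + 1).factorial : ℝ) : ℂ) := by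
      push_cast
      rw [div_eq_inv_mul, ← one_div, ← h1]
      refine integral_congr_ae (.of_forall fun y => ?_)
      simp only [Nat.factorial_succ]; push_cast; field_simp
    exact_mod_cast (integral_complex_ofReal).symm.trans h2
  rw [← key, ofReal_integral_eq_lintegral_ofReal hint.integrableOn
    (.of_forall fun y => by have := hH0 y; have := h0 y; positivity)]
  refine lintegral_congr fun y => ?_
  rw [ENNReal.ofReal_mul (h0 y)]

/-- Gronwall's inequality on a left half-line for a function that is only known to be bounded, by
iteration. Values in `[0, ∞]` spare the measurability of `f` in the applications to norms. -/
theorem lintegral_Iic_le_gronwall {h : ℝ → ℝ} (hi : Integrable h volume) (h0 : ∀ x, 0 ≤ h x)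
    {f : ℝ → ℝ≥0∞} {c M : ℝ≥0∞} (hM : M ≠ ⊤) {x₀ : ℝ} (hfM : ∀ x ≤ x₀, f x ≤ M)
    (hf : ∀ x ≤ x₀, f x ≤ c + ∫⁻ y in Iic x, ENNReal.ofReal (h y) * f y) :
    f x₀ ≤ c * ENNReal.ofReal (Real.exp (∫ t, h t)) := by
  set H : ℝ → ℝ := fun x => ∫ t in Iic x, h t with hH
  have hH0 (x) : 0 ≤ H x := integral_nonneg h0
  have hHle : H x₀ ≤ ∫ t, h t := setIntegral_le_integral hi (.of_forall h0)
  set e : ℕ → ℝ → ℝ≥0∞ := fun n x => ENNReal.ofReal (H x ^ n / n.factorial) with he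
  have hHc : Continuous H := by
    have := Complex.continuous_re.comp (hasACDeriv_integral_Iic (hi.ofReal (𝕜 := ℂ))).continuous
    simpa [hH, Function.comp_def, integral_complex_ofReal] using this
  have hem (n) : Measurable (e n) := by
    have : Continuous fun x => H x ^ n / n.factorial := by fun_prop
    exact this.measurable.ennreal_ofReal
  have hstep (n : ℕ) : ∀ x ≤ x₀, f x ≤ c * ∑ j ∈ Finset.range n, e j x + M * e n x := by
    induction n with
    | zero => intro x hx; simpa [he] using hfM x hx
    | succ n ih =>
      intro x hx
      refine (hf x hx).trans ?_
      have h1 : ∫⁻ y in Iic x, ENNReal.ofReal (h y) * f y ≤ ∫⁻ y in Iic x,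
          (∑ j ∈ Finset.range n, c * (ENNReal.ofReal (h y) * e j y) +
            M * (ENNReal.ofReal (h y) * e n y)) := by
        refine setLIntegral_mono' measurableSet_Iic fun y hy => ?_
        refine (mul_le_mul_right (ih y (le_trans hy hx)) _).trans (le_of_eq ?_)
        rw [mul_add, Finset.mul_sum, Finset.mul_sum]
        congr 1
        · exact Finset.sum_congr rfl fun j _ => by ring
        · ring
      have hm (j) : AEMeasurable (fun y => ENNReal.ofReal (h y) * e j y) (volume.restrict (Iic x)) :=
        (hi.aemeasurable.restrict.ennreal_ofReal).mul (hem j).aemeasurable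
      rw [lintegral_add_right' _ ((hm n).const_mul M), lintegral_finsetSum' _
        (fun j _ => (hm j).const_mul c), lintegral_const_mul'' _ (hm n)] at h1
      simp only [lintegral_const_mul'' _ (hm _)] at h1
      simp only [he, hH, lintegral_Iic_mul_pow hi h0] at h1
      refine (add_le_add_right h1 c).trans (le_of_eq ?_)
      rw [Finset.sum_range_succ', mul_add, Finset.mul_sum]
      simp [he, hH]
      ring
  have hsum (n : ℕ) : ∑ j ∈ Finset.range n, e j x₀ ≤ ENNReal.ofReal (Real.exp (∫ t, h t)) := by
    rw [he, ← ENNReal.ofReal_sum_of_nonneg fun j _ => by have := hH0 x₀; positivity]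
    exact ENNReal.ofReal_le_ofReal ((Real.sum_le_exp_of_nonneg (hH0 _) n).trans
      (Real.exp_le_exp.2 hHle))
  have hlim : Tendsto (fun n => c * ENNReal.ofReal (Real.exp (∫ t, h t)) + M * e n x₀) atTop
      (𝓝 (c * ENNReal.ofReal (Real.exp (∫ t, h t)) + M * 0)) := by
    refine tendsto_const_nhds.add (ENNReal.Tendsto.const_mul ?_ (.inr hM))
    have := ENNReal.tendsto_ofReal (FloorSemiring.tendsto_pow_div_factorial_atTop (H x₀))
    simpa [he] using this
  rw [mul_zero, add_zero] at hlim
  refine ge_of_tendsto' hlim fun n => (hstep n x₀ le_rfl).trans ?_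
  gcongr
  exact hsum n

/-! ### Volterra systems with integrable coefficients -/

theorem integrable_mul_bcf (A : ℝ →₁[volume] ℂ) (g : ℝ →ᵇ ℂ) :
    Integrable (fun y => A y * g y) volume :=
  (L1.integrable_coeFn A).mul_bdd (c := ‖g‖) g.continuous.aestronglyMeasurable
    (.of_forall fun y => g.norm_coe_le_norm y)

theorem norm_integral_mul_bcf_le (A : ℝ →₁[volume] ℂ) (g : ℝ →ᵇ ℂ) (x : ℝ) :
    ‖∫ y in Iic x, A y * g y‖ ≤ ‖A‖ * ‖g‖ := by
  refine (norm_integral_Iic_le (integrable_mul_bcf A g) x).trans ?_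
  rw [L1.norm_eq_integral_norm, ← integral_mul_const]
  refine integral_mono (integrable_mul_bcf A g).norm
    ((L1.integrable_coeFn A).norm.mul_const _) fun y => ?_
  rw [norm_mul]
  exact mul_le_mul_of_nonneg_left (g.norm_coe_le_norm y) (norm_nonneg _)

/-- The indefinite integral `x ↦ ∫_{-∞}^x A g` as a bounded continuous function. -/
def primitiveBCF (A : ℝ →₁[volume] ℂ) (g : ℝ →ᵇ ℂ) : ℝ →ᵇ ℂ :=
  BoundedContinuousFunction.ofNormedAddCommGroup (fun x => ∫ y in Iic x, A y * g y)
    (hasACDeriv_integral_Iic (integrable_mul_bcf A g)).continuous (‖A‖ * ‖g‖)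
    (norm_integral_mul_bcf_le A g)

theorem primitiveBCF_apply (A : ℝ →₁[volume] ℂ) (g : ℝ →ᵇ ℂ) (x : ℝ) :
    primitiveBCF A g x = ∫ y in Iic x, A y * g y := rfl

/-- The operator `g ↦ (x ↦ ∫_{-∞}^x A g)`, linear in the integrable coefficient `A`. -/
def primitiveCLM : (ℝ →₁[volume] ℂ) →L[ℂ] (ℝ →ᵇ ℂ) →L[ℂ] (ℝ →ᵇ ℂ) :=
  LinearMap.mkContinuous₂ (LinearMap.mk₂ ℂ primitiveBCF
    (fun A B g => by
      ext x
      rw [BoundedContinuousFunction.add_apply]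
      simp only [primitiveBCF_apply]
      rw [← integral_add (integrable_mul_bcf A g).integrableOn (integrable_mul_bcf B g).integrableOn]
      refine setIntegral_congr_ae measurableSet_Iic ?_
      filter_upwards [Lp.coeFn_add A B] with y hy _
      rw [hy, Pi.add_apply, add_mul])
    (fun c A g => by
      ext x
      rw [BoundedContinuousFunction.coe_smul]
      simp only [primitiveBCF_apply, smul_eq_mul]
      rw [← integral_const_mul]
      refine setIntegral_congr_ae measurableSet_Iic ?_
      filter_upwards [Lp.coeFn_smul c A] with y hy _
      rw [hy, Pi.smul_apply, smul_eq_mul, mul_assoc])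
    (fun A g h => by
      ext x
      rw [BoundedContinuousFunction.add_apply]
      simp only [primitiveBCF_apply]
      rw [← integral_add (integrable_mul_bcf A g).integrableOn (integrable_mul_bcf A h).integrableOn]
      simp [mul_add])
    (fun c A g => by
      ext x
      rw [BoundedContinuousFunction.coe_smul]
      simp only [primitiveBCF_apply, smul_eq_mul]
      rw [← integral_const_mul]
      simp [mul_left_comm])) 1 fun A g => by
    rw [one_mul]
    exact (BoundedContinuousFunction.norm_le (by positivity)).2 (norm_integral_mul_bcf_le A g)

theorem primitiveCLM_apply (A : ℝ →₁[volume] ℂ) (g : ℝ →ᵇ ℂ) (x : ℝ) :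
    primitiveCLM A g x = ∫ y in Iic x, A y * g y := rfl

/-- The Volterra operator `(f, g) ↦ (∫_{-∞}^x A g, ∫_{-∞}^x B f)`. -/
def volterra (A B : ℝ →₁[volume] ℂ) : ((ℝ →ᵇ ℂ) × (ℝ →ᵇ ℂ)) →L[ℂ] ((ℝ →ᵇ ℂ) × (ℝ →ᵇ ℂ)) :=
  ((primitiveCLM A).comp (ContinuousLinearMap.snd ℂ _ _)).prod
    ((primitiveCLM B).comp (ContinuousLinearMap.fst ℂ _ _))

theorem volterra_eq (A B : ℝ →₁[volume] ℂ) : volterra A B =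
    (ContinuousLinearMap.inl ℂ _ _).comp
      ((primitiveCLM A).comp (ContinuousLinearMap.snd ℂ (ℝ →ᵇ ℂ) (ℝ →ᵇ ℂ))) +
    (ContinuousLinearMap.inr ℂ _ _).comp
      ((primitiveCLM B).comp (ContinuousLinearMap.fst ℂ (ℝ →ᵇ ℂ) (ℝ →ᵇ ℂ))) := by
  ext <;> simp [volterra]

theorem enorm_primitiveCLM_le (A : ℝ →₁[volume] ℂ) (g : ℝ →ᵇ ℂ) (x : ℝ) :
    ‖primitiveCLM A g x‖ₑ ≤ ∫⁻ y in Iic x, ‖A y‖ₑ * ‖g y‖ₑ := by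
  rw [primitiveCLM_apply]
  refine (enorm_integral_le_lintegral_enorm _).trans (le_of_eq ?_)
  simp [enorm_mul]

/-- The iterates of the Volterra operator are bounded by `Hⁿ / n!`, where
`H(x) = ∫_{-∞}^x (|A| + |B|)`. -/
theorem volterra_pow_bound (A B : ℝ →₁[volume] ℂ) (X : (ℝ →ᵇ ℂ) × (ℝ →ᵇ ℂ)) (n : ℕ) (x : ℝ) :
    ‖((volterra A B ^ n) X).1 x‖ₑ ⊔ ‖((volterra A B ^ n) X).2 x‖ₑ ≤
      ‖X‖ₑ * ENNReal.ofReal ((∫ t in Iic x, (‖A t‖ + ‖B t‖)) ^ n / n.factorial) := by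
  have hi : Integrable (fun t => ‖A t‖ + ‖B t‖) :=
    (L1.integrable_coeFn A).norm.add (L1.integrable_coeFn B).norm
  induction n generalizing x with
  | zero =>
    simp only [pow_zero, one_apply_eq_self, Nat.factorial_zero, Nat.cast_one, div_one,
      ENNReal.ofReal_one, mul_one]
    refine sup_le ?_ ?_ <;> rw [enorm_le_iff_norm_le]
    · exact (X.1.norm_coe_le_norm x).trans (norm_fst_le X)
    · exact (X.2.norm_coe_le_norm x).trans (norm_snd_le X)
  | succ n ih =>
    rw [← lintegral_Iic_mul_pow hi (fun t => by positivity) n x]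
    have hX : ‖X‖ₑ ≠ ⊤ := enorm_ne_top
    rw [← lintegral_const_mul' _ _ hX]
    have key (C : ℝ →₁[volume] ℂ) (hC : ∀ t, ‖C t‖ ≤ ‖A t‖ + ‖B t‖) (g : ℝ →ᵇ ℂ)
        (hg : ∀ y, ‖g y‖ₑ ≤ ‖X‖ₑ *
          ENNReal.ofReal ((∫ t in Iic y, (‖A t‖ + ‖B t‖)) ^ n / n.factorial)) :
        ‖primitiveCLM C g x‖ₑ ≤ ∫⁻ y in Iic x, ‖X‖ₑ * (ENNReal.ofReal (‖A y‖ + ‖B y‖) *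
          ENNReal.ofReal ((∫ t in Iic y, (‖A t‖ + ‖B t‖)) ^ n / n.factorial)) := by
      refine (enorm_primitiveCLM_le C g x).trans (lintegral_mono fun y => ?_)
      rw [mul_left_comm]
      refine mul_le_mul' ?_ (hg y)
      rw [← ofReal_norm]
      exact ENNReal.ofReal_le_ofReal (hC y)
    rw [pow_succ', mul_apply_eq_comp]
    refine sup_le ?_ ?_
    · exact key A (fun t => by have := norm_nonneg (B t); linarith) _
        fun y => (le_sup_right).trans (ih y)
    · exact key B (fun t => by have := norm_nonneg (A t); linarith) _
        fun y => (le_sup_left).trans (ih y)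

/-- The Volterra operator is quasinilpotent, so `1 - T` is invertible. -/
theorem isUnit_one_sub_volterra (A B : ℝ →₁[volume] ℂ) : IsUnit (1 - volterra A B) := by
  set H : ℝ := ∫ t, (‖A t‖ + ‖B t‖)
  have hi : Integrable (fun t => ‖A t‖ + ‖B t‖) :=
    (L1.integrable_coeFn A).norm.add (L1.integrable_coeFn B).norm
  have hH : 0 ≤ H := integral_nonneg fun t => by positivity
  have hb (n : ℕ) : ‖volterra A B ^ n‖ ≤ H ^ n / n.factorial := by
    refine ContinuousLinearMap.opNorm_le_bound _ (by positivity) fun X => ?_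
    have hx (x : ℝ) : ‖((volterra A B ^ n) X).1 x‖ₑ ⊔ ‖((volterra A B ^ n) X).2 x‖ₑ ≤
        ENNReal.ofReal (H ^ n / n.factorial * ‖X‖) := by
      refine (volterra_pow_bound A B X n x).trans ?_
      rw [mul_comm, ← ofReal_norm, ← ENNReal.ofReal_mul
        (by have : 0 ≤ ∫ t in Iic x, (‖A t‖ + ‖B t‖) := integral_nonneg fun t => by positivity
            positivity)]
      refine ENNReal.ofReal_le_ofReal ?_
      have h1 : ∫ t in Iic x, (‖A t‖ + ‖B t‖) ≤ H :=
        setIntegral_le_integral hi (.of_forall fun t => by positivity)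
      have h2 : 0 ≤ ∫ t in Iic x, (‖A t‖ + ‖B t‖) := integral_nonneg fun t => by positivity
      gcongr
    have hx' (w : ℂ) (h : ‖w‖ₑ ≤ ENNReal.ofReal (H ^ n / n.factorial * ‖X‖)) :
        ‖w‖ ≤ H ^ n / n.factorial * ‖X‖ := by
      rw [← ofReal_norm] at h
      exact (ENNReal.ofReal_le_ofReal_iff (by positivity)).1 h
    rw [Prod.norm_def]
    refine max_le ?_ ?_ <;> rw [BoundedContinuousFunction.norm_le (by positivity)] <;> intro x
    · exact hx' _ (le_sup_left.trans (hx x))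
    · exact hx' _ (le_sup_right.trans (hx x))
  obtain ⟨n, hn⟩ := ((FloorSemiring.tendsto_pow_div_factorial_atTop H).eventually
    (gt_mem_nhds one_pos)).exists
  -- `1 - T` divides `1 - Tⁿ`, which is invertible as soon as `‖Tⁿ‖ < 1`
  have h1 : IsUnit (1 - volterra A B ^ n) :=
    (Units.oneSub (volterra A B ^ n) ((hb n).trans_lt hn)).isUnit
  rw [← mul_neg_geom_sum] at h1
  exact (Commute.isUnit_mul_iff (by
    refine Commute.sub_left (Commute.one_left _) ?_
    exact Commute.sum_right _ _ _ fun i _ => (Commute.refl _).pow_right i)).1 h1 |>.1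

/-- The solution `(f, g)` of `f = 1 + ∫_{-∞}^x A g`, `g = ∫_{-∞}^x B f`. The inverse of `1 - T` is a
genuine one, by `isUnit_one_sub_volterra`. -/
def volterraSol (A B : ℝ →₁[volume] ℂ) : (ℝ →ᵇ ℂ) × (ℝ →ᵇ ℂ) :=
  Ring.inverse (1 - volterra A B) (1, 0)

theorem volterraSol_eq (A B : ℝ →₁[volume] ℂ) :
    volterraSol A B = (1, 0) + volterra A B (volterraSol A B) := by
  have := Ring.mul_inverse_cancel _ (isUnit_one_sub_volterra A B)
  have h := congrArg (fun T => T ((1, 0) : (ℝ →ᵇ ℂ) × (ℝ →ᵇ ℂ))) this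
  simp only [mul_apply_eq_comp, sub_apply,
    one_apply_eq_self] at h
  exact sub_eq_iff_eq_add.1 h

theorem volterraSol_unique (A B : ℝ →₁[volume] ℂ) {X : (ℝ →ᵇ ℂ) × (ℝ →ᵇ ℂ)}
    (hX : X = (1, 0) + volterra A B X) : X = volterraSol A B := by
  have := Ring.inverse_mul_cancel _ (isUnit_one_sub_volterra A B)
  have h := congrArg (fun T => T X) this
  simp only [mul_apply_eq_comp, sub_apply,
    one_apply_eq_self] at h
  rw [← sub_eq_iff_eq_add] at hX
  rw [hX] at h
  exact h.symm

theorem continuous_volterraSol {T : Type*} [TopologicalSpace T] {A B : T → (ℝ →₁[volume] ℂ)}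
    (hA : Continuous A) (hB : Continuous B) : Continuous fun t => volterraSol (A t) (B t) := by
  have hV : Continuous fun t => 1 - volterra (A t) (B t) := by
    simp only [volterra_eq]
    fun_prop
  have : Continuous fun t => Ring.inverse (1 - volterra (A t) (B t)) := by
    refine continuous_iff_continuousAt.2 fun t => ?_
    obtain ⟨w, hw⟩ := isUnit_one_sub_volterra (A t) (B t)
    refine ContinuousAt.comp (g := Ring.inverse) ?_ hV.continuousAt
    rw [← hw]
    exact NormedRing.inverse_continuousAt (R := ((ℝ →ᵇ ℂ) × (ℝ →ᵇ ℂ)) →L[ℂ] ((ℝ →ᵇ ℂ) × (ℝ →ᵇ ℂ))) w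
  exact this.clm_apply continuous_const

theorem differentiable_inverse_one_sub_apply {X : Type*} [NormedAddCommGroup X] [NormedSpace ℂ X]
    [CompleteSpace X] {T : ℂ → X →L[ℂ] X} (hT : Differentiable ℂ T)
    (hu : ∀ t, IsUnit (1 - T t)) (x : X) :
    Differentiable ℂ fun t => Ring.inverse (1 - T t) x := fun t =>
  (DifferentiableAt.inverse ((differentiableAt_const _).sub (hT t)) (hu t)).clm_apply
    (differentiableAt_const _)

/-- The solution depends analytically on the coefficients. -/
theorem differentiable_volterraSol {A B : ℂ → (ℝ →₁[volume] ℂ)}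
    (hA : Differentiable ℂ A) (hB : Differentiable ℂ B) :
    Differentiable ℂ fun t => volterraSol (A t) (B t) := by
  refine differentiable_inverse_one_sub_apply ?_ (fun t => isUnit_one_sub_volterra (A t) (B t)) _
  simp only [volterra_eq]
  have h (C : ℂ → (ℝ →₁[volume] ℂ)) (hC : Differentiable ℂ C) :
      Differentiable ℂ fun t => primitiveCLM (C t) :=
    Differentiable.comp (𝕜 := ℂ) (F := (ℝ →₁[volume] ℂ)) (G := (ℝ →ᵇ ℂ) →L[ℂ] (ℝ →ᵇ ℂ))
      primitiveCLM.differentiable hC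
  exact ((differentiable_const _).clm_comp ((h A hA).clm_comp (differentiable_const _))).add
    ((differentiable_const _).clm_comp ((h B hB).clm_comp (differentiable_const _)))

/-! ### Volterra systems for functions -/

section

open Classical in
/-- The class of `f` in `L¹(ℝ)`, zero if `f` is not integrable. -/
def toLOne (f : ℝ → ℂ) : ℝ →₁[volume] ℂ := if h : Integrable f volume then h.toL1 f else 0

theorem toLOne_eq {f : ℝ → ℂ} (hf : Integrable f volume) : toLOne f = hf.toL1 f := dif_pos hf

theorem coeFn_toLOne {f : ℝ → ℂ} (hf : Integrable f volume) : toLOne f =ᵐ[volume] f := by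
  rw [toLOne_eq hf]; exact hf.coeFn_toL1

theorem toLOne_congr {f g : ℝ → ℂ} (h : f =ᵐ[volume] g) : toLOne f = toLOne g := by
  by_cases hf : Integrable f volume
  · rw [toLOne_eq hf, toLOne_eq (hf.congr h)]
    exact (Integrable.toL1_eq_toL1_iff _ _ _ _).2 h
  · rw [toLOne, toLOne, dif_neg hf, dif_neg fun hg => hf (hg.congr h.symm)]

theorem toLOne_add {f g : ℝ → ℂ} (hf : Integrable f volume) (hg : Integrable g volume) :
    toLOne (fun y => f y + g y) = toLOne f + toLOne g := by
  rw [toLOne_eq hf, toLOne_eq hg]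
  exact (toLOne_eq (hf.add hg)).trans (Integrable.toL1_add f g hf hg)

theorem toLOne_const_mul (c : ℂ) {f : ℝ → ℂ} (hf : Integrable f volume) :
    toLOne (fun y => c * f y) = c • toLOne f := by
  rw [toLOne_eq hf]
  exact (toLOne_eq (hf.const_mul c)).trans (Integrable.toL1_smul' f hf c)

/-- The first component of the solution of `f = 1 + ∫_{-∞}^x A g`, `g = ∫_{-∞}^x B f`. -/
def solF (A B : ℝ → ℂ) (x : ℝ) : ℂ := (volterraSol (toLOne A) (toLOne B)).1 x

/-- The second component of the solution of `f = 1 + ∫_{-∞}^x A g`, `g = ∫_{-∞}^x B f`. -/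
def solG (A B : ℝ → ℂ) (x : ℝ) : ℂ := (volterraSol (toLOne A) (toLOne B)).2 x

theorem continuous_solF (A B : ℝ → ℂ) : Continuous (solF A B) :=
  (volterraSol (toLOne A) (toLOne B)).1.continuous

theorem continuous_solG (A B : ℝ → ℂ) : Continuous (solG A B) :=
  (volterraSol (toLOne A) (toLOne B)).2.continuous

theorem memLp_bcf (f : ℝ →ᵇ ℂ) : MemLp f ∞ (volume : Measure ℝ) :=
  memLp_top_of_bound f.continuous.aestronglyMeasurable ‖f‖ (.of_forall f.norm_coe_le_norm)

theorem memLp_solF (A B : ℝ → ℂ) : MemLp (solF A B) ∞ volume :=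
  memLp_bcf (volterraSol (toLOne A) (toLOne B)).1

theorem memLp_solG (A B : ℝ → ℂ) : MemLp (solG A B) ∞ volume :=
  memLp_bcf (volterraSol (toLOne A) (toLOne B)).2

theorem _root_.MeasureTheory.Integrable.mul_memLp_top {A f : ℝ → ℂ} (hA : Integrable A volume)
    (hf : MemLp f ∞ volume) : Integrable (fun y => A y * f y) volume := by
  have h2 := hf.2
  obtain ⟨C, hC⟩ := eLpNormEssSup_lt_top_iff_isBoundedUnder.1 (by simpa using h2)
  refine hA.mul_bdd (c := C) hf.1 ?_
  filter_upwards [hC] with y hy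
  exact_mod_cast hy

variable {A B : ℝ → ℂ}

theorem solF_eq (hA : Integrable A volume) (x : ℝ) :
    solF A B x = 1 + ∫ y in Iic x, A y * solG A B y := by
  have := congrArg (fun X => X.1 x) (volterraSol_eq (toLOne A) (toLOne B))
  refine this.trans ?_
  simp only [Prod.fst_add, BoundedContinuousFunction.add_apply]
  congr 1
  refine setIntegral_congr_ae measurableSet_Iic ?_
  filter_upwards [coeFn_toLOne hA] with y hy _
  rw [hy]; rfl

theorem solG_eq (hB : Integrable B volume) (x : ℝ) :
    solG A B x = ∫ y in Iic x, B y * solF A B y := by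
  have := congrArg (fun X => X.2 x) (volterraSol_eq (toLOne A) (toLOne B))
  refine this.trans ?_
  simp only [Prod.snd_add, BoundedContinuousFunction.add_apply]
  rw [BoundedContinuousFunction.coe_zero, Pi.zero_apply, zero_add]
  refine setIntegral_congr_ae measurableSet_Iic ?_
  filter_upwards [coeFn_toLOne hB] with y hy _
  rw [hy]; rfl

/-- The system has one solution among essentially bounded functions: such a solution is bounded and
continuous by the equations. -/
theorem sol_unique (hA : Integrable A volume) (hB : Integrable B volume) {f g : ℝ → ℂ}
    (hf : MemLp f ∞ volume) (hg : MemLp g ∞ volume)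
    (h1 : ∀ x, f x = 1 + ∫ y in Iic x, A y * g y) (h2 : ∀ x, g x = ∫ y in Iic x, B y * f y) :
    f = solF A B ∧ g = solG A B := by
  have hiA := hA.mul_memLp_top hg
  have hiB := hB.mul_memLp_top hf
  let f' : ℝ →ᵇ ℂ := BoundedContinuousFunction.ofNormedAddCommGroup f
    (by rw [funext h1]; exact continuous_const.add (hasACDeriv_integral_Iic hiA).continuous)
    (1 + ∫ y, ‖A y * g y‖) fun x => by
      rw [h1]
      exact (norm_add_le _ _).trans (by simpa using norm_integral_Iic_le hiA x)
  let g' : ℝ →ᵇ ℂ := BoundedContinuousFunction.ofNormedAddCommGroup g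
    (by rw [funext h2]; exact (hasACDeriv_integral_Iic hiB).continuous)
    (∫ y, ‖B y * f y‖) fun x => by
      rw [h2]
      exact norm_integral_Iic_le hiB x
  have : (f', g') = volterraSol (toLOne A) (toLOne B) := by
    refine volterraSol_unique _ _ (Prod.ext ?_ ?_) <;> ext x
    · refine (h1 x).trans ?_
      simp only [Prod.fst_add, BoundedContinuousFunction.add_apply]
      congr 1
      refine setIntegral_congr_ae measurableSet_Iic ?_
      filter_upwards [coeFn_toLOne hA] with y hy _
      rw [hy]; rfl
    · refine (h2 x).trans ?_
      simp only [Prod.snd_add, BoundedContinuousFunction.add_apply]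
      rw [BoundedContinuousFunction.coe_zero, Pi.zero_apply, zero_add]
      refine setIntegral_congr_ae measurableSet_Iic ?_
      filter_upwards [coeFn_toLOne hB] with y hy _
      rw [hy]; rfl
  refine ⟨funext fun x => ?_, funext fun x => ?_⟩
  · exact congrArg (fun X => X.1 x) this
  · exact congrArg (fun X => X.2 x) this

theorem sol_congr {A' B' : ℝ → ℂ} (hA : A =ᵐ[volume] A') (hB : B =ᵐ[volume] B') :
    solF A B = solF A' B' ∧ solG A B = solG A' B' := by
  constructor <;> funext x
  · rw [solF, solF, toLOne_congr hA, toLOne_congr hB]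
  · rw [solG, solG, toLOne_congr hA, toLOne_congr hB]

/-- Moving a constant factor from one coefficient to the other rescales the second component. -/
theorem sol_scale (hA : Integrable A volume) (hB : Integrable B volume) (c : ℂ) :
    solF A (fun y => c * B y) = solF (fun y => c * A y) B ∧
      solG A (fun y => c * B y) = fun x => c * solG (fun y => c * A y) B x := by
  have := sol_unique (A := A) (B := fun y => c * B y) hA (hB.const_mul c)
    (f := solF (fun y => c * A y) B) (g := fun x => c * solG (fun y => c * A y) B x)
    (memLp_solF _ _) ((memLp_solG _ _).const_mul c)
    (fun x => by
      rw [solF_eq (hA.const_mul c)]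
      congr 2; funext y; ring)
    (fun x => by
      rw [solG_eq hB, ← integral_const_mul]
      congr 1; funext y; ring)
  exact ⟨this.1.symm, this.2.symm⟩

theorem hasACDeriv_solF (hA : Integrable A volume) :
    HasACDeriv (solF A B) (fun x => A x * solG A B x) := by
  have := (HasACDeriv.const 1).add
    (hasACDeriv_integral_Iic (hA.mul_memLp_top (memLp_solG A B)))
  simp only [zero_add] at this
  rwa [← funext (solF_eq (B := B) hA)] at this

theorem hasACDeriv_solG (hB : Integrable B volume) :
    HasACDeriv (solG A B) (fun x => B x * solF A B x) := by
  have := hasACDeriv_integral_Iic (hB.mul_memLp_top (memLp_solF A B))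
  rwa [← funext (solG_eq (A := A) hB)] at this

theorem tendsto_solF (hA : Integrable A volume) : Tendsto (solF A B) atBot (𝓝 1) := by
  have := (tendsto_integral_Iic_atBot (hA.mul_memLp_top (memLp_solG A B))).const_add 1
  rw [add_zero] at this
  rwa [funext (solF_eq (B := B) hA)]

theorem tendsto_solG (hB : Integrable B volume) : Tendsto (solG A B) atBot (𝓝 0) := by
  have := tendsto_integral_Iic_atBot (hB.mul_memLp_top (memLp_solF A B))
  rwa [funext (solG_eq (A := A) hB)]

/-- The pointwise Gronwall bound. -/
theorem norm_solF_add_norm_solG_le (hA : Integrable A volume) (hB : Integrable B volume) (x : ℝ) :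
    ‖solF A B x‖ + ‖solG A B x‖ ≤ Real.exp (∫ t, (‖A t‖ + ‖B t‖)) := by
  set X := volterraSol (toLOne A) (toLOne B)
  have h := lintegral_Iic_le_gronwall (h := fun t => ‖A t‖ + ‖B t‖) (hA.norm.add hB.norm)
    (fun t => by positivity) (f := fun x => ‖solF A B x‖ₑ + ‖solG A B x‖ₑ) (c := 1)
    (M := ‖X.1‖ₑ + ‖X.2‖ₑ) (by simp) (x₀ := x)
    (fun y _ => add_le_add (enorm_le_iff_norm_le.2 (X.1.norm_coe_le_norm y))
      (enorm_le_iff_norm_le.2 (X.2.norm_coe_le_norm y)))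
    (fun y _ => by
      rw [solF_eq hA, solG_eq hB]
      refine (add_le_add_left (enorm_add_le _ _) _).trans ?_
      rw [enorm_one, add_assoc]
      refine add_le_add_right ((add_le_add (enorm_integral_le_lintegral_enorm _)
        (enorm_integral_le_lintegral_enorm _)).trans ((le_lintegral_add _ _).trans
        (lintegral_mono fun t => ?_))) _
      simp only [enorm_mul]
      rw [ENNReal.ofReal_add (norm_nonneg _) (norm_nonneg _), ofReal_norm, ofReal_norm]
      rw [add_mul]
      exact add_le_add (by gcongr; exact le_add_self) (by gcongr; exact le_self_add))
  rw [one_mul, ← ofReal_norm, ← ofReal_norm, ← ENNReal.ofReal_add (norm_nonneg _) (norm_nonneg _)]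
    at h
  exact (ENNReal.ofReal_le_ofReal_iff (Real.exp_nonneg _)).1 h

/-! ### Oscillating coefficients -/

/-- The exponential `e^{2izy}`. -/
def osc (z y : ℝ) : ℂ := Complex.exp (2 * Complex.I * z * y)

theorem osc_eq (z y : ℝ) : osc z y = Complex.exp ((2 * z * y : ℝ) * Complex.I) := by
  rw [osc]; congr 1; push_cast; ring

@[simp] theorem norm_osc (z y : ℝ) : ‖osc z y‖ = 1 := by
  rw [osc_eq, Complex.norm_exp_ofReal_mul_I]

@[simp] theorem osc_zero_left (y : ℝ) : osc 0 y = 1 := by simp [osc]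
@[simp] theorem osc_zero_right (z : ℝ) : osc z 0 = 1 := by simp [osc]

theorem osc_add (z h y : ℝ) : osc (z + h) y = osc z y * osc h y := by
  rw [osc, osc, osc, ← Complex.exp_add]; congr 1; push_cast; ring

theorem osc_neg_mul_self (z y : ℝ) : osc (-z) y * osc z y = 1 := by
  rw [← osc_add]; simp

theorem osc_neg_right (z y : ℝ) : osc z (-y) = osc (-z) y := by
  rw [osc, osc]; congr 1; push_cast; ring

theorem continuous_osc : Continuous fun p : ℝ × ℝ => osc p.1 p.2 := by
  unfold osc; fun_prop

@[fun_prop] theorem Continuous.osc {X : Type*} [TopologicalSpace X] {f g : X → ℝ}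
    (hf : Continuous f) (hg : Continuous g) : Continuous fun x => NDNLS.osc (f x) (g x) :=
  continuous_osc.comp (hf.prodMk hg)

theorem norm_osc_sub_one_le (h y : ℝ) : ‖osc h y - 1‖ ≤ 2 * |h| * |y| := by
  rw [osc_eq, mul_comm]
  refine (Real.norm_exp_I_mul_ofReal_sub_one_le).trans ?_
  rw [Real.norm_eq_abs, abs_mul, abs_mul, abs_two]

theorem hasDerivAt_osc (z y : ℝ) : HasDerivAt (osc z) (2 * Complex.I * z * osc z y) y := by
  have h1 : HasDerivAt (fun y : ℝ => 2 * Complex.I * z * (y : ℂ)) (2 * Complex.I * z * 1) y :=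
    (Complex.ofRealCLM.hasDerivAt (x := y)).const_mul _
  convert! h1.cexp using 1
  rw [osc]; ring

theorem hasACDeriv_osc (z : ℝ) : HasACDeriv (osc z) (fun y => 2 * Complex.I * z * osc z y) :=
  .of_hasDerivAt (hasDerivAt_osc z) (by fun_prop)

/-- The modulated coefficient `y ↦ e^{2izy} U(y)`. -/
def modul (z : ℝ) (U : ℝ → ℂ) (y : ℝ) : ℂ := osc z y * U y

theorem integrable_modul {U : ℝ → ℂ} (hU : Integrable U volume) (z : ℝ) :
    Integrable (modul z U) volume := by
  refine hU.bdd_mul (c := 1) ?_ (.of_forall fun y => (norm_osc z y).le)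
  exact (by fun_prop : Continuous fun y => osc z y).aestronglyMeasurable

theorem norm_modul (z : ℝ) (U : ℝ → ℂ) (y : ℝ) : ‖modul z U y‖ = ‖U y‖ := by
  simp [modul]

theorem modul_congr {U V : ℝ → ℂ} (h : U =ᵐ[volume] V) (z : ℝ) :
    modul z U =ᵐ[volume] modul z V := by
  filter_upwards [h] with y hy
  rw [modul, modul, hy]

/-- Modulation is continuous in `L¹`, by dominated convergence; with `continuous_volterraSol` the
solutions are continuous in `z`. -/
theorem continuous_toLOne_modul {U : ℝ → ℂ} (hU : Integrable U volume) :
    Continuous fun z => toLOne (modul z U) := by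
  refine continuous_iff_continuousAt.2 fun z₀ => ?_
  rw [ContinuousAt, tendsto_iff_dist_tendsto_zero]
  have h : ∀ z, dist (toLOne (modul z U)) (toLOne (modul z₀ U)) =
      ∫ y, ‖modul z U y - modul z₀ U y‖ := fun z => by
    rw [toLOne_eq (integrable_modul hU z), toLOne_eq (integrable_modul hU z₀), dist_eq_norm,
      ← Integrable.toL1_sub, L1.norm_of_fun_eq_integral_norm]
    rfl
  simp only [h]
  have := tendsto_integral_filter_of_dominated_convergence (l := 𝓝 z₀)
    (F := fun z y => ‖modul z U y - modul z₀ U y‖) (f := fun _ => 0) (μ := volume)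
    (fun y => 2 * ‖U y‖)
    (.of_forall fun z => ((integrable_modul hU z).sub (integrable_modul hU z₀)).norm.1)
    (.of_forall fun z => .of_forall fun y => by
      rw [norm_norm, two_mul]
      exact (norm_sub_le _ _).trans (by rw [norm_modul, norm_modul]))
    (hU.norm.const_mul 2)
    (.of_forall fun y => by
      have : Continuous fun z => ‖modul z U y - modul z₀ U y‖ := by unfold modul; fun_prop
      simpa using this.tendsto z₀)
  simpa using this

end

/-! ### Inequalities in `L²` -/

theorem eLpNorm_two_sq {α : Type*} {mα : MeasurableSpace α} {μ : Measure α} (f : α → ℂ) :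
    eLpNorm f 2 μ ^ 2 = ∫⁻ x, ‖f x‖ₑ ^ 2 ∂μ := by
  rw [eLpNorm_eq_lintegral_rpow_enorm_toReal two_ne_zero ENNReal.ofNat_ne_top]
  simp only [ENNReal.toReal_ofNat, ENNReal.rpow_ofNat]
  rw [← ENNReal.rpow_natCast, ← ENNReal.rpow_mul]; norm_num

/-- Minkowski's integral inequality in `L²`: the norm of an integral is at most the integral of
the norms. -/
theorem eLpNorm_integral_le {α β : Type*} {mα : MeasurableSpace α} {mβ : MeasurableSpace β}
    {ν : Measure α} {μ : Measure β} [SFinite ν] [SFinite μ] {K : α → β → ℂ}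
    (hK : AEStronglyMeasurable (Function.uncurry K) (ν.prod μ)) :
    eLpNorm (fun z => ∫ y, K y z ∂ν) 2 μ ≤ ∫⁻ y, eLpNorm (K y) 2 μ ∂ν := by
  set k : α → β → ℝ≥0∞ := fun y z => ‖hK.mk _ (y, z)‖ₑ with hk
  have hkm : Measurable (Function.uncurry k) :=
    hK.stronglyMeasurable_mk.enorm
  have h1 : ∀ᵐ y ∂ν, ∀ᵐ z ∂μ, ‖K y z‖ₑ = k y z := by
    filter_upwards [Measure.ae_ae_of_ae_prod hK.ae_eq_mk] with y hy
    filter_upwards [hy] with z hz using congrArg (‖·‖ₑ) hz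
  have h2 : ∀ᵐ z ∂μ, ∀ᵐ y ∂ν, ‖K y z‖ₑ = k y z := by
    have := Measure.ae_ae_of_ae_prod (Measure.measurePreserving_swap.quasiMeasurePreserving.ae
      hK.ae_eq_mk)
    filter_upwards [this] with z hz
    filter_upwards [hz] with y hy using congrArg (‖·‖ₑ) hy
  set n : α → ℝ≥0∞ := fun y => (∫⁻ z, k y z ^ 2 ∂μ) ^ (1 / 2 : ℝ) with hn
  have hnm : Measurable n := (hkm.pow_const 2).lintegral_prod_right'.pow_const _
  have hR : ∫⁻ y, eLpNorm (K y) 2 μ ∂ν = ∫⁻ y, n y ∂ν := by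
    refine lintegral_congr_ae ?_
    filter_upwards [h1] with y hy
    rw [hn, eLpNorm_eq_lintegral_rpow_enorm_toReal two_ne_zero ENNReal.ofNat_ne_top]
    simp only [ENNReal.toReal_ofNat, ENNReal.rpow_ofNat]
    congr 1
    refine lintegral_congr_ae ?_
    filter_upwards [hy] with z hz
    rw [hz]
  rw [hR]
  have hpw (y y' : α) : ∫⁻ z, k y z * k y' z ∂μ ≤ n y * n y' := by
    have := ENNReal.lintegral_mul_le_Lp_mul_Lq μ Real.HolderConjugate.two_two
      (hkm.comp measurable_prodMk_left).aemeasurable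
      (hkm.comp (measurable_prodMk_left (x := y'))).aemeasurable (f := k y) (g := k y')
    simpa [hn] using this
  -- the square of the integral is a double integral, to which the Cauchy–Schwarz inequality
  -- applies pointwise
  refine (ENNReal.pow_le_pow_left_iff two_ne_zero).1 ?_
  rw [eLpNorm_two_sq]
  calc ∫⁻ z, ‖∫ y, K y z ∂ν‖ₑ ^ 2 ∂μ ≤ ∫⁻ z, (∫⁻ y, k y z ∂ν) ^ 2 ∂μ := by
        refine lintegral_mono_ae ?_
        filter_upwards [h2] with z hz
        gcongr
        refine (enorm_integral_le_lintegral_enorm _).trans (lintegral_congr_ae hz).le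
    _ = ∫⁻ z, ∫⁻ p : α × α, k p.1 z * k p.2 z ∂(ν.prod ν) ∂μ := by
        refine lintegral_congr fun z => ?_
        have hz : Measurable fun y => k y z := hkm.comp measurable_prodMk_right
        rw [sq, ← lintegral_prod_mul hz.aemeasurable hz.aemeasurable]
    _ = ∫⁻ p : α × α, ∫⁻ z, k p.1 z * k p.2 z ∂μ ∂(ν.prod ν) := by
        refine lintegral_lintegral_swap (Measurable.aemeasurable ?_)
        exact (hkm.comp ((measurable_fst.comp measurable_snd).prodMk measurable_fst)).mul
          (hkm.comp ((measurable_snd.comp measurable_snd).prodMk measurable_fst))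
    _ ≤ ∫⁻ p : α × α, n p.1 * n p.2 ∂(ν.prod ν) := lintegral_mono fun p => hpw _ _
    _ = (∫⁻ y, n y ∂ν) ^ 2 := by
        rw [sq, ← lintegral_prod_mul hnm.aemeasurable hnm.aemeasurable]

open scoped FourierTransform in
/-- Plancherel's inequality for the Fourier integral of a function in `L¹ ∩ L²`. -/
theorem eLpNorm_fourier_le {V : ℝ → ℂ} (h1 : Integrable V volume) (h2 : MemLp V 2 volume) :
    eLpNorm (𝓕 V) 2 volume ≤ eLpNorm V 2 volume := by
  set f : Lp ℂ 2 (volume : Measure ℝ) := h2.toLp V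
  have hc : Continuous (𝓕 V) := VectorFourier.fourierIntegral_continuous
    Real.continuous_fourierChar (by exact continuous_inner) h1
  have hL1 : LocallyIntegrable (𝓕 f : Lp ℂ 2 (volume : Measure ℝ)) volume :=
    (Lp.memLp _).locallyIntegrable (by norm_num)
  -- the Fourier integral agrees with the unitary Fourier transform of `L²` as a distribution
  have hae : 𝓕 V =ᵐ[volume] (𝓕 f : Lp ℂ 2 (volume : Measure ℝ)) := by
    refine ae_eq_of_integral_contDiff_smul_eq hc.locallyIntegrable hL1 fun g hg hgc => ?_
    have hg' : ContDiff ℝ ∞ fun x => (g x : ℂ) := Complex.ofRealCLM.contDiff.comp hg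
    have hgc' : HasCompactSupport fun x => (g x : ℂ) := hgc.comp_left (g := Complex.ofReal) rfl
    set G := hgc'.toSchwartzMap hg'
    have e1 := congrArg (fun T => T G) (Lp.fourier_toTemperedDistribution_eq f)
    simp only [TemperedDistribution.fourier_apply, Lp.toTemperedDistribution_apply] at e1
    have e2 : ∫ x, 𝓕 G x • f x = ∫ x, 𝓕 G x • V x := by
      refine integral_congr_ae ?_
      filter_upwards [h2.coeFn_toLp] with x hx
      rw [hx]
    have e3 := VectorFourier.integral_fourierIntegral_smul_eq_flip (L := innerₗ ℝ)
      (μ := volume) (ν := volume) Real.continuous_fourierChar (by exact continuous_inner)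
      G.integrable h1
    have e4 : ∫ x, 𝓕 G x • V x = ∫ x, G x • 𝓕 V x := by
      rw [flip_innerₗ] at e3
      exact e3
    have e5 (F : ℝ → ℂ) : ∫ x, g x • F x = ∫ x, G x • F x :=
      integral_congr_ae (.of_forall fun x => Complex.real_smul)
    rw [e5, e5, ← e4, ← e2, e1]
  rw [eLpNorm_congr_ae hae, ← Lp.enorm_def, ← ofReal_norm, Lp.norm_fourier_eq, ofReal_norm,
    Lp.enorm_def, eLpNorm_congr_ae h2.coeFn_toLp]

open scoped FourierTransform in
/-- Plancherel's inequality in the variable `z`. The substitution `ξ = z / π` costs a factor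
`√π ≤ 2`. -/
theorem eLpNorm_integral_modul_le {V : ℝ → ℂ} (h1 : Integrable V volume) (h2 : MemLp V 2 volume) :
    eLpNorm (fun z => ∫ y, modul (-z) V y) 2 volume ≤ 2 * eLpNorm V 2 volume := by
  have hc : Continuous (𝓕 V) := VectorFourier.fourierIntegral_continuous
    Real.continuous_fourierChar (by exact continuous_inner) h1
  have he : (fun z => ∫ y, modul (-z) V y) = 𝓕 V ∘ (Real.pi⁻¹ * ·) := by
    funext z
    rw [Function.comp, Real.fourier_real_eq_integral_exp_smul]
    refine integral_congr_ae (.of_forall fun y => ?_)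
    simp only [modul, smul_eq_mul, osc]
    congr 2
    have := Real.pi_ne_zero
    push_cast
    field_simp
  rw [he, ← eLpNorm_map_measure hc.aestronglyMeasurable (by fun_prop),
    Real.map_volume_mul_left (by positivity), eLpNorm_smul_measure_of_ne_top (by norm_num)]
  refine mul_le_mul' ?_ (eLpNorm_fourier_le h1 h2)
  rw [inv_inv, abs_of_pos Real.pi_pos]
  refine (ENNReal.rpow_le_rpow (ENNReal.ofReal_le_ofReal Real.pi_le_four) (by positivity)).trans ?_
  rw [ENNReal.ofReal_rpow_of_pos (by norm_num)]
  have : ((4 : ℝ) ^ (1 / 2 : ℝ≥0∞).toReal) = 2 := by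
    rw [show (4 : ℝ) = 2 ^ (2 : ℝ) by norm_num, ← Real.rpow_mul (by norm_num)]
    simp
  rw [this]; simp

theorem eLpNorm_le_of_tendsto {f : ℕ → ℝ → ℂ} {F : ℝ → ℂ} {C : ℝ≥0∞}
    (hf : ∀ n, AEStronglyMeasurable (f n) volume)
    (hlim : ∀ z, Tendsto (fun n => f n z) atTop (𝓝 (F z))) (hC : ∀ n, eLpNorm (f n) 2 volume ≤ C) :
    eLpNorm F 2 volume ≤ C :=
  (Lp.eLpNorm_lim_le_liminf_eLpNorm hf F (.of_forall hlim)).trans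
    (liminf_le_of_frequently_le' (Frequently.of_forall hC))

theorem eLpNorm_le_of_restrict {F : ℝ → ℂ} {C : ℝ≥0∞} (hF : AEStronglyMeasurable F volume)
    (hC : ∀ N : ℕ, eLpNorm F 2 (volume.restrict (Icc (-N : ℝ) N)) ≤ C) :
    eLpNorm F 2 volume ≤ C := by
  refine eLpNorm_le_of_tendsto (f := fun N : ℕ => (Icc (-N : ℝ) N).indicator F)
    (fun N => hF.indicator measurableSet_Icc) (fun z => ?_) fun N => ?_
  · refine tendsto_const_nhds.congr' ?_
    obtain ⟨N, hN⟩ := exists_nat_ge |z|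
    filter_upwards [eventually_ge_atTop N] with n hn
    have : |z| ≤ n := hN.trans (by exact_mod_cast hn)
    rw [indicator_of_mem]
    exact abs_le.1 this
  · rw [eLpNorm_indicator_eq_eLpNorm_restrict measurableSet_Icc]
    exact hC N

/-- A family of functions that is entire in a parameter and bounded in `L²` on a large disc is
Lipschitz in the parameter, by Cauchy's formula. -/
theorem eLpNorm_sub_le_of_differentiable {G : ℂ → ℝ → ℂ} {R : ℝ} (hR : 1 < R)
    (hd : ∀ z, Differentiable ℂ fun τ => G τ z) (hm : ∀ τ, Measurable (G τ)) {M : ℝ≥0∞}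
    (hM : ∀ τ, ‖τ‖ ≤ R → eLpNorm (G τ) 2 volume ≤ M) :
    eLpNorm (fun z => G 1 z - G 0 z) 2 volume ≤ M * ENNReal.ofReal (1 / (R - 1)) := by
  have hR0 : 0 < R := by linarith
  -- the difference of the Cauchy kernels for the points `1` and `0`
  set w : ℝ → ℂ := fun θ => (2 * Real.pi * Complex.I : ℂ)⁻¹ *
    (deriv (circleMap 0 R) θ * ((circleMap 0 R θ - 1)⁻¹ - (circleMap 0 R θ - 0)⁻¹)) with hw
  have hne (θ : ℝ) : circleMap 0 R θ - 1 ≠ 0 := fun h => by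
    have := congrArg norm (sub_eq_zero.1 h)
    simp [abs_of_pos hR0] at this; linarith
  have hne0 (θ : ℝ) : circleMap 0 R θ ≠ 0 := circleMap_ne_center hR0.ne'
  have hwc : Continuous w := by
    have h1 : Continuous (circleMap 0 R) := continuous_circleMap 0 R
    have h2 : Continuous fun θ => (circleMap 0 R θ - 1)⁻¹ := (h1.sub continuous_const).inv₀ hne
    have h3 : Continuous fun θ => (circleMap 0 R θ - 0)⁻¹ :=
      (h1.sub continuous_const).inv₀ (by simpa using hne0)
    simp only [hw, deriv_circleMap]
    fun_prop
  have hwb (θ : ℝ) : ‖w θ‖ ≤ (2 * Real.pi)⁻¹ * (1 / (R - 1)) := by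
    have h1 : (circleMap 0 R θ - 1)⁻¹ - (circleMap 0 R θ - 0)⁻¹ =
        (circleMap 0 R θ * (circleMap 0 R θ - 1))⁻¹ := by
      have := hne θ; have := hne0 θ
      field_simp; ring
    have h2 : R - 1 ≤ ‖circleMap 0 R θ - 1‖ := by
      have := norm_sub_norm_le (circleMap 0 R θ) 1
      simpa [abs_of_pos hR0] using this
    have h3 : 0 < R - 1 := by linarith
    rw [hw]
    simp only [h1, norm_mul, norm_inv, deriv_circleMap, norm_circleMap_zero, abs_of_pos hR0,
      Complex.norm_I, Complex.norm_real, Complex.norm_ofNat, Real.norm_eq_abs,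
      abs_of_pos Real.pi_pos, mul_one]
    gcongr
    rw [mul_inv, ← mul_assoc, mul_inv_cancel₀ hR0.ne', one_mul, one_div]
    gcongr
  have key (z : ℝ) : G 1 z - G 0 z = ∫ θ in Ioc 0 (2 * Real.pi), w θ * G (circleMap 0 R θ) z := by
    have hc (p : ℂ) (hp : p ∈ Metric.ball (0 : ℂ) R) :=
      Complex.two_pi_I_inv_smul_circleIntegral_sub_inv_smul_of_differentiable_on_off_countable
      (R := R) (c := 0) (f := fun τ => G τ z) countable_empty hp
      (hd z).continuous.continuousOn fun x _ => (hd z) x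
    have hGc : Continuous fun θ => G (circleMap 0 R θ) z :=
      (hd z).continuous.comp (continuous_circleMap 0 R)
    rw [← hc 1 (by simpa using hR), ← hc 0 (by simpa using hR0), ← smul_sub,
      ← intervalIntegral.integral_of_le (by positivity)]
    simp only [circleIntegral]
    have h1 : Continuous (circleMap 0 R) := continuous_circleMap 0 R
    have h2 : Continuous fun θ => (circleMap 0 R θ - 1)⁻¹ := (h1.sub continuous_const).inv₀ hne
    have h3 : Continuous fun θ => (circleMap 0 R θ - 0)⁻¹ :=
      (h1.sub continuous_const).inv₀ (by simpa using hne0)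
    rw [← intervalIntegral.integral_sub, smul_eq_mul, ← intervalIntegral.integral_const_mul]
    · refine intervalIntegral.integral_congr fun θ _ => ?_
      simp only [hw, smul_eq_mul]; ring
    · refine Continuous.intervalIntegrable ?_ _ _
      simp only [deriv_circleMap, smul_eq_mul]
      exact (h1.mul continuous_const).mul (h2.mul hGc)
    · refine Continuous.intervalIntegrable ?_ _ _
      simp only [deriv_circleMap, smul_eq_mul]
      exact (h1.mul continuous_const).mul (h3.mul hGc)
  simp only [key]
  have hmeas : Measurable (Function.uncurry fun θ z => G (circleMap 0 R θ) z) :=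
    measurable_uncurry_of_continuous_of_measurable
      (fun z => (hd z).continuous.comp (continuous_circleMap 0 R)) fun θ => hm _
  refine (eLpNorm_integral_le (K := fun θ z => w θ * G (circleMap 0 R θ) z) ?_).trans ?_
  · exact ((hwc.measurable.comp measurable_fst).mul hmeas).aestronglyMeasurable
  · have hb (θ : ℝ) : eLpNorm (fun z => w θ * G (circleMap 0 R θ) z) 2 volume ≤
        ENNReal.ofReal ((2 * Real.pi)⁻¹ * (1 / (R - 1))) * M := by
      have : eLpNorm (fun z => w θ * G (circleMap 0 R θ) z) 2 volume =
          ‖w θ‖ₑ * eLpNorm (G (circleMap 0 R θ)) 2 volume :=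
        eLpNorm_const_smul (w θ) (G (circleMap 0 R θ)) 2 volume
      rw [this, ← ofReal_norm]
      exact mul_le_mul' (ENNReal.ofReal_le_ofReal (hwb θ)) (hM _ (by simp [abs_of_pos hR0]))
    refine (lintegral_mono hb).trans (le_of_eq ?_)
    have hR1 : 0 < R - 1 := by linarith
    rw [setLIntegral_const, Real.volume_Ioc, sub_zero, mul_comm, ← mul_assoc, mul_comm M,
      ← ENNReal.ofReal_mul (by positivity)]
    congr 2
    have := Real.pi_pos
    field_simp

/-! ### Weak derivatives -/

theorem integrable_smul_of_locallyIntegrable {θ : ℝ → ℝ} (hθ : Continuous θ)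
    (hc : HasCompactSupport θ) {f : ℝ → ℂ} (hf : LocallyIntegrable f volume) :
    Integrable (fun x => θ x • f x) volume :=
  hf.integrable_smul_left_of_hasCompactSupport hθ hc

theorem HasWeakDeriv.ae_unique {j : ℕ} {f g g' : ℝ → ℂ} (hg : LocallyIntegrable g volume)
    (hg' : LocallyIntegrable g' volume) (h : HasWeakDeriv j f g) (h' : HasWeakDeriv j f g') :
    g =ᵐ[volume] g' :=
  ae_eq_of_integral_contDiff_smul_eq hg hg' fun θ hθ hc => by
    have := (h θ hθ hc).symm.trans (h' θ hθ hc)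
    exact mul_left_cancel₀ (by simp) this

theorem weakDeriv_spec {j : ℕ} {f g : ℝ → ℂ} (hg : LocallyIntegrable g volume)
    (h : HasWeakDeriv j f g) : LocallyIntegrable (weakDeriv j f) volume ∧
      HasWeakDeriv j f (weakDeriv j f) ∧ weakDeriv j f =ᵐ[volume] g := by
  have hex : ∃ g : ℝ → ℂ, LocallyIntegrable g volume ∧ HasWeakDeriv j f g := ⟨g, hg, h⟩
  have hs := hex.choose_spec
  rw [weakDeriv, dif_pos hex]
  exact ⟨hs.1, hs.2, hs.2.ae_unique hs.1 hg h⟩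

theorem HasWeakDeriv.congr {j : ℕ} {f g f' : ℝ → ℂ} (h : HasWeakDeriv j f g)
    (hf : f =ᵐ[volume] f') : HasWeakDeriv j f' g := fun θ hθ hc => by
  rw [← h θ hθ hc]
  refine integral_congr_ae ?_
  filter_upwards [hf] with x hx
  rw [hx]

/-- A bounded sequence in a Hilbert space has a weak limit along the hyperfilter. -/
theorem exists_tendsto_inner_hyperfilter {H : Type*} [NormedAddCommGroup H]
    [InnerProductSpace ℂ H] [CompleteSpace H] (X : ℕ → H) {C : ℝ} (hX : ∀ n, ‖X n‖ ≤ C) :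
    ∃ g : H, ‖g‖ ≤ C ∧
      ∀ y, Tendsto (fun n => inner ℂ (X n) y) (hyperfilter ℕ) (𝓝 (inner ℂ g y)) := by
  set Λ : ℕ → WeakDual ℂ H := fun n => StrongDual.toWeakDual (InnerProductSpace.toDual ℂ _ (X n))
  obtain ⟨Λ', hΛ', hlim⟩ := (WeakDual.isCompact_closedBall (𝕜 := ℂ)
    (E := H) 0 C).ultrafilter_le_nhds ((hyperfilter ℕ).map Λ) (by
      rw [Ultrafilter.coe_map, le_principal_iff]
      refine Filter.Eventually.of_forall (p := fun n => Λ n ∈ _) fun n => ?_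
      change dist (InnerProductSpace.toDual ℂ _ (X n)) 0 ≤ C
      rw [dist_zero_right]
      exact ((InnerProductSpace.toDual ℂ _).norm_map (X n)).le.trans (hX n))
  refine ⟨(InnerProductSpace.toDual ℂ _).symm (WeakDual.toStrongDual Λ'), ?_, fun y => ?_⟩
  · rw [LinearIsometryEquiv.norm_map]
    have : dist (WeakDual.toStrongDual Λ') 0 ≤ C := hΛ'
    rwa [dist_zero_right] at this
  · have h1 : Tendsto (fun n => Λ n y) (hyperfilter ℕ) (𝓝 (Λ' y)) :=
      ((WeakDual.eval_continuous y).tendsto Λ').comp hlim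
    have h2 : inner ℂ ((InnerProductSpace.toDual ℂ _).symm (WeakDual.toStrongDual Λ')) y =
        Λ' y := by
      rw [← InnerProductSpace.toDual_apply_apply]
      simp
    rw [h2]
    exact h1

/-- A function whose difference quotients are bounded in `L²` has a weak derivative in `L²`: a weak
limit of the difference quotients, which exists by the Banach–Alaoglu theorem. -/
theorem exists_hasWeakDeriv_of_diffQuotient {F : ℝ → ℂ} {C : ℝ≥0} (hc : Continuous F)
    (hdq : ∀ h : ℝ, eLpNorm (fun z => F (z + h) - F z) 2 volume ≤ C * ‖h‖ₑ) :
    ∃ g : ℝ → ℂ, HasWeakDeriv 1 F g ∧ MemLp g 2 volume ∧ eLpNorm g 2 volume ≤ C := by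
  -- difference quotients with steps `t n → 0`
  set t : ℕ → ℝ := fun n => 1 / ((n : ℝ) + 1) with ht
  have ht0 (n) : 0 < t n := by positivity
  have htlim : Tendsto t atTop (𝓝 0) := tendsto_one_div_add_atTop_nhds_zero_nat
  set D : ℕ → ℝ → ℂ := fun n z => ((t n)⁻¹ : ℂ) * (F (z + t n) - F z) with hD
  have hDc (n) : Continuous (D n) := by fun_prop
  have hDn (n) : eLpNorm (D n) 2 volume ≤ C := by
    have h1 : eLpNorm (D n) 2 volume =
        ‖((t n)⁻¹ : ℂ)‖ₑ * eLpNorm (fun z => F (z + t n) - F z) 2 volume :=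
      eLpNorm_const_smul ((t n)⁻¹ : ℂ) (fun z => F (z + t n) - F z) 2 volume
    rw [h1]
    refine (mul_le_mul_right (hdq (t n)) _).trans (le_of_eq ?_)
    have h2 : ‖((t n)⁻¹ : ℂ)‖ₑ = ‖t n‖ₑ⁻¹ := by
      rw [← enorm_inv (ht0 n).ne', ← ofReal_norm, ← ofReal_norm, ← Complex.ofReal_inv,
        Complex.norm_real]
    rw [h2, mul_left_comm, ENNReal.inv_mul_cancel (by simpa using (ht0 n).ne') (by simp), mul_one]
  have hDL (n) : MemLp (D n) 2 volume :=
    ⟨(hDc n).aestronglyMeasurable, (hDn n).trans_lt ENNReal.coe_lt_top⟩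
  set X : ℕ → Lp ℂ 2 (volume : Measure ℝ) := fun n => (hDL n).toLp
  have hX (n) : ‖X n‖ ≤ C := by
    rw [Lp.norm_toLp]
    exact ENNReal.toReal_le_of_le_ofReal C.2 (by simpa using hDn n)
  obtain ⟨g, hgn, hev⟩ := exists_tendsto_inner_hyperfilter X hX
  refine ⟨g, fun θ hθ hθc => ?_, Lp.memLp g, ?_⟩
  swap
  · rw [← Lp.enorm_def, ← ofReal_norm]
    exact (ENNReal.ofReal_le_ofReal hgn).trans (by simp)
  have hθC : Continuous θ := hθ.continuous
  have hθL : MemLp (fun x => (θ x : ℂ)) 2 volume :=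
    (Complex.continuous_ofReal.comp hθC).memLp_of_hasCompactSupport
      (hθc.comp_left (g := Complex.ofReal) rfl)
  have hinner (Y : Lp ℂ 2 (volume : Measure ℝ)) :
      conj (inner ℂ Y hθL.toLp) = ∫ x, θ x • Y x := by
    rw [L2.inner_def, ← integral_conj]
    refine integral_congr_ae ?_
    filter_upwards [hθL.coeFn_toLp] with x hx
    rw [hx]
    simp
  have hl1 : Tendsto (fun n => ∫ x, θ x • D n x) (hyperfilter ℕ) (𝓝 (∫ x, θ x • g x)) := by
    rw [← hinner]
    refine (Complex.continuous_conj.tendsto _ |>.comp (hev hθL.toLp)).congr fun n => ?_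
    rw [Function.comp, hinner]
    refine integral_congr_ae ?_
    filter_upwards [(hDL n).coeFn_toLp] with x hx
    rw [hx]
  obtain ⟨K, hK⟩ := hθ.lipschitzWith_of_hasCompactSupport hθc (by simp)
  have hshift (n : ℕ) : ∫ x, θ x • D n x = ∫ x, ((t n)⁻¹ * (θ (x - t n) - θ x)) • F x := by
    have i1 : Integrable fun x => θ x • F (x + t n) :=
      integrable_smul_of_locallyIntegrable hθC hθc (by fun_prop : Continuous _).locallyIntegrable
    have i2 : Integrable fun x => θ x • F x :=
      integrable_smul_of_locallyIntegrable hθC hθc hc.locallyIntegrable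
    have i3 : Integrable fun x => θ (x - t n) • F x := by
      simpa using i1.comp_sub_right (t n)
    have e1 : ∫ x, θ x • F (x + t n) = ∫ x, θ (x - t n) • F x := by
      rw [← integral_sub_right_eq_self _ (t n)]
      simp
    calc ∫ x, θ x • D n x = ∫ x, ((t n)⁻¹ : ℂ) * (θ x • F (x + t n) - θ x • F x) :=
          integral_congr_ae (.of_forall fun x => by
            simp only [hD, Complex.real_smul]; ring)
      _ = ((t n)⁻¹ : ℂ) * ((∫ x, θ (x - t n) • F x) - ∫ x, θ x • F x) := by
          rw [integral_const_mul, integral_sub i1 i2, e1]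
      _ = _ := by
          rw [← integral_sub i3 i2, ← integral_const_mul]
          refine integral_congr_ae (.of_forall fun x => ?_)
          simp only [Complex.real_smul]; push_cast; ring
  obtain ⟨r, hr⟩ := hθc.isCompact.isBounded.subset_closedBall 0
  -- on the other hand, the difference quotients converge to the distributional derivative
  have hl2 : Tendsto (fun n => ∫ x, θ x • D n x) atTop (𝓝 (∫ x, (-deriv θ x) • F x)) := by
    simp only [hshift]
    refine tendsto_integral_filter_of_dominated_convergence
      ((Metric.closedBall (0 : ℝ) (r + 1)).indicator fun x => K * ‖F x‖) ?_ ?_ ?_ ?_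
    · exact .of_forall fun n => (by fun_prop : Continuous _).aestronglyMeasurable
    · refine .of_forall fun n => .of_forall fun x => ?_
      have ht1 : t n ≤ 1 := by
        rw [ht]; exact (div_le_one (by positivity)).2 (by linarith [(n.cast_nonneg : (0:ℝ) ≤ n)])
      by_cases hx : x ∈ Metric.closedBall (0 : ℝ) (r + 1)
      · rw [indicator_of_mem hx, norm_smul]
        gcongr
        have := hK.dist_le_mul (x - t n) x
        rw [dist_eq_norm, dist_eq_norm] at this
        rw [norm_mul, norm_inv, Real.norm_of_nonneg (ht0 n).le]
        have h3 : ‖x - t n - x‖ = t n := by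
          rw [sub_sub_cancel_left, norm_neg, Real.norm_of_nonneg (ht0 n).le]
        rw [h3] at this
        rw [inv_mul_le_iff₀ (ht0 n), mul_comm]
        exact this
      · rw [indicator_of_notMem hx]
        have h0 (y : ℝ) (hy : r < |y|) : θ y = 0 := by
          refine image_eq_zero_of_notMem_tsupport fun h => ?_
          have := hr h
          rw [mem_closedBall_zero_iff, Real.norm_eq_abs] at this
          linarith
        rw [mem_closedBall_zero_iff, Real.norm_eq_abs, not_le] at hx
        rw [h0 x (by linarith), h0 (x - t n) (by
          have := abs_sub_abs_le_abs_sub x (t n)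
          rw [abs_of_pos (ht0 n)] at this
          linarith)]
        simp
    · refine (integrable_indicator_iff Metric.isClosed_closedBall.measurableSet).2 ?_
      exact (by fun_prop : Continuous _).continuousOn.integrableOn_compact
        (isCompact_closedBall 0 (r + 1))
    · refine .of_forall fun x => ?_
      have hd : HasDerivAt θ (deriv θ x) x :=
        (hθ.differentiable (by simp) x).hasDerivAt
      have h1 := hasDerivAt_iff_tendsto_slope_zero.1 hd
      have h2 : Tendsto (fun n => -t n) atTop (𝓝[≠] 0) := by
        refine tendsto_nhdsWithin_iff.2 ⟨by simpa using htlim.neg, .of_forall fun n => ?_⟩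
        simpa using (ht0 n).ne'
      have h3 := (h1.comp h2).neg
      refine Tendsto.smul_const (h3.congr fun n => ?_) _
      simp only [Function.comp, smul_eq_mul, inv_neg, neg_mul, neg_neg, sub_eq_add_neg]
  have := tendsto_nhds_unique (hl2.mono_left Nat.hyperfilter_le_atTop) hl1
  rw [← this, iteratedDeriv_one]
  simp only [neg_smul, integral_neg]
  ring

/-- Quantitative membership in `H¹ ∩ L^∞`, the derivative being controlled through difference
quotients, which makes the class visibly closed under products. -/
structure SobBound (C : ℝ≥0) (F : ℝ → ℂ) : Prop where
  cont : Continuous F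
  bdd : ∀ z, ‖F z‖ ≤ C
  l2 : eLpNorm F 2 volume ≤ C
  dq : ∀ h : ℝ, eLpNorm (fun z => F (z + h) - F z) 2 volume ≤ C * ‖h‖ₑ

theorem eLpNorm_mul_le_of_bdd {f g : ℝ → ℂ} {C : ℝ≥0} (hf : ∀ z, ‖f z‖ ≤ C) :
    eLpNorm (fun z => f z * g z) 2 volume ≤ C * eLpNorm g 2 volume := by
  have := eLpNorm_le_nnreal_smul_eLpNorm_of_ae_le_mul (μ := volume) (f := fun z => f z * g z)
    (g := g) (c := C) (.of_forall fun z => by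
      rw [nnnorm_mul]; exact mul_le_mul_left (by exact_mod_cast hf z) _) 2
  simpa [ENNReal.smul_def] using this

theorem SobBound.mono {C C' : ℝ≥0} {F : ℝ → ℂ} (h : SobBound C F) (hC : C ≤ C') :
    SobBound C' F where
  cont := h.cont
  bdd z := (h.bdd z).trans hC
  l2 := h.l2.trans (by exact_mod_cast hC)
  dq t := (h.dq t).trans (by gcongr)

theorem SobBound.add {C D : ℝ≥0} {F G : ℝ → ℂ} (hF : SobBound C F) (hG : SobBound D G) :
    SobBound (C + D) (fun z => F z + G z) where
  cont := hF.cont.add hG.cont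
  bdd z := (norm_add_le _ _).trans (add_le_add (hF.bdd z) (hG.bdd z))
  l2 := (eLpNorm_add_le hF.cont.aestronglyMeasurable hG.cont.aestronglyMeasurable
    (by norm_num)).trans (by push_cast; exact add_le_add hF.l2 hG.l2)
  dq t := by
    have e : (fun z => F (z + t) + G (z + t) - (F z + G z)) =
      (fun z => F (z + t) - F z) + fun z => G (z + t) - G z := by funext z; simp; ring
    have c1 := hF.cont; have c2 := hG.cont
    rw [e]
    refine (eLpNorm_add_le (by fun_prop : Continuous _).aestronglyMeasurable
      (by fun_prop : Continuous _).aestronglyMeasurable (by norm_num)).trans ?_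
    push_cast
    rw [add_mul]
    exact add_le_add (hF.dq t) (hG.dq t)

theorem SobBound.const_mul {C D : ℝ≥0} {F : ℝ → ℂ} (hF : SobBound C F) {c : ℂ} (hc : ‖c‖ ≤ D) :
    SobBound (D * C) (fun z => c * F z) where
  cont := hF.cont.const_mul c
  bdd z := by
    rw [norm_mul]; push_cast
    exact mul_le_mul hc (hF.bdd z) (norm_nonneg _) D.2
  l2 := (eLpNorm_mul_le_of_bdd (f := fun _ => c) fun _ => hc).trans (by
    push_cast; gcongr; exact hF.l2)
  dq t := by
    simp only [← mul_sub]
    refine (eLpNorm_mul_le_of_bdd (f := fun _ => c) fun _ => hc).trans ?_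
    push_cast; rw [mul_assoc]; gcongr; exact hF.dq t

theorem SobBound.sub {C D : ℝ≥0} {F G : ℝ → ℂ} (hF : SobBound C F) (hG : SobBound D G) :
    SobBound (C + D) (fun z => F z - G z) := by
  have := hF.add (hG.const_mul (c := -1) (D := 1) (by simp))
  simpa [sub_eq_add_neg] using this

theorem SobBound.mul {C D : ℝ≥0} {F G : ℝ → ℂ} (hF : SobBound C F) (hG : SobBound D G) :
    SobBound (2 * C * D) (fun z => F z * G z) := by
  have c1 := hF.cont; have c2 := hG.cont
  refine SobBound.mono (C := 2 * C * D) ⟨by fun_prop, fun z => ?_, ?_, fun t => ?_⟩ le_rfl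
  · rw [norm_mul]; push_cast
    have := mul_le_mul (hF.bdd z) (hG.bdd z) (norm_nonneg _) C.2
    have : 0 ≤ (C : ℝ) * D := by positivity
    linarith
  · refine (eLpNorm_mul_le_of_bdd hF.bdd).trans ?_
    push_cast
    rw [mul_assoc, two_mul]
    exact (mul_le_mul_right hG.l2 _).trans le_self_add
  · have e : (fun z => F (z + t) * G (z + t) - F z * G z) =
      (fun z => F (z + t) * (G (z + t) - G z)) + fun z => G z * (F (z + t) - F z) := by
      funext z; simp; ring
    rw [e]
    refine (eLpNorm_add_le (by fun_prop : Continuous _).aestronglyMeasurable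
      (by fun_prop : Continuous _).aestronglyMeasurable (by norm_num)).trans ?_
    refine (add_le_add ((eLpNorm_mul_le_of_bdd fun z => hF.bdd (z + t)).trans
      (mul_le_mul_right (hG.dq t) _)) ((eLpNorm_mul_le_of_bdd hG.bdd).trans
      (mul_le_mul_right (hF.dq t) _))).trans (le_of_eq ?_)
    push_cast; ring

theorem SobBound.comp_neg {C : ℝ≥0} {F : ℝ → ℂ} (hF : SobBound C F) :
    SobBound C (fun z => F (-z)) := by
  have c1 := hF.cont
  have hneg (f : ℝ → ℂ) (hf : Continuous f) :
      eLpNorm (fun z => f (-z)) 2 volume = eLpNorm f 2 volume :=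
    eLpNorm_comp_measurePreserving hf.aestronglyMeasurable (Measure.measurePreserving_neg volume)
  refine ⟨by fun_prop, fun z => hF.bdd _, (hneg F c1).trans_le hF.l2, fun t => ?_⟩
  have := hneg (fun z => F (z + -t) - F z) (by fun_prop)
  simp only [neg_add] at this ⊢
  rw [this]
  simpa using hF.dq (-t)

/-! ### Sobolev functions and absolute continuity -/

section

/-- Membership in `H¹` by difference quotients, for a function `F'` that has a continuous
representative `F`. -/
theorem memSobolev_one_of_diffQuotient {F F' : ℝ → ℂ} {C : ℝ≥0} (hF : F' =ᵐ[volume] F)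
    (hc : Continuous F) (h2 : eLpNorm F 2 volume ≤ C)
    (hdq : ∀ h : ℝ, eLpNorm (fun z => F (z + h) - F z) 2 volume ≤ C * ‖h‖ₑ) :
    MemSobolev 1 F' ∧ sobolevNorm 1 F' ≤ 2 * C := by
  obtain ⟨g, hg, hgL, hgC⟩ := exists_hasWeakDeriv_of_diffQuotient hc hdq
  have hg' := hg.congr hF.symm
  have hs := weakDeriv_spec (hgL.locallyIntegrable (by norm_num)) hg'
  have h2' : eLpNorm F' 2 volume ≤ C := by rwa [eLpNorm_congr_ae hF]
  refine ⟨⟨?_, fun j hj => ?_⟩, ?_⟩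
  · simp only [MemWeightedLp, pow_zero, one_smul]
    exact ⟨hc.aestronglyMeasurable.congr hF.symm, h2'.trans_lt ENNReal.coe_lt_top⟩
  · rw [Finset.Icc_self, Finset.mem_singleton] at hj
    subst hj
    exact ⟨g, hg', by simpa [MemWeightedLp] using hgL⟩
  · rw [sobolevNorm, weightedSobolevNorm, Finset.Icc_self, Finset.sum_singleton]
    simp only [weightedLpNorm, pow_zero, one_smul]
    rw [eLpNorm_congr_ae hs.2.2, two_mul]
    exact add_le_add h2' hgC

/-- The derivative almost everywhere of an absolutely continuous function is its weak derivative, by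
integration by parts. -/
theorem HasACDeriv.hasWeakDeriv {F f : ℝ → ℂ} (h : HasACDeriv F f) : HasWeakDeriv 1 F f := by
  intro θ hθ hθc
  have hθC : HasACDeriv (fun x => (θ x : ℂ)) (fun x => ((deriv θ x : ℝ) : ℂ)) :=
    .of_hasDerivAt (fun x => (hθ.differentiable (by simp) x).hasDerivAt.ofReal_comp)
      (Complex.continuous_ofReal.comp (hθ.continuous_deriv (by simp)))
  obtain ⟨r, hr⟩ := hθc.isCompact.isBounded.subset_closedBall 0
  have h0 (y : ℝ) (hy : r < |y|) : θ y = 0 := by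
    refine image_eq_zero_of_notMem_tsupport fun h => ?_
    have := hr h
    rw [mem_closedBall_zero_iff, Real.norm_eq_abs] at this
    linarith
  set R := |r| + 1
  have hR : r < |R| := by
    have := le_abs_self r
    rw [abs_of_pos (by positivity)]; linarith
  have h1 := (hθC.mul h).integral_eq (-R) R
  have hRR : -R ≤ R := by have := abs_nonneg r; linarith
  rw [h0 R hR, h0 (-R) (by rwa [abs_neg]), intervalIntegral.integral_of_le hRR] at h1
  have i1 : Integrable fun x => deriv θ x • F x :=
    integrable_smul_of_locallyIntegrable (hθ.continuous_deriv (by simp)) hθc.deriv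
      h.continuous.locallyIntegrable
  have i2 : Integrable fun x => θ x • f x :=
    integrable_smul_of_locallyIntegrable hθ.continuous hθc h.locInt
  rw [setIntegral_eq_integral_of_forall_compl_eq_zero] at h1
  · rw [iteratedDeriv_one, pow_one, neg_one_mul, ← add_eq_zero_iff_eq_neg, ← integral_add i1 i2]
    simpa [Complex.real_smul] using h1
  · intro x hx
    have hx' : r < |x| ∨ x = -R := by
      by_cases hx0 : x = -R
      · exact .inr hx0
      · left
        rw [mem_Ioc, not_and_or, not_lt, not_le] at hx
        refine (lt_of_lt_of_le hR ?_)
        rw [abs_of_pos (by positivity : 0 < R)]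
        rcases hx with hx | hx
        · rw [le_abs]; right; linarith
        · rw [le_abs]; left; linarith
    have hx2 : r < |x| := by
      rcases hx' with h | h
      · exact h
      · rw [h, abs_neg]; exact hR
    have hd : deriv θ x = 0 := by
      refine image_eq_zero_of_notMem_tsupport (f := deriv θ) fun h => ?_
      have := hr (tsupport_deriv_subset (f := θ) h)
      rw [mem_closedBall_zero_iff, Real.norm_eq_abs] at this
      linarith
    simp [h0 x hx2, hd]

/-- A function with vanishing weak derivative is constant almost everywhere. -/
theorem HasWeakDeriv.ae_eq_const {w : ℝ → ℂ} (hw : LocallyIntegrable w volume)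
    (h : HasWeakDeriv 1 w 0) : ∃ c : ℂ, w =ᵐ[volume] fun _ => c := by
  let φ : ContDiffBump (0 : ℝ) := ⟨1, 2, by norm_num, by norm_num⟩
  set ρ : ℝ → ℝ := φ.normed volume
  have hρ : ContDiff ℝ ∞ ρ := φ.contDiff_normed
  have hρc : HasCompactSupport ρ := φ.hasCompactSupport_normed
  have hρ1 : ∫ x, ρ x = 1 := φ.integral_normed
  refine ⟨∫ x, ρ x • w x, ae_eq_of_integral_contDiff_smul_eq hw
    continuous_const.locallyIntegrable fun χ hχ hχc => ?_⟩
  set m := ∫ x, χ x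
  -- a test function of integral zero is the derivative of a test function
  set η : ℝ → ℝ := fun x => χ x - m * ρ x with hη
  have hηs : ContDiff ℝ ∞ η := hχ.sub (contDiff_const.mul hρ)
  have hηc : HasCompactSupport η := hχc.sub hρc.mul_left
  have hηi : Integrable η := hηs.continuous.integrable_of_hasCompactSupport hηc
  have hη0 : ∫ x, η x = 0 := by
    rw [hη, integral_sub (hχ.continuous.integrable_of_hasCompactSupport hχc)
      ((hρ.continuous.integrable_of_hasCompactSupport hρc).const_mul m), integral_const_mul, hρ1]
    simp [m]
  obtain ⟨r, hr⟩ := hηc.isCompact.isBounded.subset_closedBall 0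
  have h0 (y : ℝ) (hy : r < |y|) : η y = 0 := by
    refine image_eq_zero_of_notMem_tsupport fun h => ?_
    have := hr h
    rw [mem_closedBall_zero_iff, Real.norm_eq_abs] at this
    linarith
  set θ : ℝ → ℝ := fun x => ∫ t in Iic x, η t with hθ
  have hθd (x : ℝ) : HasDerivAt θ (η x) x := by
    have h1 : θ = fun x => (∫ t in Iic 0, η t) + ∫ t in (0 : ℝ)..x, η t := by
      funext x
      rw [← intervalIntegral.integral_Iic_sub_Iic hηi.integrableOn hηi.integrableOn]
      simp [hθ]
    rw [h1]
    exact (intervalIntegral.integral_hasDerivAt_right hηi.intervalIntegrable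
      hηs.continuous.stronglyMeasurable.stronglyMeasurableAtFilter
      hηs.continuous.continuousAt).const_add _
  have hθ' : deriv θ = η := funext fun x => (hθd x).deriv
  have hθs : ContDiff ℝ ∞ θ := contDiff_infty_iff_deriv.2
    ⟨fun x => (hθd x).differentiableAt, hθ' ▸ hηs⟩
  have hθc : HasCompactSupport θ := by
    refine HasCompactSupport.of_support_subset_isCompact (isCompact_closedBall (0 : ℝ) r) ?_
    intro x hx
    by_contra hxr
    rw [mem_closedBall_zero_iff, Real.norm_eq_abs, not_le] at hxr
    apply hx
    rcases le_or_gt x 0 with hx0 | hx0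
    · refine setIntegral_eq_zero_of_forall_eq_zero fun t ht => h0 t ?_
      rw [abs_of_nonpos hx0] at hxr
      rw [abs_of_nonpos ((mem_Iic.1 ht).trans hx0)]
      linarith [mem_Iic.1 ht]
    · have h2 := setIntegral_eq_integral_of_forall_compl_eq_zero (s := Iic x) (f := η)
        (μ := volume) fun t ht => h0 t (by
          have ht' : x < t := not_le.1 ht
          rw [abs_of_pos hx0] at hxr
          rw [abs_of_pos (hx0.trans ht')]
          linarith)
      exact h2.trans hη0
  have key := h θ hθs hθc
  rw [iteratedDeriv_one, hθ'] at key
  simp only [Pi.zero_apply, smul_zero, integral_zero, mul_zero] at key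
  have i1 := integrable_smul_of_locallyIntegrable hχ.continuous hχc hw
  have i2 := integrable_smul_of_locallyIntegrable hρ.continuous hρc hw
  have e : (fun x => η x • w x) = fun x => χ x • w x - m • (ρ x • w x) := by
    funext x; simp [hη, sub_mul, mul_assoc]
  rw [e, integral_sub (g := fun x => m • (ρ x • w x)) i1 (i2.smul m), integral_smul,
    sub_eq_zero] at key
  rw [key, integral_smul_const]

/-- A function with a locally integrable weak derivative has an absolutely continuous representative. -/
theorem HasWeakDeriv.exists_hasACDeriv {f g : ℝ → ℂ} (hf : LocallyIntegrable f volume)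
    (hg : LocallyIntegrable g volume) (h : HasWeakDeriv 1 f g) :
    ∃ F : ℝ → ℂ, f =ᵐ[volume] F ∧ HasACDeriv F g := by
  have hG : HasACDeriv (fun x => ∫ t in (0 : ℝ)..x, g t) g := .of_integral hg fun a b => by
    rw [intervalIntegral.integral_interval_sub_left (hg.intervalInt _ _) (hg.intervalInt _ _)]
  have hGl := hG.continuous.locallyIntegrable (μ := volume)
  obtain ⟨c, hc⟩ := HasWeakDeriv.ae_eq_const (hf.sub hGl) (by
    intro θ hθ hθc
    have h1 := h θ hθ hθc
    have h2 := hG.hasWeakDeriv θ hθ hθc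
    rw [iteratedDeriv_one] at h1 h2 ⊢
    have hθ' := hθ.continuous_deriv (by simp)
    simp only [Pi.sub_apply, smul_sub]
    rw [integral_sub (integrable_smul_of_locallyIntegrable hθ' hθc.deriv hf)
      (integrable_smul_of_locallyIntegrable hθ' hθc.deriv hGl), h1, h2]
    simp)
  refine ⟨fun x => c + ∫ t in (0 : ℝ)..x, g t, ?_, by simpa using (HasACDeriv.const c).add hG⟩
  filter_upwards [hc] with x hx
  rw [← hx]; simp

theorem HasACDeriv.comp_neg {F f : ℝ → ℂ} (h : HasACDeriv F f) :
    HasACDeriv (fun x => F (-x)) (fun x => -f (-x)) := by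
  refine .of_integral ?_ fun a b => ?_
  · refine LocallyIntegrable.neg ?_
    refine locallyIntegrable_iff.2 fun k hk => ?_
    have := h.locInt.integrableOn_isCompact hk.neg
    have h2 := (integrable_indicator_iff hk.neg.measurableSet).2 this
    have h3 := h2.comp_neg
    refine (integrable_indicator_iff hk.measurableSet).1 (h3.congr (.of_forall fun x => ?_))
    by_cases hx : x ∈ k <;> simp [indicator, hx]
  · rw [intervalIntegral.integral_neg, intervalIntegral.integral_comp_neg, h.integral_eq]; ring

theorem HasACDeriv.conj {F f : ℝ → ℂ} (h : HasACDeriv F f) :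
    HasACDeriv (fun x => (starRingEnd ℂ) (F x)) (fun x => (starRingEnd ℂ) (f x)) := by
  refine .of_integral ?_ fun a b => ?_
  · refine locallyIntegrable_iff.2 fun k hk => ?_
    exact (Complex.conjLIE.toContinuousLinearEquiv : ℂ →L[ℝ] ℂ).integrable_comp
      (h.locInt.integrableOn_isCompact hk)
  · rw [intervalIntegral, integral_conj, integral_conj, ← map_sub, ← intervalIntegral,
      h.integral_eq, map_sub]

/-! ### Weighted spaces -/

theorem one_le_bracket (x : ℝ) : 1 ≤ bracket x := by
  rw [bracket, Real.one_le_sqrt]; nlinarith [sq_nonneg x]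

theorem bracket_pos (x : ℝ) : 0 < bracket x := by linarith [one_le_bracket x]

theorem abs_le_bracket (x : ℝ) : |x| ≤ bracket x :=
  Real.abs_le_sqrt (by linarith)

theorem continuous_bracket : Continuous bracket := by unfold bracket; fun_prop

theorem bracket_neg (x : ℝ) : bracket (-x) = bracket x := by simp [bracket]

/-- `‖f‖_{L^{2,1}} ≤ γ`. -/
structure L21 (γ : ℝ≥0) (f : ℝ → ℂ) : Prop where
  meas : AEStronglyMeasurable f volume
  norm : weightedLpNorm 2 1 f ≤ γ

theorem weightedLpNorm_one (f : ℝ → ℂ) :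
    weightedLpNorm 2 1 f = eLpNorm (fun x => bracket x • f x) 2 volume := by
  simp [weightedLpNorm]

theorem L21.of_norm_le {γ c : ℝ≥0} {f g : ℝ → ℂ} (hf : L21 γ f)
    (hg : AEStronglyMeasurable g volume) (h : ∀ x, ‖g x‖ ≤ c * ‖f x‖) : L21 (c * γ) g := by
  refine ⟨hg, ?_⟩
  have := eLpNorm_le_nnreal_smul_eLpNorm_of_ae_le_mul (μ := volume)
    (f := fun x => bracket x • g x) (g := fun x => bracket x • f x) (c := c) (.of_forall fun x => by
      rw [nnnorm_smul, nnnorm_smul, mul_left_comm]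
      exact mul_le_mul_right (by exact_mod_cast h x) _) 2
  rw [weightedLpNorm_one]
  refine this.trans ?_
  rw [ENNReal.smul_def, smul_eq_mul, ← weightedLpNorm_one]
  push_cast
  exact mul_le_mul_right hf.norm _

theorem L21.congr {γ : ℝ≥0} {f g : ℝ → ℂ} (hf : L21 γ f) (h : f =ᵐ[volume] g) : L21 γ g := by
  refine ⟨hf.meas.congr h, ?_⟩
  rw [weightedLpNorm_one, ← eLpNorm_congr_ae (f := fun x => bracket x • f x), ← weightedLpNorm_one]
  · exact hf.norm
  · filter_upwards [h] with x hx
    rw [hx]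

theorem L21.mono {γ γ' : ℝ≥0} {f : ℝ → ℂ} (hf : L21 γ f) (h : γ ≤ γ') : L21 γ' f :=
  ⟨hf.meas, hf.norm.trans (by exact_mod_cast h)⟩

theorem L21.add {γ δ : ℝ≥0} {f g : ℝ → ℂ} (hf : L21 γ f) (hg : L21 δ g) :
    L21 (γ + δ) (fun x => f x + g x) := by
  have hb := continuous_bracket
  refine ⟨hf.meas.add hg.meas, ?_⟩
  rw [weightedLpNorm_one]
  have e : (fun x => bracket x • (f x + g x)) =
      (fun x => bracket x • f x) + fun x => bracket x • g x := by funext x; simp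
  rw [e]
  refine (eLpNorm_add_le (f := fun x => bracket x • f x) (g := fun x => bracket x • g x)
    (hb.aestronglyMeasurable.smul hf.meas)
    (hb.aestronglyMeasurable.smul hg.meas) (by norm_num)).trans ?_
  rw [← weightedLpNorm_one, ← weightedLpNorm_one]
  push_cast
  exact add_le_add hf.norm hg.norm

theorem L21.const_mul {γ : ℝ≥0} {f : ℝ → ℂ} (hf : L21 γ f) (c : ℂ) :
    L21 (‖c‖₊ * γ) (fun x => c * f x) :=
  hf.of_norm_le (hf.meas.const_mul c) fun x => by simp

theorem L21.comp_neg {γ : ℝ≥0} {f : ℝ → ℂ} (hf : L21 γ f) : L21 γ (fun x => f (-x)) := by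
  have hm := Measure.measurePreserving_neg (volume : Measure ℝ)
  refine ⟨hf.meas.comp_measurePreserving hm, ?_⟩
  have := eLpNorm_comp_measurePreserving (p := 2) (g := fun x => bracket x • f x)
    (continuous_bracket.aestronglyMeasurable.smul hf.meas) hm
  rw [weightedLpNorm_one] at *
  simp only [Function.comp_def, bracket_neg] at this
  rw [this, ← weightedLpNorm_one]
  exact hf.norm

theorem L21.conj {γ : ℝ≥0} {f : ℝ → ℂ} (hf : L21 γ f) : L21 γ (fun x => conj (f x)) := by
  simpa using hf.of_norm_le (c := 1) (g := fun x => (starRingEnd ℂ) (f x))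
    (Complex.continuous_conj.comp_aestronglyMeasurable hf.meas) fun x => by simp

theorem L21.eLpNorm_le {γ : ℝ≥0} {f g : ℝ → ℂ} (hf : L21 γ f) {c : ℝ≥0}
    (h : ∀ x, ‖g x‖ ≤ c * (bracket x * ‖f x‖)) : eLpNorm g 2 volume ≤ c * γ := by
  have := eLpNorm_le_nnreal_smul_eLpNorm_of_ae_le_mul (μ := volume)
    (f := g) (g := fun x => bracket x • f x) (c := c) (.of_forall fun x => by
      rw [← NNReal.coe_le_coe, NNReal.coe_mul, coe_nnnorm, coe_nnnorm, norm_smul,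
        Real.norm_of_nonneg (bracket_pos x).le]
      exact h x) 2
  refine this.trans ?_
  rw [ENNReal.smul_def, smul_eq_mul, ← weightedLpNorm_one]
  exact mul_le_mul_right hf.norm _

theorem L21.memLp {γ : ℝ≥0} {f : ℝ → ℂ} (hf : L21 γ f) :
    MemLp f 2 volume ∧ eLpNorm f 2 volume ≤ γ := by
  have := hf.eLpNorm_le (g := f) (c := 1) fun x => by
    rw [NNReal.coe_one, one_mul]
    exact le_mul_of_one_le_left (norm_nonneg _) (one_le_bracket x)
  rw [ENNReal.coe_one, one_mul] at this
  exact ⟨⟨hf.meas, this.trans_lt ENNReal.coe_lt_top⟩, this⟩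

/-- The integral is `π`. -/
theorem lintegral_bracket_inv_sq : ∫⁻ x, ‖(bracket x)⁻¹‖ₑ ^ (2 : ℝ) ≤ 4 := by
  have e (x : ℝ) : ‖(bracket x)⁻¹‖ₑ ^ (2 : ℝ) = ENNReal.ofReal ((1 + x ^ 2)⁻¹) := by
    rw [← ofReal_norm, ENNReal.ofReal_rpow_of_nonneg (norm_nonneg _) (by norm_num)]
    congr 1
    rw [Real.rpow_two, norm_inv, inv_pow, Real.norm_eq_abs, sq_abs, bracket,
      Real.sq_sqrt (by positivity)]
  simp only [e]
  rw [← ofReal_integral_eq_lintegral_ofReal integrable_inv_one_add_sq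
    (.of_forall fun x => by positivity), integral_univ_inv_one_add_sq]
  exact (ENNReal.ofReal_le_ofReal Real.pi_le_four).trans (by simp)

/-- `L^{2,1}` is contained in `L¹`, by the Cauchy–Schwarz inequality. -/
theorem L21.lintegral_le {γ : ℝ≥0} {f : ℝ → ℂ} (hf : L21 γ f) : ∫⁻ x, ‖f x‖ₑ ≤ 2 * γ := by
  have h1 := ENNReal.lintegral_mul_le_Lp_mul_Lq (volume : Measure ℝ) Real.HolderConjugate.two_two
    (f := fun x => ‖(bracket x)⁻¹‖ₑ) (g := fun x => ‖bracket x • f x‖ₑ)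
    (continuous_bracket.measurable.inv.enorm.aemeasurable)
    (continuous_bracket.aestronglyMeasurable.smul hf.meas).enorm
  have e1 : ∫⁻ x, ‖f x‖ₑ = ∫⁻ x, ((fun x => ‖(bracket x)⁻¹‖ₑ) * fun x => ‖bracket x • f x‖ₑ) x := by
    refine lintegral_congr fun x => ?_
    rw [Pi.mul_apply, ← ofReal_norm, ← ofReal_norm, ← ofReal_norm,
      ← ENNReal.ofReal_mul (norm_nonneg _), norm_smul, norm_inv, inv_mul_cancel_left₀]
    simpa using (bracket_pos x).ne'
  rw [e1]
  refine h1.trans (mul_le_mul' ?_ ?_)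
  · refine (ENNReal.rpow_le_rpow lintegral_bracket_inv_sq (by norm_num)).trans (le_of_eq ?_)
    rw [show (4 : ℝ≥0∞) = 2 ^ (2 : ℝ) by norm_num, ← ENNReal.rpow_mul]
    norm_num
  · have := hf.norm
    rw [weightedLpNorm_one, eLpNorm_eq_lintegral_rpow_enorm_toReal two_ne_zero
      ENNReal.ofNat_ne_top] at this
    simpa using this

theorem L21.integrable {γ : ℝ≥0} {f : ℝ → ℂ} (hf : L21 γ f) : Integrable f volume :=
  ⟨hf.meas, hf.lintegral_le.trans_lt (by finiteness)⟩

theorem L21.integral_norm_le {γ : ℝ≥0} {f : ℝ → ℂ} (hf : L21 γ f) : ∫ x, ‖f x‖ ≤ 2 * γ := by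
  rw [integral_norm_eq_lintegral_enorm hf.meas]
  refine ENNReal.toReal_le_of_le_ofReal (by positivity) (hf.lintegral_le.trans (le_of_eq ?_))
  rw [ENNReal.ofReal_mul (by norm_num)]; simp

/-- Decay of the `L²` norm over a left half-line ending at `x ≤ 0`. -/
theorem L21.eLpNorm_indicator_le {γ : ℝ≥0} {f : ℝ → ℂ} (hf : L21 γ f) {x : ℝ} (hx : x ≤ 0) :
    eLpNorm ((Iic x).indicator f) 2 volume ≤ γ * ENNReal.ofReal (bracket x)⁻¹ := by
  have h := hf.eLpNorm_le (g := (Iic x).indicator f) (c := (bracket x)⁻¹.toNNReal) fun y => by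
    rw [Real.coe_toNNReal _ (by have := bracket_pos x; positivity)]
    by_cases hy : y ∈ Iic x
    · rw [indicator_of_mem hy, ← mul_assoc]
      refine le_mul_of_one_le_left (norm_nonneg _) ?_
      rw [inv_mul_eq_div, one_le_div (bracket_pos x)]
      refine Real.sqrt_le_sqrt ?_
      have := mem_Iic.1 hy
      nlinarith
    · rw [indicator_of_notMem hy, norm_zero]
      have := bracket_pos x; have := bracket_pos y; positivity
  rw [mul_comm]
  exact h

/-- An integrable function with integrable derivative vanishes at `-∞`. -/
theorem HasACDeriv.tendsto_atBot_zero {u u' : ℝ → ℂ} (h : HasACDeriv u u')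
    (hu : Integrable u volume) (hu' : Integrable u' volume) : Tendsto u atBot (𝓝 0) := by
  have h1 : Tendsto u atBot (𝓝 (u 0 - ∫ t in Iic 0, u' t)) := by
    have := (intervalIntegral_tendsto_integral_Iic 0 hu'.integrableOn tendsto_id).const_sub (u 0)
    refine this.congr fun x => ?_
    rw [id, h.integral_eq]; ring
  have h0 : u 0 - ∫ t in Iic 0, u' t = 0 := by
    refine IntegrableAtFilter.eq_zero_of_tendsto (l := atBot) ⟨univ, univ_mem,
      hu.integrableOn⟩ (fun s hs => ?_) h1
    obtain ⟨b, hb⟩ := mem_atBot_sets.1 hs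
    refine top_le_iff.1 ?_
    rw [← Real.volume_Iic (a := b)]
    exact measure_mono hb
  rwa [h0] at h1

/-- `(u, u')` is a locally absolutely continuous function with its derivative, both of norm at most
`γ` in `L^{2,1}`: an element of `H^{1,1}`. -/
structure W11 (γ : ℝ≥0) (u u' : ℝ → ℂ) : Prop where
  fn : L21 γ u
  der : L21 γ u'
  ac : HasACDeriv u u'

namespace W11

variable {γ δ : ℝ≥0} {u u' w w' : ℝ → ℂ}

theorem tendsto_atBot (h : W11 γ u u') : Tendsto u atBot (𝓝 0) :=
  h.ac.tendsto_atBot_zero h.fn.integrable h.der.integrable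

theorem integral_Iic (h : W11 γ u u') (x : ℝ) : ∫ t in Iic x, u' t = u x :=
  h.ac.integral_Iic h.der.integrable h.tendsto_atBot x

theorem norm_le (h : W11 γ u u') (x : ℝ) : ‖u x‖ ≤ 2 * γ := by
  rw [← h.integral_Iic]
  exact (norm_integral_Iic_le h.der.integrable x).trans h.der.integral_norm_le

theorem mono (h : W11 γ u u') (hγ : γ ≤ δ) : W11 δ u u' := ⟨h.fn.mono hγ, h.der.mono hγ, h.ac⟩

theorem add (h : W11 γ u u') (h' : W11 δ w w') :
    W11 (γ + δ) (fun x => u x + w x) (fun x => u' x + w' x) :=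
  ⟨h.fn.add h'.fn, h.der.add h'.der, h.ac.add h'.ac⟩

theorem const_mul (h : W11 γ u u') (c : ℂ) :
    W11 (‖c‖₊ * γ) (fun x => c * u x) (fun x => c * u' x) :=
  ⟨h.fn.const_mul c, h.der.const_mul c, h.ac.const_mul c⟩

theorem neg (h : W11 γ u u') : W11 γ (fun x => -u x) (fun x => -u' x) := by
  simpa using h.const_mul (-1)

theorem comp_neg (h : W11 γ u u') : W11 γ (fun x => u (-x)) (fun x => -u' (-x)) :=
  ⟨h.fn.comp_neg, by simpa using h.der.comp_neg.const_mul (-1), h.ac.comp_neg⟩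

end W11

theorem W11.conj {γ : ℝ≥0} {u u' : ℝ → ℂ} (h : W11 γ u u') :
    W11 γ (fun x => (starRingEnd ℂ) (u x)) (fun x => (starRingEnd ℂ) (u' x)) :=
  ⟨h.fn.conj, h.der.conj, h.ac.conj⟩

end

/-! ### Representatives of Sobolev functions -/

theorem MemWeightedLp.L21 {f : ℝ → ℂ} (h : MemWeightedLp 2 1 f) :
    L21 (weightedLpNorm 2 1 f).toNNReal f := by
  refine ⟨?_, (ENNReal.coe_toNNReal h.2.ne).ge⟩
  have h1 : AEStronglyMeasurable (fun x => bracket x ^ 1 • f x) volume := h.1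
  have hb : Continuous fun x => (bracket x)⁻¹ :=
    continuous_bracket.inv₀ fun x => (bracket_pos x).ne'
  refine (hb.aestronglyMeasurable.smul h1).congr (.of_forall fun x => ?_)
  simp [(bracket_pos x).ne']

/-- Elements of `H^{1,1}` have an absolutely continuous representative. -/
theorem MemWeightedSobolev.exists_W11 {u : ℝ → ℂ} (h : MemWeightedSobolev 1 1 u) :
    ∃ U U' γ, u =ᵐ[volume] U ∧ W11 γ U U' := by
  obtain ⟨g, hg, hgL⟩ := h.2 1 (by simp)
  obtain ⟨U, hU, hUg⟩ := hg.exists_hasACDeriv h.1.L21.integrable.locallyIntegrable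
    hgL.L21.integrable.locallyIntegrable
  exact ⟨U, g, _, hU, (h.1.L21.congr hU).mono (le_max_left _ _), hgL.L21.mono (le_max_right _ _),
    hUg⟩

theorem weakDeriv_one_ae_eq {u U U' : ℝ → ℂ} (hu : u =ᵐ[volume] U) (h : HasACDeriv U U') :
    weakDeriv 1 u =ᵐ[volume] U' :=
  (weakDeriv_spec h.locInt (h.hasWeakDeriv.congr hu.symm)).2.2

theorem HasACDeriv.hasWeakDeriv_two {U U' U'' : ℝ → ℂ} (h : HasACDeriv U U')
    (h' : HasACDeriv U' U'') : HasWeakDeriv 2 U U'' := fun θ hθ hθc => by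
  have h1 := h.hasWeakDeriv (deriv θ) (contDiff_infty_iff_deriv.1 hθ).2 hθc.deriv
  have h2 := h'.hasWeakDeriv θ hθ hθc
  rw [iteratedDeriv_one] at h1 h2
  rw [iteratedDeriv_succ, iteratedDeriv_one, h1, h2]
  ring

theorem weakDeriv_two_ae_eq {u U U' U'' : ℝ → ℂ} (hu : u =ᵐ[volume] U) (h : HasACDeriv U U')
    (h' : HasACDeriv U' U'') : weakDeriv 2 u =ᵐ[volume] U'' :=
  (weakDeriv_spec h'.locInt ((h.hasWeakDeriv_two h').congr hu.symm)).2.2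

theorem W11.of_norm_le {u U U' : ℝ → ℂ} {γ δ : ℝ≥0} (hu : u =ᵐ[volume] U) (h : W11 γ U U')
    (hδ : weightedSobolevNorm 1 1 u ≤ δ) : W11 δ U U' := by
  rw [weightedSobolevNorm, Finset.Icc_self, Finset.sum_singleton] at hδ
  have hu' := weakDeriv_one_ae_eq hu h.ac
  exact ⟨L21.congr ⟨h.fn.meas.congr hu.symm, le_self_add.trans hδ⟩ hu,
    L21.congr ⟨h.der.meas.congr hu'.symm, le_add_self.trans hδ⟩ hu', h.ac⟩

theorem eLpNorm_le_of_sobolevNorm_two_le {u U U' U'' : ℝ → ℂ} {δ : ℝ≥0} (hu : u =ᵐ[volume] U)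
    (h : HasACDeriv U U') (h' : HasACDeriv U' U'') (hδ : sobolevNorm 2 u ≤ δ) :
    eLpNorm U'' 2 volume ≤ δ := by
  rw [← eLpNorm_congr_ae (weakDeriv_two_ae_eq hu h h')]
  refine le_trans ?_ hδ
  rw [sobolevNorm, weightedSobolevNorm]
  refine le_trans ?_ le_add_self
  have := Finset.single_le_sum (f := fun j => weightedLpNorm 2 0 (weakDeriv j u))
    (fun _ _ => zero_le) (show 2 ∈ Finset.Icc 1 2 by simp)
  simpa [weightedLpNorm] using this

/-- Elements of `H² ∩ H^{1,1}` have a representative with absolutely continuous derivative. -/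
theorem MemSobolev.exists_W11_hasACDeriv {u : ℝ → ℂ} (h2 : MemSobolev 2 u)
    (h : MemWeightedSobolev 1 1 u) :
    ∃ U U' U'' γ, u =ᵐ[volume] U ∧ W11 γ U U' ∧ HasACDeriv U' U'' ∧ eLpNorm U'' 2 volume ≤ γ := by
  obtain ⟨U, V, γ, hU, hW⟩ := h.exists_W11
  obtain ⟨g, hg, hgL⟩ := h2.2 2 (by simp)
  have hgL' : MemLp g 2 volume := by simpa [MemWeightedLp] using hgL
  have hgl := hgL'.locallyIntegrable (by norm_num)
  have hV : HasWeakDeriv 1 V g := fun θ hθ hθc => by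
    have h1 := hW.ac.hasWeakDeriv (deriv θ) (contDiff_infty_iff_deriv.1 hθ).2 hθc.deriv
    have h3 := (hg.congr hU) θ hθ hθc
    rw [iteratedDeriv_succ, iteratedDeriv_one] at h3
    rw [iteratedDeriv_one] at h1 ⊢
    linear_combination h1 - h3
  obtain ⟨U', hU', hac⟩ := hV.exists_hasACDeriv hW.ac.locInt hgl
  exact ⟨U, U', g, max γ (eLpNorm g 2 volume).toNNReal, hU,
    ⟨hW.fn.mono (le_max_left _ _), (hW.der.congr hU').mono (le_max_left _ _),
      hW.ac.congr_deriv hU'⟩, hac, by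
      refine (ENNReal.coe_toNNReal hgL'.2.ne).ge.trans ?_
      exact_mod_cast le_max_right _ _⟩

/-! ### The Zakharov–Shabat system on a half-line -/

section

theorem continuous_integral_mul {V : ℝ → ℂ} (hV : Integrable V volume) {G : ℝ → ℝ → ℂ}
    (hG : Continuous (Function.uncurry G)) {M : ℝ} (hM : ∀ y z, ‖G y z‖ ≤ M) (s : Set ℝ) :
    Continuous fun z => ∫ y in s, V y * G y z := by
  have hG1 (z : ℝ) : Continuous fun y => G y z := by
    exact hG.comp (by fun_prop : Continuous fun y : ℝ => (y, z))
  have hG2 (y : ℝ) : Continuous fun z => G y z := by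
    exact hG.comp (by fun_prop : Continuous fun z : ℝ => (y, z))
  refine continuous_of_dominated (bound := fun y => ‖V y‖ * M)
    (fun z => (hV.1.mul (hG1 z).aestronglyMeasurable).restrict)
    (fun z => .of_forall fun y => ?_) (hV.norm.mul_const M).integrableOn
    (.of_forall fun y => (hG2 y).const_mul _)
  rw [norm_mul]
  exact mul_le_mul_of_nonneg_left (hM y z) (norm_nonneg _)

theorem eLpNorm_integral_mul_le {V : ℝ → ℂ} (hV : AEStronglyMeasurable V volume) {G : ℝ → ℝ → ℂ}
    (hG : Continuous (Function.uncurry G)) (s : Set ℝ) (μ : Measure ℝ) [SFinite μ] :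
    eLpNorm (fun z => ∫ y in s, V y * G y z) 2 μ ≤ ∫⁻ y in s, ‖V y‖ₑ * eLpNorm (G y) 2 μ := by
  refine (eLpNorm_integral_le (K := fun y z => V y * G y z) ?_).trans ?_
  · exact (hV.restrict.comp_fst).mul hG.aestronglyMeasurable
  · refine lintegral_mono fun y => ?_
    exact (eLpNorm_const_smul (V y) (G y) 2 μ).le

theorem eLpNorm_osc_mul {μ : Measure ℝ} (y : ℝ) (f : ℝ → ℂ) :
    eLpNorm (fun z => osc z y * f z) 2 μ = eLpNorm f 2 μ :=
  eLpNorm_congr_norm_ae (.of_forall fun z => by simp)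

theorem eLpNorm_osc_neg_mul {μ : Measure ℝ} (y : ℝ) (f : ℝ → ℂ) :
    eLpNorm (fun z => osc (-z) y * f z) 2 μ = eLpNorm f 2 μ :=
  eLpNorm_congr_norm_ae (.of_forall fun z => by simp)

theorem eLpNorm_setIntegral_modul_le {V : ℝ → ℂ} (h1 : Integrable V volume)
    (h2 : MemLp V 2 volume) {s : Set ℝ} (hs : MeasurableSet s) :
    eLpNorm (fun z => ∫ y in s, modul (-z) V y) 2 volume ≤
      2 * eLpNorm (s.indicator V) 2 volume := by
  refine le_trans (le_of_eq ?_) (eLpNorm_integral_modul_le (h1.indicator hs) (h2.indicator hs))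
  congr 1
  funext z
  rw [← integral_indicator hs]
  refine integral_congr_ae (.of_forall fun y => ?_)
  by_cases hy : y ∈ s <;> simp [modul, hy]

/-- The Gronwall estimate in `L²_z` for a forced Zakharov–Shabat system. Since the a priori bound
`M` is only uniform, the inequality is applied on bounded intervals of `z`. -/
theorem eLpNorm_le_of_forced {U V : ℝ → ℂ} {c : ℝ≥0} (hU : L21 c U) (hV : L21 c V)
    {P Q a b : ℝ → ℝ → ℂ} (hP : Continuous (Function.uncurry P))
    (hQ : Continuous (Function.uncurry Q)) (ha : ∀ x, Continuous (a x)) (hb : ∀ x, Continuous (b x))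
    {M : ℝ≥0} (hPM : ∀ x z, ‖P x z‖ ≤ M) (hQM : ∀ x z, ‖Q x z‖ ≤ M)
    (h1 : ∀ x z, P x z = a x z + ∫ y in Iic x, U y * (osc z y * Q y z))
    (h2 : ∀ x z, Q x z = b x z + ∫ y in Iic x, V y * (osc (-z) y * P y z))
    {α : ℝ≥0∞} {x₀ : ℝ} (hα : ∀ x ≤ x₀, eLpNorm (a x) 2 volume + eLpNorm (b x) 2 volume ≤ α) :
    eLpNorm (P x₀) 2 volume ≤ α * ENNReal.ofReal (Real.exp (4 * c)) ∧
      eLpNorm (Q x₀) 2 volume ≤ α * ENNReal.ofReal (Real.exp (4 * c)) := by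
  have hP' (x : ℝ) : Continuous (P x) := hP.comp (by fun_prop : Continuous fun z : ℝ => (x, z))
  have hQ' (x : ℝ) : Continuous (Q x) := hQ.comp (by fun_prop : Continuous fun z : ℝ => (x, z))
  have key (N : ℕ) : eLpNorm (P x₀) 2 (volume.restrict (Icc (-N : ℝ) N)) +
      eLpNorm (Q x₀) 2 (volume.restrict (Icc (-N : ℝ) N)) ≤
      α * ENNReal.ofReal (Real.exp (4 * c)) := by
    set μ := (volume : Measure ℝ).restrict (Icc (-N : ℝ) N) with hμ
    have hfin (f : ℝ → ℂ) (hf : ∀ z, ‖f z‖ ≤ M) :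
        eLpNorm f 2 μ ≤ μ univ ^ (2 : ℝ≥0∞).toReal⁻¹ * ENNReal.ofReal M :=
      eLpNorm_le_of_ae_bound (.of_forall hf)
    have hμM : μ univ ^ (2 : ℝ≥0∞).toReal⁻¹ * ENNReal.ofReal M ≠ ⊤ := by
      have : μ univ ≠ ⊤ := by simp [hμ]
      finiteness
    have hres (f : ℝ → ℂ) : eLpNorm f 2 μ ≤ eLpNorm f 2 volume :=
      eLpNorm_mono_measure _ Measure.restrict_le_self
    have hg := lintegral_Iic_le_gronwall (h := fun t => ‖U t‖ + ‖V t‖)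
      (hU.integrable.norm.add hV.integrable.norm) (fun t => by positivity)
      (f := fun x => eLpNorm (P x) 2 μ + eLpNorm (Q x) 2 μ) (c := α) (x₀ := x₀)
      (ENNReal.add_ne_top.2 ⟨hμM, hμM⟩)
      (fun x _ => add_le_add (hfin _ (hPM x)) (hfin _ (hQM x)))
      (fun x hx => by
        have e1 : P x = (fun z => a x z) + fun z => ∫ y in Iic x, U y * (osc z y * Q y z) :=
          funext (h1 x)
        have e2 : Q x = (fun z => b x z) + fun z => ∫ y in Iic x, V y * (osc (-z) y * P y z) :=
          funext (h2 x)
        have m1 : Continuous fun z => ∫ y in Iic x, U y * (osc z y * Q y z) := by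
          convert! (hP' x).sub (ha x) using 2 with z
          rw [Pi.sub_apply, h1 x z]; ring
        have m2 : Continuous fun z => ∫ y in Iic x, V y * (osc (-z) y * P y z) := by
          convert! (hQ' x).sub (hb x) using 2 with z
          rw [Pi.sub_apply, h2 x z]; ring
        have i1 : eLpNorm (P x) 2 μ ≤ eLpNorm (a x) 2 volume +
            ∫⁻ y in Iic x, ‖U y‖ₑ * eLpNorm (Q y) 2 μ := by
          conv_lhs => rw [e1]
          refine (eLpNorm_add_le (ha x).aestronglyMeasurable m1.aestronglyMeasurable
            (by norm_num)).trans (add_le_add (hres _) ?_)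
          refine (eLpNorm_integral_mul_le (G := fun y z => osc z y * Q y z) hU.meas ?_ _ μ).trans
            (le_of_eq ?_)
          · exact (by fun_prop : Continuous fun q : ℝ × ℝ => osc q.2 q.1).mul hQ
          · simp only [eLpNorm_osc_mul]
        have i2 : eLpNorm (Q x) 2 μ ≤ eLpNorm (b x) 2 volume +
            ∫⁻ y in Iic x, ‖V y‖ₑ * eLpNorm (P y) 2 μ := by
          conv_lhs => rw [e2]
          refine (eLpNorm_add_le (hb x).aestronglyMeasurable m2.aestronglyMeasurable
            (by norm_num)).trans (add_le_add (hres _) ?_)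
          refine (eLpNorm_integral_mul_le (G := fun y z => osc (-z) y * P y z) hV.meas ?_ _ μ).trans
            (le_of_eq ?_)
          · exact (by fun_prop : Continuous fun q : ℝ × ℝ => osc (-q.2) q.1).mul hP
          · simp only [eLpNorm_osc_neg_mul]
        refine (add_le_add i1 i2).trans ?_
        rw [add_add_add_comm]
        refine add_le_add (hα x hx) ((le_lintegral_add _ _).trans (lintegral_mono fun y => ?_))
        rw [ENNReal.ofReal_add (norm_nonneg _) (norm_nonneg _), ofReal_norm, ofReal_norm, add_mul]
        exact add_le_add (by gcongr; exact le_add_self) (by gcongr; exact le_self_add))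
    refine hg.trans ?_
    gcongr
    rw [integral_add hU.integrable.norm hV.integrable.norm]
    linarith [hU.integral_norm_le, hV.integral_norm_le]
  exact ⟨eLpNorm_le_of_restrict (hP' x₀).aestronglyMeasurable fun N => le_self_add.trans (key N),
    eLpNorm_le_of_restrict (hQ' x₀).aestronglyMeasurable fun N => le_add_self.trans (key N)⟩

/-- The first component of the Zakharov–Shabat solution normalised at `-∞`. -/
def zsP (U V : ℝ → ℂ) (x z : ℝ) : ℂ := solF (modul z U) (modul (-z) V) x

/-- The second component, times `e^{-2izx}`, of the Zakharov–Shabat solution normalised at `-∞`. -/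
def zsR (U V : ℝ → ℂ) (x z : ℝ) : ℂ := solG (modul z U) (modul (-z) V) x

section

variable {U V W : ℝ → ℂ} {c : ℝ≥0}

theorem continuous_zs (hU : Integrable U volume) (hV : Integrable V volume) :
    Continuous (Function.uncurry (zsP U V)) ∧ Continuous (Function.uncurry (zsR U V)) := by
  have h := continuous_volterraSol (continuous_toLOne_modul hU)
    ((continuous_toLOne_modul hV).comp continuous_neg)
  have h1 : Continuous fun q : ℝ × ℝ => (volterraSol (toLOne (modul q.2 U))
      (toLOne (modul (-q.2) V))).1 := continuous_fst.comp (h.comp continuous_snd)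
  have h2 : Continuous fun q : ℝ × ℝ => (volterraSol (toLOne (modul q.2 U))
      (toLOne (modul (-q.2) V))).2 := continuous_snd.comp (h.comp continuous_snd)
  exact ⟨continuous_eval.comp (h1.prodMk continuous_fst),
    continuous_eval.comp (h2.prodMk continuous_fst)⟩

theorem norm_zs_le (hU : L21 c U) (hV : L21 c V) (x z : ℝ) :
    ‖zsP U V x z‖ + ‖zsR U V x z‖ ≤ Real.exp (4 * c) := by
  refine (norm_solF_add_norm_solG_le (integrable_modul hU.integrable z)
    (integrable_modul hV.integrable (-z)) x).trans (Real.exp_le_exp.2 ?_)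
  simp only [norm_modul]
  rw [integral_add hU.integrable.norm hV.integrable.norm]
  linarith [hU.integral_norm_le, hV.integral_norm_le]

theorem zsP_eq (hU : Integrable U volume) (x z : ℝ) :
    zsP U V x z = 1 + ∫ y in Iic x, U y * (osc z y * zsR U V y z) := by
  rw [zsP, solF_eq (integrable_modul hU z)]
  congr 2; funext y
  simp only [modul, zsR]; ring

theorem zsR_eq (hV : Integrable V volume) (x z : ℝ) :
    zsR U V x z = ∫ y in Iic x, V y * (osc (-z) y * zsP U V y z) := by
  rw [zsR, solG_eq (integrable_modul hV _)]
  congr 1; funext y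
  simp only [modul, zsP]; ring

/-- `L²_z` decay of the Zakharov–Shabat solution on the left half-line. -/
theorem eLpNorm_zs_le (hU : L21 c U) (hV : L21 c V) {x : ℝ} (hx : x ≤ 0) :
    eLpNorm (fun z => zsP U V x z - 1) 2 volume ≤
        2 * (c * ENNReal.ofReal (bracket x)⁻¹) * ENNReal.ofReal (Real.exp (4 * c)) ∧
      eLpNorm (zsR U V x) 2 volume ≤
        2 * (c * ENNReal.ofReal (bracket x)⁻¹) * ENNReal.ofReal (Real.exp (4 * c)) := by
  obtain ⟨hPc, hRc⟩ := continuous_zs hU.integrable hV.integrable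
  set M : ℝ≥0 := (Real.exp (4 * c)).toNNReal + 1
  have hM : (M : ℝ) = Real.exp (4 * c) + 1 := by
    simp [M, Real.coe_toNNReal _ (Real.exp_nonneg _)]
  have hb := norm_zs_le hU hV
  have hoscc : Continuous (Function.uncurry fun y z : ℝ => osc (-z) y) := by
    unfold Function.uncurry; fun_prop
  refine eLpNorm_le_of_forced hU hV (P := fun x z => zsP U V x z - 1) (Q := zsR U V)
    (a := fun _ _ => 0) (b := fun x z => ∫ y in Iic x, modul (-z) V y) (M := M)
    (hPc.sub continuous_const) hRc (fun x => continuous_const) (fun x => ?_) (fun x z => ?_)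
    (fun x z => ?_) (fun x z => ?_) (fun x z => ?_) fun t ht => ?_
  · have := continuous_integral_mul hV.integrable (G := fun y z => osc (-z) y) (M := 1)
      hoscc (fun y z => by simp) (Iic x)
    simpa only [modul, mul_comm] using this
  · have := norm_sub_le (zsP U V x z) 1
    rw [norm_one] at this
    rw [hM]
    linarith [hb x z, norm_nonneg (zsR U V x z)]
  · rw [hM]; linarith [hb x z, norm_nonneg (zsP U V x z)]
  · rw [zsP_eq hU.integrable]; ring
  · rw [zsR_eq hV.integrable, ← integral_add (integrable_modul hV.integrable _).integrableOn]
    · congr 1; funext y; simp only [modul]; ring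
    · refine (hV.integrable.mul_bdd (c := M) ?_ (.of_forall fun y => ?_)).integrableOn
      · have : Continuous fun y => zsP U V y z := continuous_solF _ _
        exact (by fun_prop : Continuous fun y => osc (-z) y * (zsP U V y z - 1)).aestronglyMeasurable
      · have := norm_sub_le (zsP U V y z) 1
        rw [norm_one] at this
        rw [norm_mul, norm_osc, one_mul, hM]
        linarith [hb y z, norm_nonneg (zsR U V y z)]
  · rw [show (fun _ : ℝ => (0 : ℂ)) = 0 from rfl, eLpNorm_zero, zero_add]
    refine (eLpNorm_setIntegral_modul_le hV.integrable hV.memLp.1 measurableSet_Iic).trans ?_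
    refine mul_le_mul_right ((hV.eLpNorm_indicator_le (ht.trans hx)).trans ?_) _
    refine mul_le_mul_right (ENNReal.ofReal_le_ofReal (inv_anti₀ (bracket_pos x)
      (Real.sqrt_le_sqrt ?_))) _
    nlinarith

end

end

/-! ### Difference quotients on the half-line -/

section

theorem abs_mul_bracket_inv_le (y : ℝ) : |y| * (bracket y)⁻¹ ≤ 1 := by
  rw [← div_eq_mul_inv, div_le_one (bracket_pos y)]
  exact abs_le_bracket y

theorem eLpNorm_osc_sub_one_mul_le {C : ℝ≥0} {y h : ℝ} {f : ℝ → ℂ}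
    (hf : eLpNorm f 2 volume ≤ C * ENNReal.ofReal (bracket y)⁻¹) :
    eLpNorm (fun z => (osc h y - 1) * f z) 2 volume ≤ 2 * C * ‖h‖ₑ := by
  have e : eLpNorm (fun z => (osc h y - 1) * f z) 2 volume = ‖osc h y - 1‖ₑ * eLpNorm f 2 volume :=
    eLpNorm_const_smul (osc h y - 1) f 2 volume
  have h1 : ‖osc h y - 1‖ₑ ≤ ENNReal.ofReal (2 * |h| * |y|) := by
    rw [← ofReal_norm]; exact ENNReal.ofReal_le_ofReal (norm_osc_sub_one_le h y)
  rw [e]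
  refine (mul_le_mul' h1 hf).trans ?_
  have h3 : (2 : ℝ≥0∞) * C * ‖h‖ₑ = C * ENNReal.ofReal (2 * |h|) := by
    rw [ENNReal.ofReal_mul (by norm_num), ← Real.norm_eq_abs, ofReal_norm, ENNReal.ofReal_ofNat]
    ring
  rw [mul_left_comm, ← ENNReal.ofReal_mul (by positivity), h3]
  refine mul_le_mul_right (ENNReal.ofReal_le_ofReal ?_) _
  have := abs_mul_bracket_inv_le y
  have h2 : 0 ≤ 2 * |h| := by positivity
  nlinarith

theorem eLpNorm_comp_add {f : ℝ → ℂ} (hf : Continuous f) (h : ℝ) :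
    eLpNorm (fun z => f (z + h)) 2 volume = eLpNorm f 2 volume :=
  eLpNorm_comp_measurePreserving hf.aestronglyMeasurable (measurePreserving_add_right volume h)

theorem _root_.Continuous.shift_snd {f : ℝ → ℝ → ℂ} (hf : Continuous (Function.uncurry f)) (h : ℝ) :
    Continuous fun q : ℝ × ℝ => f q.1 (q.2 + h) :=
  hf.comp (by fun_prop : Continuous fun q : ℝ × ℝ => (q.1, q.2 + h))

/-- Bounds for a function `p(y, z)` on the half-line `y ≤ 0` that make `∫_{-∞}^0 e^{-2izy} W p dy`
an element of `H¹_z` for every `W ∈ L^{2,1}`. -/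
structure HalfLineBound (C : ℝ≥0) (p : ℝ → ℝ → ℂ) : Prop where
  cont : Continuous (Function.uncurry p)
  bdd : ∀ y z, ‖p y z‖ ≤ C
  l2 : ∀ y ≤ 0, eLpNorm (fun z => p y z - 1) 2 volume ≤ C * ENNReal.ofReal (bracket y)⁻¹

variable {U V W : ℝ → ℂ} {c C : ℝ≥0} {p : ℝ → ℝ → ℂ}

theorem HalfLineBound.continuous_fst (hp : HalfLineBound C p) (z : ℝ) : Continuous fun y => p y z :=
  hp.cont.comp (by fun_prop : Continuous fun y : ℝ => (y, z))

theorem HalfLineBound.continuous_snd (hp : HalfLineBound C p) (y : ℝ) : Continuous (p y) :=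
  hp.cont.comp (by fun_prop : Continuous fun z : ℝ => (y, z))

theorem lintegral_enorm_mul_le (hW : L21 c W) {s : Set ℝ} {f : ℝ → ℝ≥0∞} {D : ℝ≥0∞}
    (hs : MeasurableSet s) (hf : ∀ y ∈ s, f y ≤ D) :
    ∫⁻ y in s, ‖W y‖ₑ * f y ≤ 2 * c * D := by
  calc ∫⁻ y in s, ‖W y‖ₑ * f y ≤ ∫⁻ y in s, ‖W y‖ₑ * D :=
        setLIntegral_mono' hs fun y hy => mul_le_mul_right (hf y hy) _
    _ = (∫⁻ y in s, ‖W y‖ₑ) * D := by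
        rw [lintegral_mul_const'' _ hW.meas.enorm.restrict]
    _ ≤ 2 * c * D := by
        gcongr
        exact (setLIntegral_le_lintegral _ _).trans hW.lintegral_le

theorem bracket_inv_le_one (y : ℝ) : ENNReal.ofReal (bracket y)⁻¹ ≤ 1 := by
  rw [ENNReal.ofReal_le_one]
  exact inv_le_one_of_one_le₀ (one_le_bracket y)

/-- The `z`-difference quotient falling on the exponential. The factor `|y|` it produces is absorbed
by `W` when `p` is replaced by `1`, and by the decay of `p - 1` in the remainder. -/
theorem HalfLineBound.eLpNorm_osc_sub_one_le (hp : HalfLineBound C p) (hW : L21 c W) {x : ℝ}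
    (hx : x ≤ 0) (h : ℝ) :
    eLpNorm (fun z => ∫ y in Iic x, W y * (osc (-z) y * ((osc (-h) y - 1) * p y (z + h)))) 2 volume
      ≤ (4 * c + 4 * c * C) * ‖h‖ₑ := by
  have hpc := hp.cont
  set W' : ℝ → ℂ := fun y => (osc (-h) y - 1) * W y with hW'
  have hoc : Continuous fun y => osc (-h) y - 1 := by fun_prop
  have hob (y : ℝ) : ‖osc (-h) y - 1‖ ≤ 2 := by
    refine (norm_sub_le _ _).trans ?_
    rw [norm_osc, norm_one]; norm_num
  have hW'i : Integrable W' := hW.integrable.bdd_mul hoc.aestronglyMeasurable (.of_forall hob)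
  -- `|e^{-2ihy} - 1| ≤ 2 |h| ⟨y⟩`, and the weight is absorbed by `W`
  have hW'2 : eLpNorm W' 2 volume ≤ 2 * ‖h‖ₑ * c := by
    have := hW.eLpNorm_le (g := W') (c := 2 * ‖h‖₊) fun y => by
      rw [norm_mul, ← mul_assoc]
      refine mul_le_mul_of_nonneg_right ((norm_osc_sub_one_le (-h) y).trans ?_) (norm_nonneg _)
      rw [abs_neg]; push_cast
      exact mul_le_mul_of_nonneg_left (abs_le_bracket y) (by positivity)
    push_cast at this
    exact this
  have hW'L : MemLp W' 2 volume := ⟨hW'i.1, hW'2.trans_lt (by finiteness)⟩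
  have hG : Continuous (Function.uncurry fun y z : ℝ =>
      osc (-z) y * ((osc (-h) y - 1) * (p y (z + h) - 1))) := by
    have : Continuous fun q : ℝ × ℝ => p q.1 (q.2 + h) :=
      hpc.comp (by fun_prop : Continuous fun q : ℝ × ℝ => (q.1, q.2 + h))
    unfold Function.uncurry
    fun_prop
  have hGb (y z : ℝ) : ‖osc (-z) y * ((osc (-h) y - 1) * (p y (z + h) - 1))‖ ≤ 2 * (C + 1) := by
    rw [norm_mul, norm_osc, one_mul, norm_mul]
    refine mul_le_mul (hob y) ((norm_sub_le _ _).trans ?_) (norm_nonneg _) (by norm_num)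
    rw [norm_one]
    linarith [hp.bdd y (z + h)]
  have e : (fun z => ∫ y in Iic x, W y * (osc (-z) y * ((osc (-h) y - 1) * p y (z + h)))) =
      (fun z => ∫ y in Iic x, modul (-z) W' y) + fun z => ∫ y in Iic x, W y *
        (osc (-z) y * ((osc (-h) y - 1) * (p y (z + h) - 1))) := by
    funext z
    rw [Pi.add_apply, ← integral_add (integrable_modul hW'i _).integrableOn]
    · congr 1; funext y; simp only [modul, hW']; ring
    · have : Continuous fun y : ℝ => osc (-z) y * ((osc (-h) y - 1) * (p y (z + h) - 1)) :=
        hG.comp (by fun_prop : Continuous fun y : ℝ => (y, z))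
      exact (hW.integrable.mul_bdd (c := 2 * (C + 1)) this.aestronglyMeasurable
        (.of_forall fun y => hGb y z)).integrableOn
  have hoscc : Continuous (Function.uncurry fun y z : ℝ => osc (-z) y) := by
    unfold Function.uncurry; fun_prop
  have m1 : Continuous fun z => ∫ y in Iic x, modul (-z) W' y := by
    have := continuous_integral_mul hW'i (G := fun y z => osc (-z) y) (M := 1)
      hoscc (fun y z => by simp) (Iic x)
    simpa only [modul, mul_comm] using this
  have m2 := continuous_integral_mul hW.integrable hG hGb (Iic x)
  rw [e]
  refine (eLpNorm_add_le m1.aestronglyMeasurable m2.aestronglyMeasurable (by norm_num)).trans ?_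
  rw [add_mul]
  refine add_le_add ?_ ?_
  · refine (eLpNorm_setIntegral_modul_le hW'i hW'L measurableSet_Iic).trans ?_
    refine (mul_le_mul_right ((eLpNorm_indicator_le _).trans hW'2) _).trans (le_of_eq ?_)
    ring
  · refine (eLpNorm_integral_mul_le hW.meas hG _ _).trans ?_
    refine (lintegral_enorm_mul_le hW (D := 2 * C * ‖h‖ₑ) measurableSet_Iic fun y hy => ?_).trans
      (le_of_eq (by ring))
    have hy0 : y ≤ 0 := (mem_Iic.1 hy).trans hx
    rw [eLpNorm_osc_neg_mul]
    refine (eLpNorm_osc_sub_one_mul_le (f := fun z => p y (z + h) - 1) (C := C) (h := -h)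
      ?_).trans (le_of_eq (by simp))
    have hpy := hp.continuous_snd y
    rw [eLpNorm_comp_add (f := fun z => p y z - 1) (by fun_prop) h]
    exact hp.l2 y hy0

/-- `∫_{-∞}^0 e^{-2izy} W(y) p(y, z) dy ∈ H¹_z`. In `p = 1 + (p - 1)` the first term is estimated by
Plancherel's theorem, the second by Minkowski's inequality. -/
theorem HalfLineBound.sobBound_integral (hp : HalfLineBound C p) {D : ℝ≥0}
    (hdq : ∀ y ≤ 0, ∀ h : ℝ, eLpNorm (fun z => p y (z + h) - p y z) 2 volume ≤ D * ‖h‖ₑ)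
    (hW : L21 c W) :
    SobBound (4 * c + 4 * c * C + 2 * c * D)
      (fun z => ∫ y in Iic 0, W y * (osc (-z) y * p y z)) := by
  have hpc := hp.cont
  have hosc : Continuous fun q : ℝ × ℝ => osc (-q.2) q.1 := by fun_prop
  have hG : Continuous (Function.uncurry fun y z : ℝ => osc (-z) y * p y z) := hosc.mul hpc
  have hGb (y z : ℝ) : ‖osc (-z) y * p y z‖ ≤ C := by
    rw [norm_mul, norm_osc, one_mul]; exact hp.bdd y z
  have hint (z : ℝ) (q : ℝ → ℂ) (hq : Continuous q) (M : ℝ) (hM : ∀ y, ‖q y‖ ≤ M) :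
      IntegrableOn (fun y => W y * q y) (Iic 0) :=
    (hW.integrable.mul_bdd hq.aestronglyMeasurable (.of_forall hM)).integrableOn
  refine ⟨continuous_integral_mul hW.integrable hG hGb _, fun z => ?_, ?_, fun h => ?_⟩
  · have h1 : ‖∫ y in Iic 0, W y * (osc (-z) y * p y z)‖ ≤ ∫ y in Iic 0, ‖W y‖ * C := by
      refine norm_integral_le_of_norm_le (hW.integrable.norm.mul_const _).integrableOn
        (.of_forall fun y => ?_)
      rw [norm_mul]
      exact mul_le_mul_of_nonneg_left (hGb y z) (norm_nonneg _)
    rw [integral_mul_const] at h1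
    have h2 : ∫ y in Iic 0, ‖W y‖ ≤ 2 * c :=
      (setIntegral_le_integral hW.integrable.norm (.of_forall fun y => norm_nonneg _)).trans
        hW.integral_norm_le
    refine h1.trans ((mul_le_mul_of_nonneg_right h2 C.coe_nonneg).trans ?_)
    push_cast
    have : (0 : ℝ) ≤ c * C := by positivity
    have : (0 : ℝ) ≤ c * D := by positivity
    have : (0 : ℝ) ≤ c := c.coe_nonneg
    linarith
  · have hG' : Continuous (Function.uncurry fun y z : ℝ => osc (-z) y * (p y z - 1)) :=
      hosc.mul (hpc.sub continuous_const)
    have hGb' (y z : ℝ) : ‖osc (-z) y * (p y z - 1)‖ ≤ C + 1 := by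
      rw [norm_mul, norm_osc, one_mul]
      refine (norm_sub_le _ _).trans ?_
      rw [norm_one]
      linarith [hp.bdd y z]
    have e : (fun z => ∫ y in Iic 0, W y * (osc (-z) y * p y z)) =
        (fun z => ∫ y in Iic 0, modul (-z) W y) +
          fun z => ∫ y in Iic 0, W y * (osc (-z) y * (p y z - 1)) := by
      funext z
      have hz := hp.continuous_fst z
      rw [Pi.add_apply, ← integral_add (integrable_modul hW.integrable _).integrableOn
        (hint z _ (by fun_prop) _ fun y => hGb' y z)]
      congr 1; funext y; simp only [modul]; ring
    have hoscc : Continuous (Function.uncurry fun y z : ℝ => osc (-z) y) := hosc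
    have m1 : Continuous fun z => ∫ y in Iic 0, modul (-z) W y := by
      have := continuous_integral_mul hW.integrable (G := fun y z => osc (-z) y) (M := 1)
        hoscc (fun y z => by simp) (Iic 0)
      simpa only [modul, mul_comm] using this
    have m2 := continuous_integral_mul hW.integrable hG' hGb' (Iic 0)
    rw [e]
    refine (eLpNorm_add_le m1.aestronglyMeasurable m2.aestronglyMeasurable (by norm_num)).trans ?_
    have i1 : eLpNorm (fun z => ∫ y in Iic 0, modul (-z) W y) 2 volume ≤ 2 * c :=
      (eLpNorm_setIntegral_modul_le hW.integrable hW.memLp.1 measurableSet_Iic).trans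
        (mul_le_mul_right ((eLpNorm_indicator_le _).trans hW.memLp.2) _)
    have i2 : eLpNorm (fun z => ∫ y in Iic 0, W y * (osc (-z) y * (p y z - 1))) 2 volume ≤
        2 * c * C := by
      refine (eLpNorm_integral_mul_le hW.meas hG' _ _).trans
        (lintegral_enorm_mul_le hW measurableSet_Iic fun y hy => ?_)
      rw [eLpNorm_osc_neg_mul]
      refine (hp.l2 y hy).trans ?_
      exact mul_le_of_le_one_right' (bracket_inv_le_one y)
    refine (add_le_add i1 i2).trans ?_
    push_cast
    refine (add_le_add (by gcongr; norm_num : (2 : ℝ≥0∞) * c ≤ 4 * c)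
      (by gcongr; norm_num : (2 : ℝ≥0∞) * c * C ≤ 4 * c * C)).trans le_self_add
  · have hG1 : Continuous (Function.uncurry fun y z : ℝ =>
        osc (-z) y * ((osc (-h) y - 1) * p y (z + h))) := by
      have h1 : Continuous fun q : ℝ × ℝ => p q.1 (q.2 + h) :=
        hpc.comp (by fun_prop : Continuous fun q : ℝ × ℝ => (q.1, q.2 + h))
      have h2 : Continuous fun q : ℝ × ℝ => osc (-h) q.1 - 1 := by fun_prop
      exact hosc.mul (h2.mul h1)
    have hGb1 (y z : ℝ) : ‖osc (-z) y * ((osc (-h) y - 1) * p y (z + h))‖ ≤ 2 * C := by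
      rw [norm_mul, norm_osc, one_mul, norm_mul]
      refine mul_le_mul ((norm_sub_le _ _).trans ?_) (hp.bdd _ _) (norm_nonneg _) (by norm_num)
      rw [norm_osc, norm_one]; norm_num
    have hG2 : Continuous (Function.uncurry fun y z : ℝ =>
        osc (-z) y * (p y (z + h) - p y z)) := by
      have h1 : Continuous fun q : ℝ × ℝ => p q.1 (q.2 + h) :=
        hpc.comp (by fun_prop : Continuous fun q : ℝ × ℝ => (q.1, q.2 + h))
      exact hosc.mul (h1.sub hpc)
    have hGb2 (y z : ℝ) : ‖osc (-z) y * (p y (z + h) - p y z)‖ ≤ 2 * C := by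
      rw [norm_mul, norm_osc, one_mul]
      exact (norm_sub_le _ _).trans (by linarith [hp.bdd y z, hp.bdd y (z + h)])
    have e : (fun z => (∫ y in Iic 0, W y * (osc (-(z + h)) y * p y (z + h))) -
        ∫ y in Iic 0, W y * (osc (-z) y * p y z)) =
        (fun z => ∫ y in Iic 0, W y * (osc (-z) y * ((osc (-h) y - 1) * p y (z + h)))) +
          fun z => ∫ y in Iic 0, W y * (osc (-z) y * (p y (z + h) - p y z)) := by
      funext z
      have c1 := hp.continuous_fst z
      have c2 := hp.continuous_fst (z + h)
      rw [Pi.add_apply, ← integral_add (hint z _ (by fun_prop) _ fun y => hGb1 y z)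
        (hint z _ (by fun_prop) _ fun y => hGb2 y z),
        ← integral_sub (hint z _ (by fun_prop) _ fun y => hGb y (z + h))
        (hint z _ (by fun_prop) _ fun y => hGb y z)]
      congr 1; funext y
      rw [neg_add, osc_add]; ring
    have m1 := continuous_integral_mul hW.integrable hG1 hGb1 (Iic 0)
    have m2 := continuous_integral_mul hW.integrable hG2 hGb2 (Iic 0)
    rw [e]
    refine (eLpNorm_add_le m1.aestronglyMeasurable m2.aestronglyMeasurable (by norm_num)).trans ?_
    push_cast
    rw [add_mul]
    refine add_le_add (hp.eLpNorm_osc_sub_one_le hW le_rfl h) ?_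
    refine (eLpNorm_integral_mul_le hW.meas hG2 _ _).trans ?_
    rw [mul_assoc]
    refine lintegral_enorm_mul_le hW measurableSet_Iic fun y hy => ?_
    rw [eLpNorm_osc_neg_mul]
    exact hdq y hy h

/-- The constant in the half-line bounds of the Zakharov–Shabat solution. -/
def zsConst (c : ℝ≥0) : ℝ≥0 := (1 + 2 * c) * (Real.exp (4 * c)).toNNReal

theorem coe_zsConst (c : ℝ≥0) : (zsConst c : ℝ≥0∞) =
    (1 + 2 * c) * ENNReal.ofReal (Real.exp (4 * c)) := by
  rw [zsConst, ENNReal.coe_mul]; rfl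

theorem exp_le_zsConst (c : ℝ≥0) : Real.exp (4 * c) ≤ zsConst c := by
  rw [zsConst, NNReal.coe_mul, Real.coe_toNNReal _ (Real.exp_nonneg _)]
  refine le_mul_of_one_le_left (Real.exp_nonneg _) ?_
  push_cast; linarith [c.2]

theorem le_coe_zsConst (c : ℝ≥0) (x : ℝ) :
    2 * (c * ENNReal.ofReal (bracket x)⁻¹) * ENNReal.ofReal (Real.exp (4 * c)) ≤
      zsConst c * ENNReal.ofReal (bracket x)⁻¹ := by
  rw [coe_zsConst, ← mul_assoc, mul_right_comm]
  gcongr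
  exact le_add_self

theorem halfLineBound_zsP (hU : L21 c U) (hV : L21 c V) :
    HalfLineBound (zsConst c) (zsP U V) where
  cont := (continuous_zs hU.integrable hV.integrable).1
  bdd y z := by
    have := norm_zs_le hU hV y z
    linarith [exp_le_zsConst c, norm_nonneg (zsR U V y z)]
  l2 y hy := (eLpNorm_zs_le hU hV hy).1.trans (le_coe_zsConst c y)

/-- The `z`-difference quotients of the Zakharov–Shabat solution are bounded in `L²_z` on the left
half-line. -/
theorem eLpNorm_zs_diff_le (hU : L21 c U) (hV : L21 c V) {x : ℝ} (hx : x ≤ 0) (h : ℝ) :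
    eLpNorm (fun z => zsP U V x (z + h) - zsP U V x z) 2 volume ≤
      ((4 * c + 8 * c * zsConst c) * ‖h‖ₑ) * ENNReal.ofReal (Real.exp (4 * c)) := by
  obtain ⟨hPc, hRc⟩ := continuous_zs hU.integrable hV.integrable
  have hp := halfLineBound_zsP hU hV
  have hP1 (z : ℝ) : Continuous fun y => zsP U V y z := continuous_solF _ _
  have hR1 (z : ℝ) : Continuous fun y => zsR U V y z := continuous_solG _ _
  have hPh : Continuous fun q : ℝ × ℝ => zsP U V q.1 (q.2 + h) := hPc.shift_snd h
  have hRh : Continuous fun q : ℝ × ℝ => zsR U V q.1 (q.2 + h) := hRc.shift_snd h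
  have hPb (x z : ℝ) : ‖zsP U V x z‖ ≤ zsConst c := hp.bdd x z
  have hRb (x z : ℝ) : ‖zsR U V x z‖ ≤ zsConst c := by
    have := norm_zs_le hU hV x z
    linarith [exp_le_zsConst c, norm_nonneg (zsP U V x z)]
  have ho (y : ℝ) (h : ℝ) : ‖osc h y - 1‖ ≤ 2 := (norm_sub_le _ _).trans (by
    rw [norm_osc, norm_one]; norm_num)
  have hGa : Continuous (Function.uncurry fun y z : ℝ =>
      osc z y * ((osc h y - 1) * zsR U V y (z + h))) := by
    have h2 : Continuous fun q : ℝ × ℝ => osc h q.1 - 1 := by fun_prop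
    have h3 : Continuous fun q : ℝ × ℝ => osc q.2 q.1 := by fun_prop
    exact h3.mul (h2.mul hRh)
  have hGab (y z : ℝ) : ‖osc z y * ((osc h y - 1) * zsR U V y (z + h))‖ ≤ 2 * zsConst c := by
    rw [norm_mul, norm_osc, one_mul, norm_mul]
    exact mul_le_mul (ho _ _) (hRb _ _) (norm_nonneg _) (by norm_num)
  have hGb : Continuous (Function.uncurry fun y z : ℝ =>
      osc (-z) y * ((osc (-h) y - 1) * zsP U V y (z + h))) := by
    have h2 : Continuous fun q : ℝ × ℝ => osc (-h) q.1 - 1 := by fun_prop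
    have h3 : Continuous fun q : ℝ × ℝ => osc (-q.2) q.1 := by fun_prop
    exact h3.mul (h2.mul hPh)
  have hGbb (y z : ℝ) : ‖osc (-z) y * ((osc (-h) y - 1) * zsP U V y (z + h))‖ ≤
      2 * zsConst c := by
    rw [norm_mul, norm_osc, one_mul, norm_mul]
    exact mul_le_mul (ho _ _) (hPb _ _) (norm_nonneg _) (by norm_num)
  have hint (F : ℝ → ℂ) (hF : L21 c F) (x : ℝ) (q : ℝ → ℂ) (hq : Continuous q) (M : ℝ)
      (hM : ∀ y, ‖q y‖ ≤ M) : IntegrableOn (fun y => F y * q y) (Iic x) :=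
    (hF.integrable.mul_bdd hq.aestronglyMeasurable (.of_forall hM)).integrableOn
  have hM2 : ((2 * zsConst c : ℝ≥0) : ℝ) = 2 * zsConst c := by push_cast; rfl
  have hsub (f : ℝ → ℝ → ℂ) (hf : ∀ x z, ‖f x z‖ ≤ zsConst c) (y z w : ℝ) :
      ‖f y z - f y w‖ ≤ 2 * zsConst c :=
    (norm_sub_le _ _).trans (by linarith [hf y z, hf y w])
  refine (eLpNorm_le_of_forced hU hV (M := 2 * zsConst c)
    (P := fun x z => zsP U V x (z + h) - zsP U V x z)
    (Q := fun x z => zsR U V x (z + h) - zsR U V x z)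
    (a := fun x z => ∫ y in Iic x, U y * (osc z y * ((osc h y - 1) * zsR U V y (z + h))))
    (b := fun x z => ∫ y in Iic x, V y * (osc (-z) y * ((osc (-h) y - 1) * zsP U V y (z + h))))
    (hPh.sub hPc) (hRh.sub hRc)
    (fun x => continuous_integral_mul hU.integrable hGa hGab _)
    (fun x => continuous_integral_mul hV.integrable hGb hGbb _)
    (fun x z => by rw [hM2]; exact hsub _ hPb x (z + h) z)
    (fun x z => by rw [hM2]; exact hsub _ hRb x (z + h) z)
    (fun x z => ?_) (fun x z => ?_) fun t ht => ?_).1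
  · have c1 := hR1 z
    have c2 := hR1 (z + h)
    rw [zsP_eq hU.integrable, zsP_eq hU.integrable, add_sub_add_left_eq_sub,
      ← integral_add (hint U hU x _ (by fun_prop) _ fun y => hGab y z)
        (hint U hU x _ (by fun_prop) (2 * zsConst c) fun y => by
          rw [norm_mul, norm_osc, one_mul]; exact hsub _ hRb _ _ _),
      ← integral_sub (hint U hU x _ (by fun_prop) (zsConst c) fun y => by
          rw [norm_mul, norm_osc, one_mul]; exact hRb _ _)
        (hint U hU x _ (by fun_prop) (zsConst c) fun y => by
          rw [norm_mul, norm_osc, one_mul]; exact hRb _ _)]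
    congr 1; funext y
    rw [osc_add]; ring
  · have c1 := hP1 z
    have c2 := hP1 (z + h)
    rw [zsR_eq hV.integrable, zsR_eq hV.integrable,
      ← integral_add (hint V hV x _ (by fun_prop) _ fun y => hGbb y z)
        (hint V hV x _ (by fun_prop) (2 * zsConst c) fun y => by
          rw [norm_mul, norm_osc, one_mul]; exact hsub _ hPb _ _ _),
      ← integral_sub (hint V hV x _ (by fun_prop) (zsConst c) fun y => by
          rw [norm_mul, norm_osc, one_mul]; exact hPb _ _)
        (hint V hV x _ (by fun_prop) (zsConst c) fun y => by
          rw [norm_mul, norm_osc, one_mul]; exact hPb _ _)]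
    congr 1; funext y
    rw [neg_add, osc_add]; ring
  · have i1 : eLpNorm (fun z => ∫ y in Iic t, U y *
        (osc z y * ((osc h y - 1) * zsR U V y (z + h)))) 2 volume ≤
        4 * c * zsConst c * ‖h‖ₑ := by
      refine (eLpNorm_integral_mul_le hU.meas hGa _ _).trans ?_
      refine (lintegral_enorm_mul_le hU (D := 2 * zsConst c * ‖h‖ₑ) measurableSet_Iic
        fun y hy => ?_).trans (le_of_eq (by ring))
      have hy0 : y ≤ 0 := (mem_Iic.1 hy).trans (ht.trans hx)
      rw [eLpNorm_osc_mul]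
      refine eLpNorm_osc_sub_one_mul_le (f := fun z => zsR U V y (z + h)) ?_
      rw [eLpNorm_comp_add (Continuous.uncurry_left y hRc)]
      exact (eLpNorm_zs_le hU hV hy0).2.trans (le_coe_zsConst c y)
    have i2 := hp.eLpNorm_osc_sub_one_le hV (ht.trans hx) h
    refine (add_le_add i1 i2).trans (le_of_eq ?_)
    ring

end

/-! ### The Zakharov–Shabat solution at the origin -/

section

variable {U V V' W : ℝ → ℂ} {c : ℝ≥0}

/-- The values at `x = 0` of the Zakharov–Shabat solution, and the integrals of its first component
against an `L^{2,1}` weight, lie in `H¹_z`, with bounds uniform over bounded sets of potentials. -/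
theorem exists_sobBound_zs (c : ℝ≥0) : ∃ C : ℝ≥0, ∀ U V : ℝ → ℂ, L21 c U → L21 c V →
    SobBound C (fun z => zsP U V 0 z - 1) ∧ SobBound C (zsR U V 0) ∧
    ∀ W, L21 c W → SobBound C (fun z => ∫ y in Iic 0, W y * (osc (-z) y * zsP U V y z)) := by
  set D : ℝ≥0 := (4 * c + 8 * c * zsConst c) * (Real.exp (4 * c)).toNNReal with hD
  have hDe (h : ℝ) : ((4 * c + 8 * c * zsConst c : ℝ≥0∞) * ‖h‖ₑ) *
      ENNReal.ofReal (Real.exp (4 * c)) = D * ‖h‖ₑ := by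
    rw [hD, mul_right_comm]; push_cast; rfl
  set C : ℝ≥0 := zsConst c + 1 + D + (4 * c + 4 * c * zsConst c + 2 * c * D) with hC
  have hC1 : zsConst c + 1 ≤ C := by rw [hC, add_assoc (zsConst c + 1)]; exact le_self_add
  have hC2 : D ≤ C := by rw [hC, add_right_comm]; exact le_add_self
  have hC3 : 4 * c + 4 * c * zsConst c + 2 * c * D ≤ C := le_add_self
  refine ⟨C, fun U V hU hV => ?_⟩
  have hp := halfLineBound_zsP hU hV
  have hdq (y : ℝ) (hy : y ≤ 0) (h : ℝ) :
      eLpNorm (fun z => zsP U V y (z + h) - zsP U V y z) 2 volume ≤ D * ‖h‖ₑ :=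
    (eLpNorm_zs_diff_le hU hV hy h).trans (hDe h).le
  have key (W : ℝ → ℂ) (hW : L21 c W) :
      SobBound C (fun z => ∫ y in Iic 0, W y * (osc (-z) y * zsP U V y z)) :=
    (hp.sobBound_integral hdq hW).mono hC3
  refine ⟨⟨(hp.continuous_snd 0).sub continuous_const, fun z => ?_, ?_, fun h => ?_⟩, ?_, key⟩
  · refine (norm_sub_le _ _).trans ?_
    rw [norm_one]
    exact (add_le_add (hp.bdd 0 z) le_rfl).trans (by exact_mod_cast hC1)
  · refine (hp.l2 0 le_rfl).trans ((mul_le_of_le_one_right' (bracket_inv_le_one 0)).trans ?_)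
    exact_mod_cast le_self_add.trans hC1
  · simp only [sub_sub_sub_cancel_right]
    exact (hdq 0 le_rfl h).trans (by gcongr)
  · rw [funext (zsR_eq hV.integrable 0)]
    exact key V hV

theorem lintegral_enorm_mul_bracket_inv_le {f : ℝ → ℂ} (hf : AEStronglyMeasurable f volume) :
    ∫⁻ x, ‖f x‖ₑ * ENNReal.ofReal (bracket x)⁻¹ ≤ eLpNorm f 2 volume * 2 := by
  have h1 := ENNReal.lintegral_mul_le_Lp_mul_Lq (volume : Measure ℝ) Real.HolderConjugate.two_two
    (f := fun x => ‖f x‖ₑ) (g := fun x => ‖(bracket x)⁻¹‖ₑ) hf.enorm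
    (continuous_bracket.measurable.inv.enorm.aemeasurable)
  have e1 (x : ℝ) : ‖f x‖ₑ * ENNReal.ofReal (bracket x)⁻¹ =
      ((fun x => ‖f x‖ₑ) * fun x => ‖(bracket x)⁻¹‖ₑ) x := by
    rw [Pi.mul_apply, Real.enorm_eq_ofReal (inv_nonneg.2 (bracket_pos x).le)]
  simp only [e1]
  refine h1.trans (mul_le_mul' ?_ ?_)
  · rw [eLpNorm_eq_lintegral_rpow_enorm_toReal two_ne_zero ENNReal.ofNat_ne_top]
    simp
  · refine (ENNReal.rpow_le_rpow lintegral_bracket_inv_sq (by norm_num)).trans (le_of_eq ?_)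
    rw [show (4 : ℝ≥0∞) = 2 ^ (2 : ℝ) by norm_num, ← ENNReal.rpow_mul]
    norm_num

/-- Integration by parts against the exponential on `[-N, 0]`. -/
theorem zs_integral_by_parts (hU : Integrable U volume) (hV : Integrable V volume)
    (hac : HasACDeriv V V') (z a : ℝ) :
    ∫ y in a..0, (V' y * (osc (-z) y * zsP U V y z) + U y * V y * zsR U V y z) =
      V 0 * zsP U V 0 z - V a * (osc (-z) a * zsP U V a z) +
        2 * Complex.I * z * (zsR U V 0 z - zsR U V a z) := by
  have hP : HasACDeriv (fun y => zsP U V y z) (fun y => modul z U y * zsR U V y z) :=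
    hasACDeriv_solF (integrable_modul hU z)
  have hR : HasACDeriv (fun y => zsR U V y z) (fun y => modul (-z) V y * zsP U V y z) :=
    hasACDeriv_solG (integrable_modul hV (-z))
  have h := ((hac.mul ((hasACDeriv_osc (-z)).mul hP)).add
    (hR.const_mul (2 * Complex.I * z))).integral_eq a 0
  rw [osc_zero_right, one_mul] at h
  rw [show V 0 * zsP U V 0 z - V a * (osc (-z) a * zsP U V a z) +
        2 * Complex.I * z * (zsR U V 0 z - zsR U V a z) =
      V 0 * zsP U V 0 z + 2 * Complex.I * z * zsR U V 0 z -
        (V a * (osc (-z) a * zsP U V a z) + 2 * Complex.I * z * zsR U V a z) by ring, ← h]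
  congr 1; funext y
  have := osc_neg_mul_self z y
  simp only [modul]
  push_cast
  linear_combination (-V y * U y * zsR U V y z) * this

/-- If the coefficient `V` is absolutely continuous with derivative in `L²`, then `2iz r` is, up to
a boundary term, in `L²_z`. -/
theorem exists_eLpNorm_zsR_le (c : ℝ≥0) : ∃ C : ℝ≥0, ∀ U V V' : ℝ → ℂ, L21 c U → L21 c V →
    HasACDeriv V V' → (∀ x, ‖V x‖ ≤ c) → Tendsto V atBot (𝓝 0) → eLpNorm V' 2 volume ≤ c →
    eLpNorm (fun z => 2 * Complex.I * z * zsR U V 0 z + V 0 * zsP U V 0 z) 2 volume ≤ C := by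
  refine ⟨2 * c + 2 * c * zsConst c + 2 * (c * c) * zsConst c, fun U V V' hU hV hac hb h0 h2 => ?_⟩
  obtain ⟨hPc, hRc⟩ := continuous_zs hU.integrable hV.integrable
  have hp := halfLineBound_zsP hU hV
  have hP1 (z : ℝ) : Continuous fun y => zsP U V y z := continuous_solF _ _
  have hR1 (z : ℝ) : Continuous fun y => zsR U V y z := continuous_solG _ _
  have hV'm : AEStronglyMeasurable V' volume := hac.locInt.aestronglyMeasurable
  have hUV : L21 (c * c) (fun y => U y * V y) :=
    hU.of_norm_le (hU.meas.mul hac.continuous.aestronglyMeasurable) fun y => by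
      rw [norm_mul, mul_comm]; exact mul_le_mul_of_nonneg_right (hb y) (norm_nonneg _)
  have hG2 : Continuous (Function.uncurry fun y z : ℝ => osc (-z) y * (zsP U V y z - 1)) :=
    (by fun_prop : Continuous fun q : ℝ × ℝ => osc (-q.2) q.1).mul (hPc.sub continuous_const)
  refine eLpNorm_le_of_tendsto (f := fun n : ℕ => fun z =>
    ∫ y in (-n : ℝ)..0, (V' y * (osc (-z) y * zsP U V y z) + U y * V y * zsR U V y z))
    (fun n => ?_) (fun z => ?_) fun n => ?_
  · simp only [zs_integral_by_parts hU.integrable hV.integrable hac]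
    have h1 := Continuous.uncurry_left (0 : ℝ) hPc
    have h2 := Continuous.uncurry_left (0 : ℝ) hRc
    have h3 := Continuous.uncurry_left (-n : ℝ) hPc
    have h4 := Continuous.uncurry_left (-n : ℝ) hRc
    exact Continuous.aestronglyMeasurable (by fun_prop)
  · simp only [zs_integral_by_parts hU.integrable hV.integrable hac]
    have hn : Tendsto (fun n : ℕ => (-n : ℝ)) atTop atBot :=
      tendsto_neg_atTop_atBot.comp tendsto_natCast_atTop_atTop
    have t1 : Tendsto (fun n : ℕ => zsR U V (-n : ℝ) z) atTop (𝓝 0) :=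
      (tendsto_solG (A := modul z U) (integrable_modul hV.integrable (-z))).comp hn
    have t2 : Tendsto (fun n : ℕ => V (-n : ℝ) * (osc (-z) (-n) * zsP U V (-n) z)) atTop (𝓝 0) := by
      refine squeeze_zero_norm (a := fun n : ℕ => ‖V (-n : ℝ)‖ * zsConst c) (fun n => ?_) ?_
      · rw [norm_mul, norm_mul, norm_osc, one_mul]
        exact mul_le_mul_of_nonneg_left (hp.bdd _ _) (norm_nonneg _)
      · simpa using ((h0.comp hn).norm).mul_const (zsConst c : ℝ)
    have := (t2.const_sub (V 0 * zsP U V 0 z)).add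
      ((t1.const_sub (zsR U V 0 z)).const_mul (2 * Complex.I * z))
    rw [sub_zero, sub_zero, add_comm] at this
    exact this
  · set s := Ioc (-n : ℝ) 0 with hs
    have hsm : MeasurableSet s := measurableSet_Ioc
    have hV's : MemLp (s.indicator V') 2 volume := by
      refine (MemLp.indicator hsm ⟨hV'm, h2.trans_lt ENNReal.coe_lt_top⟩)
    have hV'i : Integrable (s.indicator V') volume := by
      rw [integrable_indicator_iff hsm]
      exact (hac.locInt.integrableOn_isCompact isCompact_Icc).mono_set Ioc_subset_Icc_self
    have hV'o : IntegrableOn V' s := (integrable_indicator_iff hsm).1 hV'i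
    have hint (F : ℝ → ℂ) (hF : IntegrableOn F s volume) (q : ℝ → ℂ) (hq : Continuous q) (M : ℝ)
        (hM : ∀ y, ‖q y‖ ≤ M) : IntegrableOn (fun y => F y * q y) s volume :=
      Integrable.mul_bdd (μ := volume.restrict s) (f := F) (c := M) hF
        hq.aestronglyMeasurable.restrict (.of_forall hM)
    have hRb (x z : ℝ) : ‖zsR U V x z‖ ≤ zsConst c := by
      have := norm_zs_le hU hV x z
      linarith [exp_le_zsConst c, norm_nonneg (zsP U V x z)]
    have e : (fun z => ∫ y in (-n : ℝ)..0,
        (V' y * (osc (-z) y * zsP U V y z) + U y * V y * zsR U V y z)) =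
        (fun z => ∫ y in s, modul (-z) (s.indicator V') y) +
        (fun z => ∫ y in s, V' y * (osc (-z) y * (zsP U V y z - 1))) +
        fun z => ∫ y in s, U y * V y * zsR U V y z := by
      funext z
      have c1 := hP1 z
      have i1 : IntegrableOn (modul (-z) (s.indicator V')) s := (integrable_modul hV'i _).integrableOn
      have i2 : IntegrableOn (fun y => V' y * (osc (-z) y * (zsP U V y z - 1))) s :=
        hint V' hV'o _ (by fun_prop) (zsConst c + 1) fun y => by
          rw [norm_mul, norm_osc, one_mul]
          refine (norm_sub_le _ _).trans ?_
          rw [norm_one]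
          linarith [hp.bdd y z]
      have i3 : IntegrableOn (fun y => U y * V y * zsR U V y z) s :=
        hint _ hUV.integrable.integrableOn _ (hR1 z) (zsConst c) fun y => hRb y z
      have i4 : IntegrableOn (fun y => modul (-z) (s.indicator V') y +
          V' y * (osc (-z) y * (zsP U V y z - 1))) s := i1.add i2
      rw [intervalIntegral.integral_of_le (by simp), Pi.add_apply, Pi.add_apply,
        ← integral_add i1 i2, ← integral_add i4 i3]
      refine setIntegral_congr_fun hsm fun y hy => ?_
      have hy' : y ∈ s := hy
      simp only [modul, indicator_of_mem hy']
      ring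
    have m1 : AEStronglyMeasurable (fun z => ∫ y in s, modul (-z) (s.indicator V') y) volume := by
      have hoscc : Continuous (Function.uncurry fun y z : ℝ => osc (-z) y) := by
        unfold Function.uncurry; fun_prop
      have := continuous_integral_mul hV'i (G := fun y z => osc (-z) y) (M := 1)
        hoscc (fun y z => by simp) s
      simpa only [modul, mul_comm] using this.aestronglyMeasurable
    have m2 : AEStronglyMeasurable
        (fun z => ∫ y in s, V' y * (osc (-z) y * (zsP U V y z - 1))) volume := by
      have := continuous_integral_mul hV'i hG2 (M := zsConst c + 1) (fun y z => by
        rw [norm_mul, norm_osc, one_mul]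
        refine (norm_sub_le _ _).trans ?_
        rw [norm_one]
        linarith [hp.bdd y z]) s
      refine this.aestronglyMeasurable.congr (.of_forall fun z => ?_)
      refine setIntegral_congr_fun hsm fun y hy => ?_
      simp only [indicator_of_mem hy]
    have m3 : AEStronglyMeasurable (fun z => ∫ y in s, U y * V y * zsR U V y z) volume :=
      (continuous_integral_mul hUV.integrable hRc hRb s).aestronglyMeasurable
    rw [e]
    refine (eLpNorm_add_le (m1.add m2) m3 (by norm_num)).trans ?_
    push_cast
    refine add_le_add ((eLpNorm_add_le m1 m2 (by norm_num)).trans (add_le_add ?_ ?_)) ?_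
    · refine (eLpNorm_setIntegral_modul_le hV'i hV's hsm).trans ?_
      exact mul_le_mul_right ((eLpNorm_indicator_le _).trans ((eLpNorm_indicator_le _).trans h2)) _
    · refine (eLpNorm_integral_mul_le hV'm hG2 _ _).trans ?_
      calc ∫⁻ y in s, ‖V' y‖ₑ * eLpNorm (fun z => osc (-z) y * (zsP U V y z - 1)) 2 volume
          ≤ ∫⁻ y in s, zsConst c * (‖V' y‖ₑ * ENNReal.ofReal (bracket y)⁻¹) := by
            refine setLIntegral_mono' hsm fun y hy => ?_
            rw [eLpNorm_osc_neg_mul, mul_left_comm]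
            exact mul_le_mul_right (hp.l2 y hy.2) _
        _ ≤ zsConst c * (c * 2) := by
            refine (setLIntegral_le_lintegral _ _).trans ?_
            rw [lintegral_const_mul' _ _ ENNReal.coe_ne_top]
            gcongr
            exact (lintegral_enorm_mul_bracket_inv_le hV'm).trans (by gcongr)
        _ = 2 * c * zsConst c := by ring
    · refine (eLpNorm_integral_mul_le hUV.meas hRc _ _).trans ?_
      refine (lintegral_enorm_mul_le hUV (D := zsConst c) hsm fun y hy => ?_).trans
        (le_of_eq (by push_cast; ring))
      refine (eLpNorm_zs_le hU hV hy.2).2.trans ((le_coe_zsConst c y).trans ?_)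
      exact mul_le_of_le_one_right' (bracket_inv_le_one y)

end

/-! ### The gauge transformation -/

section

/-- The phase `E(x) = (1/2i) ∫_{-∞}^x u v`. -/
def gaugeE (u v : ℝ → ℂ) (x : ℝ) : ℂ := 1 / (2 * Complex.I) * ∫ y in Iic x, u y * v y

/-- The first Zakharov–Shabat potential `u e^{2E}`. -/
def gaugeU (u v : ℝ → ℂ) (y : ℝ) : ℂ := u y * Complex.exp (2 * gaugeE u v y)

/-- The second Zakharov–Shabat potential `(1/2i) (v' - u v² / 2i) e^{-2E}`. -/
def gaugeV (u v v' : ℝ → ℂ) (y : ℝ) : ℂ :=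
  1 / (2 * Complex.I) *
    ((v' y + -(1 / (2 * Complex.I)) * (u y * v y ^ 2)) * Complex.exp (-2 * gaugeE u v y))

/-- The weight `v e^{-E}`. -/
def gaugeW (u v : ℝ → ℂ) (y : ℝ) : ℂ := v y * Complex.exp (-1 * gaugeE u v y)

theorem norm_one_div_two_I : ‖(1 / (2 * Complex.I) : ℂ)‖ = 1 / 2 := by simp

theorem one_div_two_I_mul : (2 * Complex.I) * (1 / (2 * Complex.I)) = 1 :=
  mul_one_div_cancel (by simp)

/-- A bound of the gauge factors `e^{±E}`, `e^{±2E}`. -/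
def gaugeM (γ : ℝ≥0) : ℝ≥0 := (Real.exp (4 * γ ^ 2)).toNNReal

theorem coe_gaugeM (γ : ℝ≥0) : (gaugeM γ : ℝ) = Real.exp (4 * γ ^ 2) :=
  Real.coe_toNNReal _ (Real.exp_nonneg _)

/-- A common `L^{2,1}` bound of the transformed potentials. -/
def gaugeConst (γ : ℝ≥0) : ℝ≥0 :=
  gaugeM γ * (γ + ‖(-(1 / (2 * Complex.I)) : ℂ)‖₊ * (4 * γ ^ 2 * γ))

variable {γ : ℝ≥0} {u u' v v' : ℝ → ℂ}

theorem W11.integrable_mul (hu : W11 γ u u') (hv : W11 γ v v') :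
    Integrable (fun y => u y * v y) volume :=
  hu.fn.integrable.mul_bdd hv.ac.continuous.aestronglyMeasurable (.of_forall hv.norm_le)

theorem W11.hasACDeriv_gaugeE (hu : W11 γ u u') (hv : W11 γ v v') :
    HasACDeriv (gaugeE u v) (fun y => 1 / (2 * Complex.I) * (u y * v y)) :=
  (hasACDeriv_integral_Iic (hu.integrable_mul hv)).const_mul _

theorem W11.tendsto_gaugeE (hu : W11 γ u u') (hv : W11 γ v v') :
    Tendsto (gaugeE u v) atBot (𝓝 0) := by
  have := (tendsto_integral_Iic_atBot (hu.integrable_mul hv)).const_mul (1 / (2 * Complex.I))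
  rwa [mul_zero] at this

theorem W11.norm_integral_mul_le (hu : W11 γ u u') (hv : W11 γ v v') :
    ∫ y, ‖u y * v y‖ ≤ 4 * γ ^ 2 := by
  calc ∫ y, ‖u y * v y‖ ≤ ∫ y, ‖u y‖ * (2 * γ) := by
        refine integral_mono (hu.integrable_mul hv).norm (hu.fn.integrable.norm.mul_const _)
          fun y => ?_
        simp only [norm_mul]
        exact mul_le_mul_of_nonneg_left (hv.norm_le y) (norm_nonneg _)
    _ = (∫ y, ‖u y‖) * (2 * γ) := integral_mul_const _ _
    _ ≤ 2 * γ * (2 * γ) := by gcongr; exact hu.fn.integral_norm_le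
    _ = 4 * γ ^ 2 := by ring

theorem W11.norm_exp_gaugeE_le (hu : W11 γ u u') (hv : W11 γ v v') {c : ℂ} (hc : ‖c‖ ≤ 2) (x : ℝ) :
    ‖Complex.exp (c * gaugeE u v x)‖ ≤ gaugeM γ := by
  have h1 := (norm_integral_Iic_le (hu.integrable_mul hv) x).trans (hu.norm_integral_mul_le hv)
  rw [coe_gaugeM]
  refine (Complex.norm_exp_le_exp_norm _).trans (Real.exp_le_exp.2 ?_)
  rw [norm_mul, gaugeE, norm_mul, norm_one_div_two_I]
  nlinarith [norm_nonneg (∫ y in Iic x, u y * v y)]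

theorem W11.continuous_gaugeE (hu : W11 γ u u') (hv : W11 γ v v') : Continuous (gaugeE u v) :=
  (hu.hasACDeriv_gaugeE hv).continuous

theorem W11.l21_gaugeU (hu : W11 γ u u') (hv : W11 γ v v') : L21 (gaugeConst γ) (gaugeU u v) := by
  have hE := hu.continuous_gaugeE hv
  refine (hu.fn.of_norm_le (c := gaugeM γ) (g := gaugeU u v) (hu.fn.meas.mul
    (by fun_prop : Continuous fun y => Complex.exp (2 * gaugeE u v y)).aestronglyMeasurable)
    fun y => ?_).mono ?_
  · rw [gaugeU, norm_mul, mul_comm]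
    gcongr
    exact hu.norm_exp_gaugeE_le hv (by simp) y
  · rw [gaugeConst]; gcongr; exact le_self_add

theorem W11.l21_gaugeW (hu : W11 γ u u') (hv : W11 γ v v') : L21 (gaugeConst γ) (gaugeW u v) := by
  have hE := hu.continuous_gaugeE hv
  refine (hv.fn.of_norm_le (c := gaugeM γ) (g := gaugeW u v) (hv.fn.meas.mul
    (by fun_prop : Continuous fun y => Complex.exp (-1 * gaugeE u v y)).aestronglyMeasurable)
    fun y => ?_).mono ?_
  · rw [gaugeW, norm_mul, mul_comm]
    gcongr
    exact hu.norm_exp_gaugeE_le hv (by simp) y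
  · rw [gaugeConst]; gcongr; exact le_self_add

theorem W11.norm_sq_le (hv : W11 γ v v') (y : ℝ) : ‖v y‖ ^ 2 ≤ 4 * γ ^ 2 := by
  have := hv.norm_le y
  nlinarith [norm_nonneg (v y)]

theorem W11.l21_gaugeV (hu : W11 γ u u') (hv : W11 γ v v') :
    L21 (gaugeConst γ) (gaugeV u v v') := by
  have hE := hu.continuous_gaugeE hv
  have hvc := hv.ac.continuous
  have h1 : L21 (4 * γ ^ 2 * γ) (fun y => u y * v y ^ 2) :=
    hu.fn.of_norm_le (hu.fn.meas.mul (by fun_prop : Continuous fun y => v y ^ 2).aestronglyMeasurable)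
      fun y => by
        rw [norm_mul, mul_comm, norm_pow]
        push_cast
        exact mul_le_mul_of_nonneg_right (hv.norm_sq_le y) (norm_nonneg _)
  have h2 := hv.der.add (h1.const_mul (-(1 / (2 * Complex.I))))
  refine h2.of_norm_le (g := gaugeV u v v') (c := gaugeM γ) ((h2.meas.mul
    (by fun_prop : Continuous fun y => Complex.exp (-2 * gaugeE u v y)).aestronglyMeasurable).const_mul
    _) fun y => ?_
  rw [gaugeV, norm_mul, norm_mul, norm_one_div_two_I]
  have h3 := hu.norm_exp_gaugeE_le hv (c := -2) (by simp) y
  have h4 := mul_le_mul_of_nonneg_left h3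
    (norm_nonneg (v' y + -(1 / (2 * Complex.I)) * (u y * v y ^ 2)))
  have h5 : 0 ≤ ‖v' y + -(1 / (2 * Complex.I)) * (u y * v y ^ 2)‖ *
      ‖Complex.exp (-2 * gaugeE u v y)‖ := by positivity
  linarith

/-! ### The half-line transmission functions -/

/-- The first component at `x = 0` of the solution of the spectral problem normalised at `-∞`. -/
def halfF (u v : ℝ → ℂ) (z : ℝ) : ℂ := solF (modul z fun y => z * u y) (modul (-z) v) 0

/-- The second component at `x = 0`, divided by `k`, of the solution of the spectral problem
normalised at `-∞`. -/
def halfR (u v : ℝ → ℂ) (z : ℝ) : ℂ := solG (modul z fun y => z * u y) (modul (-z) v) 0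

/-- The gauge transformation turns the spectral problem, whose potential is multiplied by the
spectral parameter, into a Zakharov–Shabat system. -/
theorem W11.sol_eq (hu : W11 γ u u') (hv : W11 γ v v') (z : ℝ) :
    (∀ x, solF (modul z fun y => z * u y) (modul (-z) v) x =
      Complex.exp (-1 * gaugeE u v x) * zsP (gaugeU u v) (gaugeV u v v') x z) ∧
    (∀ x, solG (modul z fun y => z * u y) (modul (-z) v) x =
      ∫ y in Iic x, gaugeW u v y * (osc (-z) y * zsP (gaugeU u v) (gaugeV u v v') y z)) ∧
    ∀ x, z * solG (modul z fun y => z * u y) (modul (-z) v) x =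
      Complex.exp (1 * gaugeE u v x) * zsR (gaugeU u v) (gaugeV u v v') x z -
        1 / (2 * Complex.I) * (osc (-z) x * (v x *
          (Complex.exp (-1 * gaugeE u v x) * zsP (gaugeU u v) (gaugeV u v v') x z))) := by
  have hU := hu.l21_gaugeU hv
  have hV := hu.l21_gaugeV hv
  have hW := hu.l21_gaugeW hv
  have hEac := hu.hasACDeriv_gaugeE hv
  have hEc := hEac.continuous
  set p : ℝ → ℂ := fun x => zsP (gaugeU u v) (gaugeV u v v') x z with hp
  set r : ℝ → ℂ := fun x => zsR (gaugeU u v) (gaugeV u v v') x z with hr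
  set f : ℝ → ℂ := fun x => Complex.exp (-1 * gaugeE u v x) * p x with hf
  set ρ : ℝ → ℂ := fun x => ∫ y in Iic x, gaugeW u v y * (osc (-z) y * p y) with hρ
  have hPac : HasACDeriv p (fun y => modul z (gaugeU u v) y * r y) :=
    hasACDeriv_solF (integrable_modul hU.integrable z)
  have hRac : HasACDeriv r (fun y => modul (-z) (gaugeV u v v') y * p y) :=
    hasACDeriv_solG (integrable_modul hV.integrable (-z))
  have hpc := hPac.continuous
  have hfac := (hEac.const_mul (-1)).cexp.mul hPac
  have hfc : Continuous f := hfac.continuous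
  have hpb (x : ℝ) : ‖p x‖ ≤ zsConst (gaugeConst γ) := (halfLineBound_zsP hU hV).bdd x z
  have hfb (x : ℝ) : ‖f x‖ ≤ gaugeM γ * zsConst (gaugeConst γ) := by
    rw [hf, norm_mul]
    exact mul_le_mul (hu.norm_exp_gaugeE_le hv (by simp) x) (hpb x) (norm_nonneg _) (by positivity)
  have hWp : Integrable (fun y => gaugeW u v y * (osc (-z) y * p y)) volume :=
    hW.integrable.mul_bdd (c := zsConst (gaugeConst γ)) (Continuous.aestronglyMeasurable
      (by fun_prop)) (.of_forall fun y => by rw [norm_mul, norm_osc, one_mul]; exact hpb y)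
  have hexp (x : ℝ) : Complex.exp (1 * gaugeE u v x) * Complex.exp (-1 * gaugeE u v x) = 1 := by
    rw [← Complex.exp_add]; simp
  have hexp1 (x : ℝ) : Complex.exp (2 * gaugeE u v x) =
      Complex.exp (1 * gaugeE u v x) * Complex.exp (1 * gaugeE u v x) := by
    rw [← Complex.exp_add]; ring_nf
  have hexp2 (x : ℝ) : Complex.exp (-2 * gaugeE u v x) =
      Complex.exp (-1 * gaugeE u v x) * Complex.exp (-1 * gaugeE u v x) := by
    rw [← Complex.exp_add]; ring_nf
  have hI := one_div_two_I_mul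
  have e1 : Tendsto (fun x => Complex.exp (1 * gaugeE u v x)) atBot (𝓝 1) := by
    have := (Complex.continuous_exp.tendsto _).comp ((hu.tendsto_gaugeE hv).const_mul 1)
    simpa [Function.comp_def] using this
  have e2 : Tendsto (fun x => Complex.exp (-1 * gaugeE u v x)) atBot (𝓝 1) := by
    have := (Complex.continuous_exp.tendsto _).comp ((hu.tendsto_gaugeE hv).const_mul (-1))
    simpa [Function.comp_def] using this
  have tr : Tendsto r atBot (𝓝 0) := tendsto_solG (integrable_modul hV.integrable (-z))
  have tp : Tendsto p atBot (𝓝 1) := tendsto_solF (integrable_modul hU.integrable z)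
  have tf : Tendsto f atBot (𝓝 1) := by
    have := e2.mul tp
    rwa [one_mul] at this
  have hzρ (x : ℝ) : z * ρ x = Complex.exp (1 * gaugeE u v x) * r x -
        1 / (2 * Complex.I) * (osc (-z) x * (v x * f x)) := by
    have hac := ((hEac.const_mul 1).cexp.mul hRac).sub
      (((hasACDeriv_osc (-z)).mul (hv.ac.mul hfac)).const_mul (1 / (2 * Complex.I)))
    have hac' := hac.congr_deriv (g := fun y => z * (gaugeW u v y * (osc (-z) y * p y)))
      (.of_forall fun y => by
        have o := osc_neg_mul_self z y
        have a := hexp y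
        simp only [modul, gaugeU, gaugeV, gaugeW, hexp1, hexp2]
        generalize 1 / (2 * Complex.I) = i2 at hI ⊢
        generalize Complex.exp (1 * gaugeE u v y) = A at a ⊢
        generalize Complex.exp (-1 * gaugeE u v y) = B at a ⊢
        push_cast
        linear_combination (B * z * osc (-z) y * v y * p y) * hI
          + (i2 * osc (-z) y * v' y * B * p y - i2 * i2 * osc (-z) y * u y * v y ^ 2 * B * p y
            - i2 * v y * u y * A * r y * osc (-z) y * osc z y) * a
          - i2 * v y * u y * r y * A * o)
    rw [hρ, ← integral_const_mul]
    refine hac'.integral_Iic (hWp.const_mul _) ?_ x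
    have t1 : Tendsto (fun x => osc (-z) x * (v x * f x)) atBot (𝓝 0) := by
      refine squeeze_zero_norm (a := fun x => ‖v x‖ * (gaugeM γ * zsConst (gaugeConst γ)))
        (fun x => ?_) ?_
      · rw [norm_mul, norm_osc, one_mul, norm_mul]
        exact mul_le_mul_of_nonneg_left (hfb x) (norm_nonneg _)
      · simpa using hv.tendsto_atBot.norm.mul_const (gaugeM γ * zsConst (gaugeConst γ) : ℝ)
    have := (e1.mul tr).sub (t1.const_mul (1 / (2 * Complex.I)))
    rwa [mul_zero, mul_zero, sub_zero] at this
  have hρb (x : ℝ) : ‖ρ x‖ ≤ ∫ y, ‖gaugeW u v y * (osc (-z) y * p y)‖ := norm_integral_Iic_le hWp x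
  have hρc : Continuous ρ := (hasACDeriv_integral_Iic hWp).continuous
  have hρm : MemLp ρ ∞ volume := memLp_top_of_bound hρc.aestronglyMeasurable _ (.of_forall hρb)
  have hAi : Integrable (modul z fun y => z * u y) volume :=
    integrable_modul (hu.fn.integrable.const_mul _) z
  have key := sol_unique (A := modul z fun y => z * u y) (B := modul (-z) v) hAi
    (integrable_modul hv.fn.integrable _) (f := f) (g := ρ)
    (memLp_top_of_bound hfc.aestronglyMeasurable _ (.of_forall hfb)) hρm (fun x => ?_) fun x => ?_
  · have k1 := key.1
    have k2 := key.2
    refine ⟨fun x => (congrFun k1 x).symm, fun x => (congrFun k2 x).symm, fun x => ?_⟩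
    rw [← congrFun k2 x]
    exact hzρ x
  · have hac' := (hfac.sub (.const 1)).congr_deriv
      (g := fun y => (modul z fun y => z * u y) y * ρ y) (.of_forall fun y => by
        have o := osc_neg_mul_self z y
        have a := hexp y
        have b := hzρ y
        simp only [modul, gaugeU, hexp1, hf] at b ⊢
        generalize 1 / (2 * Complex.I) = i2 at hI b ⊢
        generalize Complex.exp (1 * gaugeE u v y) = A at a b ⊢
        generalize Complex.exp (-1 * gaugeE u v y) = B at a b ⊢
        linear_combination (u y * osc z y * A * r y) * a - u y * osc z y * b
          + (i2 * u y * v y * B * p y) * o)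
    have t1 : Tendsto (fun x => f x - 1) atBot (𝓝 0) := by
      have := tf.sub_const 1
      rwa [sub_self] at this
    have := hac'.integral_Iic (hAi.mul_memLp_top hρm) t1 x
    rw [this]; ring
  · refine integral_congr_ae (.of_forall fun y => ?_)
    simp only [modul, gaugeW, hf]; ring

end

/-! ### Bounds of the half-line transmission functions -/

section

variable {γ : ℝ≥0} {u u' v v' v'' : ℝ → ℂ}

/-- The combination `z R + v(0) F / 2i`, in which the slow decay of `z R` is cancelled. -/
def halfZ (u v : ℝ → ℂ) (z : ℝ) : ℂ :=
  z * halfR u v z + 1 / (2 * Complex.I) * (v 0 * halfF u v z)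

/-- The uniform bounds of the half-line transmission functions. -/
structure HalfBound (C : ℝ≥0) (u v : ℝ → ℂ) : Prop where
  exp : ‖Complex.exp (-1 * gaugeE u v 0)‖ ≤ C
  F : SobBound C (fun z => halfF u v z - Complex.exp (-1 * gaugeE u v 0))
  R : SobBound C (halfR u v)
  Z : SobBound C (halfZ u v)

theorem W11.halfF_eq (hu : W11 γ u u') (hv : W11 γ v v') (z : ℝ) :
    halfF u v z = Complex.exp (-1 * gaugeE u v 0) * zsP (gaugeU u v) (gaugeV u v v') 0 z :=
  (hu.sol_eq hv z).1 0

/-- `halfZ` is a Zakharov–Shabat solution at the origin, up to a gauge factor, and so satisfies the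
`H¹_z` bounds although it contains the factor `z`. -/
theorem W11.halfZ_eq (hu : W11 γ u u') (hv : W11 γ v v') (z : ℝ) :
    halfZ u v z = Complex.exp (1 * gaugeE u v 0) * zsR (gaugeU u v) (gaugeV u v v') 0 z := by
  have h := (hu.sol_eq hv z).2.2 0
  rw [osc_zero_right, ← hu.halfF_eq hv] at h
  rw [halfZ, halfR, h]; ring

theorem exists_halfBound (γ : ℝ≥0) : ∃ C : ℝ≥0, ∀ u u' v v' : ℝ → ℂ, W11 γ u u' → W11 γ v v' →
    HalfBound C u v := by
  obtain ⟨C, hC⟩ := exists_sobBound_zs (gaugeConst γ)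
  refine ⟨gaugeM γ * C + gaugeM γ + C, fun u u' v v' hu hv => ?_⟩
  obtain ⟨h1, h2, h3⟩ := hC _ _ (hu.l21_gaugeU hv) (hu.l21_gaugeV hv)
  have hm := hu.norm_exp_gaugeE_le hv (c := -1) (by simp) 0
  have hm' := hu.norm_exp_gaugeE_le hv (c := 1) (by simp) 0
  have hle : gaugeM γ * C ≤ gaugeM γ * C + gaugeM γ + C := by rw [add_assoc]; exact le_self_add
  refine ⟨hm.trans ?_, ?_, ?_, ?_⟩
  · exact_mod_cast (le_add_self : gaugeM γ ≤ gaugeM γ * C + gaugeM γ).trans le_self_add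
  · have e : (fun z => halfF u v z - Complex.exp (-1 * gaugeE u v 0)) = fun z =>
        Complex.exp (-1 * gaugeE u v 0) * (zsP (gaugeU u v) (gaugeV u v v') 0 z - 1) := by
      funext z; rw [hu.halfF_eq hv]; ring
    rw [e]
    exact (h1.const_mul hm).mono hle
  · have e : halfR u v = fun z => ∫ y in Iic 0,
        gaugeW u v y * (osc (-z) y * zsP (gaugeU u v) (gaugeV u v v') y z) := by
      funext z; exact (hu.sol_eq hv z).2.1 0
    rw [e]
    exact (h3 _ (hu.l21_gaugeW hv)).mono le_add_self
  · rw [funext (hu.halfZ_eq hv)]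
    exact (h2.const_mul hm').mono hle

/-- A square-integrable function with square-integrable derivative is bounded and vanishes at
`-∞`, by integration of its square. -/
theorem HasACDeriv.of_memLp_two (hac : HasACDeriv v v') (h : eLpNorm v 2 volume ≤ γ)
    (h' : eLpNorm v' 2 volume ≤ γ) : Tendsto v atBot (𝓝 0) ∧ ∀ x, ‖v x‖ ≤ 2 * γ := by
  have hm := hac.continuous.aestronglyMeasurable (μ := volume)
  have hm' := hac.locInt.aestronglyMeasurable
  have hL : MemLp v 2 volume := ⟨hm, h.trans_lt ENNReal.coe_lt_top⟩
  have hL' : MemLp v' 2 volume := ⟨hm', h'.trans_lt ENNReal.coe_lt_top⟩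
  have i1 : Integrable (fun x => v x * v x) volume := hL.integrable_mul hL
  have i2 : Integrable (fun x => v' x * v x) volume := hL'.integrable_mul hL
  have i3 : Integrable (fun x => v x * v' x) volume := hL.integrable_mul hL'
  have i4 : Integrable (fun x => v' x * v x + v x * v' x) volume := i2.add i3
  have hsq := hac.mul hac
  have t := hsq.tendsto_atBot_zero i1 i4
  refine ⟨?_, fun x => ?_⟩
  · have := t.norm.sqrt
    simp only [norm_mul, norm_zero, Real.sqrt_zero, Real.sqrt_mul_self (norm_nonneg _)] at this
    exact tendsto_zero_iff_norm_tendsto_zero.2 this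
  · have e := hsq.integral_Iic i4 t x
    have b : ∫ y, ‖v' y * v y + v y * v' y‖ ≤ 2 * γ ^ 2 := by
      rw [integral_norm_eq_lintegral_enorm i4.1]
      refine ENNReal.toReal_le_of_le_ofReal (by positivity) ?_
      have hh := ENNReal.lintegral_mul_le_Lp_mul_Lq (volume : Measure ℝ)
        Real.HolderConjugate.two_two hm.enorm hm'.enorm
      have n1 := h
      have n2 := h'
      rw [eLpNorm_eq_lintegral_rpow_enorm_toReal two_ne_zero ENNReal.ofNat_ne_top] at n1 n2
      calc ∫⁻ y, ‖v' y * v y + v y * v' y‖ₑ ≤ ∫⁻ y, 2 * (‖v y‖ₑ * ‖v' y‖ₑ) := by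
            refine lintegral_mono fun y => ?_
            rw [mul_comm (v' y), ← two_mul, enorm_mul, enorm_mul]
            simp [← ofReal_norm]
        _ = 2 * ∫⁻ y, ‖v y‖ₑ * ‖v' y‖ₑ := lintegral_const_mul' _ _ (by norm_num)
        _ ≤ 2 * (γ * γ) := by
            gcongr
            refine hh.trans (mul_le_mul' ?_ ?_)
            · simpa using n1
            · simpa using n2
        _ = ENNReal.ofReal (2 * γ ^ 2) := by
            rw [ENNReal.ofReal_mul (by norm_num), ENNReal.ofReal_pow (by positivity), sq]; simp
    have hx : ‖v x * v x‖ ≤ 2 * γ ^ 2 := by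
      rw [← e]; exact (norm_integral_Iic_le i4 x).trans b
    rw [norm_mul] at hx
    nlinarith [norm_nonneg (v x), γ.coe_nonneg]

/-- The derivative of `gaugeV`, apart from the factor `1/2i`. -/
def gaugeV' (u u' v v' v'' : ℝ → ℂ) (y : ℝ) : ℂ :=
  Complex.exp (-2 * gaugeE u v y) *
    (v'' y + -(1 / (2 * Complex.I)) * (u' y * v y ^ 2 + u y * (2 * (v y * v' y))) +
      (v' y + -(1 / (2 * Complex.I)) * (u y * v y ^ 2)) *
        (-2 * (1 / (2 * Complex.I) * (u y * v y))))

theorem W11.hasACDeriv_gaugeV (hu : W11 γ u u') (hv : W11 γ v v') (hv' : HasACDeriv v' v'') :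
    HasACDeriv (gaugeV u v v') (fun y => 1 / (2 * Complex.I) * gaugeV' u u' v v' v'' y) := by
  have h := ((hv'.add ((hu.ac.mul (hv.ac.mul hv.ac)).const_mul (-(1 / (2 * Complex.I))))).mul
    (((hu.hasACDeriv_gaugeE hv).const_mul (-2)).cexp)).const_mul (1 / (2 * Complex.I))
  have e : gaugeV u v v' = fun y => 1 / (2 * Complex.I) *
      ((v' y + -(1 / (2 * Complex.I)) * (u y * (v y * v y))) *
        Complex.exp (-2 * gaugeE u v y)) := by
    funext y; rw [gaugeV, sq]
  rw [e]
  refine h.congr_deriv (.of_forall fun y => ?_)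
  simp only [gaugeV']
  ring

theorem W11.norm_gaugeV'_le (hu : W11 γ u u') (hv : W11 γ v v') (y : ℝ) :
    ‖1 / (2 * Complex.I) * gaugeV' u u' v v' v'' y‖ ≤ gaugeM γ * ‖v'' y‖ +
      gaugeM γ * (2 * γ ^ 2) * ‖u' y‖ + gaugeM γ * (8 * γ ^ 2) * ‖v' y‖ +
        gaugeM γ * (8 * γ ^ 4) * ‖u y‖ := by
  have hE := hu.norm_exp_gaugeE_le hv (c := -2) (by simp) y
  have hu1 := hu.norm_le y
  have hv1 := hv.norm_le y
  have hv2 := hv.norm_sq_le y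
  have n2 : ‖(2 : ℂ)‖ = 2 := by simp
  have n2' : ‖(-2 : ℂ)‖ = 2 := by simp
  have a2 := mul_le_mul hu1 hv1 (norm_nonneg _) (by positivity)
  have b1 : ‖-(1 / (2 * Complex.I)) * (u' y * v y ^ 2 + u y * (2 * (v y * v' y)))‖ ≤
      2 * γ ^ 2 * ‖u' y‖ + 4 * γ ^ 2 * ‖v' y‖ := by
    rw [norm_mul, norm_neg, norm_one_div_two_I]
    have := norm_add_le (u' y * v y ^ 2) (u y * (2 * (v y * v' y)))
    rw [norm_mul, norm_mul, norm_mul, norm_mul, norm_pow, n2] at this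
    have a1 := mul_le_mul_of_nonneg_left hv2 (norm_nonneg (u' y))
    have a3 := mul_le_mul_of_nonneg_right a2 (norm_nonneg (v' y))
    linarith
  have b2 : ‖-2 * (1 / (2 * Complex.I) * (u y * v y))‖ ≤ 4 * γ ^ 2 := by
    rw [norm_mul, norm_mul, norm_one_div_two_I, norm_mul, n2']
    linarith
  have b3 : ‖v' y + -(1 / (2 * Complex.I)) * (u y * v y ^ 2)‖ ≤
      ‖v' y‖ + 2 * γ ^ 2 * ‖u y‖ := by
    refine (norm_add_le _ _).trans ?_
    rw [norm_mul, norm_neg, norm_one_div_two_I, norm_mul, norm_pow]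
    have := mul_le_mul_of_nonneg_left hv2 (norm_nonneg (u y))
    linarith
  have b4 := mul_le_mul b3 b2 (norm_nonneg _) (by positivity)
  rw [← norm_mul] at b4
  rw [norm_mul, norm_one_div_two_I, gaugeV', norm_mul]
  generalize Complex.exp (-2 * gaugeE u v y) = e at hE ⊢
  set q := -(1 / (2 * Complex.I)) * (u' y * v y ^ 2 + u y * (2 * (v y * v' y)))
  set p := (v' y + -(1 / (2 * Complex.I)) * (u y * v y ^ 2)) *
      (-2 * (1 / (2 * Complex.I) * (u y * v y)))
  have b5 : ‖v'' y + q + p‖ ≤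
      ‖v'' y‖ + 2 * γ ^ 2 * ‖u' y‖ + 8 * γ ^ 2 * ‖v' y‖ + 8 * γ ^ 4 * ‖u y‖ := by
    refine (norm_add₃_le).trans ?_
    linarith
  have b6 := mul_le_mul hE b5 (norm_nonneg _) (NNReal.coe_nonneg _)
  have b7 := mul_nonneg (norm_nonneg e) (norm_nonneg (v'' y + q + p))
  linarith

theorem eLpNorm_le_of_norm_le_four {f g₁ g₂ g₃ g₄ : ℝ → ℂ} {c₁ c₂ c₃ c₄ : ℝ≥0}
    (m₁ : AEStronglyMeasurable g₁ volume) (m₂ : AEStronglyMeasurable g₂ volume)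
    (m₃ : AEStronglyMeasurable g₃ volume) (m₄ : AEStronglyMeasurable g₄ volume)
    (n₁ : eLpNorm g₁ 2 volume ≤ γ) (n₂ : eLpNorm g₂ 2 volume ≤ γ)
    (n₃ : eLpNorm g₃ 2 volume ≤ γ) (n₄ : eLpNorm g₄ 2 volume ≤ γ)
    (h : ∀ y, ‖f y‖ ≤ c₁ * ‖g₁ y‖ + c₂ * ‖g₂ y‖ + c₃ * ‖g₃ y‖ + c₄ * ‖g₄ y‖) :
    eLpNorm f 2 volume ≤ (c₁ * γ + c₂ * γ + c₃ * γ + c₄ * γ : ℝ≥0) := by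
  have n (c : ℝ≥0) (g : ℝ → ℂ) (hg : eLpNorm g 2 volume ≤ γ) :
      eLpNorm (fun y => (c : ℝ) * ‖g y‖) 2 volume ≤ c * γ := by
    refine (eLpNorm_const_smul (c : ℝ) (fun y => ‖g y‖) 2 volume).le.trans ?_
    rw [eLpNorm_norm, Real.enorm_eq_ofReal c.coe_nonneg, ENNReal.ofReal_coe_nnreal]
    gcongr
  have k₁ := m₁.norm.const_mul (c₁ : ℝ)
  have k₂ := m₂.norm.const_mul (c₂ : ℝ)
  have k₃ := m₃.norm.const_mul (c₃ : ℝ)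
  have k₄ := m₄.norm.const_mul (c₄ : ℝ)
  refine (eLpNorm_mono_real h).trans ?_
  refine (eLpNorm_add_le ((k₁.add k₂).add k₃) k₄ (by norm_num)).trans ?_
  push_cast
  exact add_le_add ((eLpNorm_add_le (k₁.add k₂) k₃ (by norm_num)).trans (add_le_add
    ((eLpNorm_add_le k₁ k₂ (by norm_num)).trans (add_le_add (n c₁ _ n₁) (n c₂ _ n₂)))
    (n c₃ _ n₃))) (n c₄ _ n₄)

theorem exists_eLpNorm_gaugeV'_le (γ : ℝ≥0) : ∃ C : ℝ≥0, ∀ u u' v v' v'' : ℝ → ℂ, W11 γ u u' →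
    W11 γ v v' → HasACDeriv v' v'' → eLpNorm v'' 2 volume ≤ γ →
    eLpNorm (fun y => 1 / (2 * Complex.I) * gaugeV' u u' v v' v'' y) 2 volume ≤ C :=
  ⟨_, fun _ _ _ _ _ hu hv hv' h2 => eLpNorm_le_of_norm_le_four (c₁ := gaugeM γ)
    (c₂ := gaugeM γ * (2 * γ ^ 2)) (c₃ := gaugeM γ * (8 * γ ^ 2)) (c₄ := gaugeM γ * (8 * γ ^ 4))
    hv'.locInt.aestronglyMeasurable hu.der.meas hv.der.meas hu.fn.meas h2 hu.der.memLp.2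
    hv.der.memLp.2 hu.fn.memLp.2 fun y => by
      push_cast
      exact hu.norm_gaugeV'_le hv y⟩

/-- The coefficient `(1/2i) (v'(0) - u(0) v(0)² / 2i)`. -/
def halfCoeff (u v v' : ℝ → ℂ) : ℂ :=
  1 / (2 * Complex.I) * (v' 0 + -(1 / (2 * Complex.I)) * (u 0 * v 0 ^ 2))

/-- For `v ∈ H²` the function `z halfZ` is in `L²_z` up to a multiple of `halfF`. -/
theorem exists_eLpNorm_mul_halfZ_le (γ : ℝ≥0) : ∃ C : ℝ≥0, ∀ u u' v v' v'' : ℝ → ℂ, W11 γ u u' →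
    W11 γ v v' → HasACDeriv v' v'' → eLpNorm v'' 2 volume ≤ γ →
    eLpNorm (fun z => z * halfZ u v z +
      1 / (2 * Complex.I) * (halfCoeff u v v' * halfF u v z)) 2 volume ≤ C := by
  obtain ⟨C₁, hC₁⟩ := exists_eLpNorm_gaugeV'_le γ
  set c : ℝ≥0 := gaugeConst γ + C₁ + gaugeM γ * (2 * γ + 4 * γ ^ 2 * (2 * γ)) with hc
  obtain ⟨C, hC⟩ := exists_eLpNorm_zsR_le c
  refine ⟨gaugeM γ * C, fun u u' v v' v'' hu hv hv' h2 => ?_⟩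
  obtain ⟨t0, hb⟩ := hv'.of_memLp_two hv.der.memLp.2 h2
  have hm (x : ℝ) := hu.norm_exp_gaugeE_le hv (c := -2) (by simp) x
  have h := hC (gaugeU u v) (gaugeV u v v') _
    ((hu.l21_gaugeU hv).mono (by rw [hc, add_assoc]; exact le_self_add))
    ((hu.l21_gaugeV hv).mono (by rw [hc, add_assoc]; exact le_self_add))
    (hu.hasACDeriv_gaugeV hv hv') (fun x => ?_) ?_
    ((hC₁ _ _ _ _ _ hu hv hv' h2).trans (by
      rw [hc]; exact_mod_cast (le_add_self : C₁ ≤ gaugeConst γ + C₁).trans le_self_add))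
  · have hm' := hu.norm_exp_gaugeE_le hv (c := 1) (by simp) 0
    have e : (fun z : ℝ => z * halfZ u v z +
        1 / (2 * Complex.I) * (halfCoeff u v v' * halfF u v z)) =
        fun z : ℝ => (1 / (2 * Complex.I) * Complex.exp (1 * gaugeE u v 0)) *
          (2 * Complex.I * z * zsR (gaugeU u v) (gaugeV u v v') 0 z +
            gaugeV u v v' 0 * zsP (gaugeU u v) (gaugeV u v v') 0 z) := by
      funext z
      have hI := one_div_two_I_mul
      have a : Complex.exp (1 * gaugeE u v 0) * Complex.exp (-1 * gaugeE u v 0) = 1 := by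
        rw [← Complex.exp_add]; simp
      have b : Complex.exp (-2 * gaugeE u v 0) =
          Complex.exp (-1 * gaugeE u v 0) * Complex.exp (-1 * gaugeE u v 0) := by
        rw [← Complex.exp_add]; ring_nf
      rw [hu.halfZ_eq hv, hu.halfF_eq hv, halfCoeff, gaugeV, b]
      generalize 1 / (2 * Complex.I) = i2 at hI ⊢
      generalize Complex.exp (1 * gaugeE u v 0) = A at a ⊢
      generalize Complex.exp (-1 * gaugeE u v 0) = B at a ⊢
      linear_combination (-A * z * zsR (gaugeU u v) (gaugeV u v v') 0 z) * hI
        - (i2 * i2 * (v' 0 + -i2 * (u 0 * v 0 ^ 2)) * B *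
          zsP (gaugeU u v) (gaugeV u v v') 0 z) * a
    rw [e]
    refine (eLpNorm_mul_le_of_bdd (C := gaugeM γ) (f := fun _ => 1 / (2 * Complex.I) *
      Complex.exp (1 * gaugeE u v 0)) fun z => ?_).trans ?_
    · rw [norm_mul, norm_one_div_two_I]
      linarith [norm_nonneg (Complex.exp (1 * gaugeE u v 0))]
    · push_cast
      gcongr
  · have h1 : ‖gaugeV u v v' x‖ ≤ gaugeM γ * (2 * γ + 4 * γ ^ 2 * (2 * γ)) := by
      have h3 : ‖v' x + -(1 / (2 * Complex.I)) * (u x * v x ^ 2)‖ ≤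
          2 * γ + 4 * γ ^ 2 * (2 * γ) := by
        refine (norm_add_le _ _).trans (add_le_add (hb x) ?_)
        rw [norm_mul, norm_neg, norm_one_div_two_I, norm_mul, norm_pow]
        have := mul_le_mul (hu.norm_le x) (hv.norm_sq_le x) (by positivity) (by positivity)
        have h0 : 0 ≤ ‖u x‖ * ‖v x‖ ^ 2 := by positivity
        linarith
      have h4 := mul_le_mul h3 (hm x) (norm_nonneg _) (by positivity)
      rw [gaugeV, norm_mul, norm_mul, norm_one_div_two_I]
      have h0 : 0 ≤ ‖v' x + -(1 / (2 * Complex.I)) * (u x * v x ^ 2)‖ *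
        ‖Complex.exp (-2 * gaugeE u v x)‖ := by positivity
      linarith
    refine h1.trans ?_
    have : gaugeM γ * (2 * γ + 4 * γ ^ 2 * (2 * γ)) ≤ c := le_add_self
    exact_mod_cast this
  · have t1 : Tendsto (fun x => v' x + -(1 / (2 * Complex.I)) * (u x * v x ^ 2)) atBot (𝓝 0) := by
      have := t0.add ((hu.tendsto_atBot.mul (hv.tendsto_atBot.pow 2)).const_mul
        (-(1 / (2 * Complex.I))))
      rwa [zero_mul, mul_zero, add_zero] at this
    refine squeeze_zero_norm (a := fun x =>
      ‖v' x + -(1 / (2 * Complex.I)) * (u x * v x ^ 2)‖ * gaugeM γ) (fun x => ?_) ?_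
    · rw [gaugeV, norm_mul, norm_mul, norm_one_div_two_I]
      have h0 : 0 ≤ ‖v' x + -(1 / (2 * Complex.I)) * (u x * v x ^ 2)‖ *
        ‖Complex.exp (-2 * gaugeE u v x)‖ := by positivity
      have := mul_le_mul_of_nonneg_left (hm x)
        (norm_nonneg (v' x + -(1 / (2 * Complex.I)) * (u x * v x ^ 2)))
      linarith
    · have := t1.norm.mul_const (gaugeM γ : ℝ)
      rwa [norm_zero, zero_mul] at this

end

/-! ### Bounds of the scattering data of a general pair of potentials -/

section

/-- The reflection `x ↦ u(-x)`. -/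
def rev (u : ℝ → ℂ) (x : ℝ) : ℂ := u (-x)

/-- The coefficient `a` of the pair `(u, v)`: the Wronskian of `φ_-` and `ψ_+` at `x = 0`. -/
def aFn (u v : ℝ → ℂ) (z : ℝ) : ℂ :=
  halfF u v z * halfF (rev v) (rev u) z + z * halfR u v z * halfR (rev v) (rev u) z

/-- The coefficient `k⁻¹ b` of the pair `(u, v)`: the Wronskian of `φ_+` and `φ_-` at `x = 0`, divided
by `k`. -/
def bFn (u v : ℝ → ℂ) (z : ℝ) : ℂ :=
  halfF (-rev u) (rev v) (-z) * halfR u v z + halfR (-rev u) (rev v) (-z) * halfF u v z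

/-- The limit of `aFn` at infinity. -/
def aLim (u v : ℝ → ℂ) : ℂ :=
  Complex.exp (-1 * gaugeE u v 0) * Complex.exp (-1 * gaugeE (rev v) (rev u) 0)

/-- The functions `k b, k⁻¹ b, k c, k⁻¹ c` of the pair `(u, v)`. The coefficients `d` and `k⁻¹ c` at
`z` are the coefficients `a` and `k⁻¹ b` of the pair `(-v, u)` at `-z`. -/
def offData (u v : ℝ → ℂ) : Fin 4 → ℝ → ℂ :=
  ![fun z => z * bFn u v z, bFn u v, fun z => z * bFn (-v) u (-z), fun z => bFn (-v) u (-z)]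

/-- The functions `a - a_∞, d - d_∞, k b, k⁻¹ b, k c, k⁻¹ c` of the pair `(u, v)`. -/
def pairData (u v : ℝ → ℂ) : Fin 6 → ℝ → ℂ :=
  Matrix.vecCons (fun z => aFn u v z - aLim u v)
    (Matrix.vecCons (fun z => aFn (-v) u (-z) - aLim (-v) u) (offData u v))

variable {γ δ C : ℝ≥0} {u u' u'' v v' v'' : ℝ → ℂ}

theorem W11.rev (h : W11 γ u u') : W11 γ (rev u) (-NDNLS.rev u') := h.comp_neg

theorem W11.neg_fun (h : W11 γ u u') : W11 γ (-u) (-u') := h.neg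

/-- `(u, u', u'')` is a function with its first two derivatives, of norm at most `γ` in `H^{1,1}` and
with `‖u''‖_{L²} ≤ γ`: an element of `H² ∩ H^{1,1}`. -/
structure W211 (γ : ℝ≥0) (u u' u'' : ℝ → ℂ) : Prop extends W11 γ u u' where
  ac' : HasACDeriv u' u''
  norm' : eLpNorm u'' 2 volume ≤ γ

theorem W211.const_mul (h : W211 γ u u' u'') (c : ℂ) :
    W211 (‖c‖₊ * γ) (fun x => c * u x) (fun x => c * u' x) (fun x => c * u'' x) :=
  ⟨h.toW11.const_mul c, h.ac'.const_mul c, (eLpNorm_const_smul c u'' 2 volume).le.trans (by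
    push_cast; exact mul_le_mul_right h.norm' _)⟩

theorem W211.neg_fun (h : W211 γ u u' u'') : W211 γ (-u) (-u') (-u'') := by
  simpa [Pi.neg_def] using h.const_mul (-1)

theorem W211.add (h : W211 γ u u' u'') (h' : W211 δ v v' v'') :
    W211 (γ + δ) (fun x => u x + v x) (fun x => u' x + v' x) (fun x => u'' x + v'' x) :=
  ⟨h.toW11.add h'.toW11, h.ac'.add h'.ac', (eLpNorm_add_le h.ac'.locInt.aestronglyMeasurable
    h'.ac'.locInt.aestronglyMeasurable (by norm_num)).trans (by
      push_cast; exact add_le_add h.norm' h'.norm')⟩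

theorem W211.mono (h : W211 γ u u' u'') (hγ : γ ≤ δ) : W211 δ u u' u'' :=
  ⟨h.toW11.mono hγ, h.ac', h.norm'.trans (by exact_mod_cast hγ)⟩

theorem W211.conj (h : W211 γ u u' u'') :
    W211 γ (fun x => conj (u x)) (fun x => conj (u' x)) (fun x => conj (u'' x)) :=
  ⟨h.toW11.conj, h.ac'.conj, (eLpNorm_congr_norm_ae (.of_forall fun x => by simp)).trans_le h.norm'⟩

theorem W211.rev (h : W211 γ u u' u'') : W211 γ (rev u) (-NDNLS.rev u') (NDNLS.rev u'') := by
  refine ⟨h.toW11.rev, ?_, ?_⟩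
  · have := h.ac'.comp_neg.const_mul (-1)
    have e1 : -NDNLS.rev u' = fun x => -1 * u' (-x) := by funext x; simp [NDNLS.rev]
    have e2 : NDNLS.rev u'' = fun x => -1 * -u'' (-x) := by funext x; simp [NDNLS.rev]
    rw [e1, e2]
    exact this
  · exact (eLpNorm_comp_measurePreserving h.ac'.locInt.aestronglyMeasurable
      (Measure.measurePreserving_neg volume)).trans_le h.norm'

/-- A product with a function which is in `H¹` up to a constant. -/
theorem SobBound.mul_of_sub_const {F G : ℝ → ℂ} {e : ℂ} (hF : SobBound C (fun z => F z - e))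
    (he : ‖e‖ ≤ C) (hG : SobBound C G) : SobBound (3 * C * C) (fun z => F z * G z) := by
  have h := (hF.mul hG).add (hG.const_mul he)
  have e1 : (fun z => F z * G z) = fun z => (F z - e) * G z + e * G z := by funext z; ring
  rw [e1]
  exact h.mono (le_of_eq (by ring))

theorem exists_sobBound_aFn (γ : ℝ≥0) : ∃ C : ℝ≥0, ∀ u u' v v' : ℝ → ℂ, W11 γ u u' → W11 γ v v' →
    SobBound C (fun z => aFn u v z - aLim u v) := by
  obtain ⟨C, hC⟩ := exists_halfBound γ
  refine ⟨2 * C * C + C * C + C * C + 2 * C * C + γ * (3 * C * C), fun u u' v v' hu hv => ?_⟩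
  have h1 := hC u u' v v' hu hv
  have h4 := hC _ _ _ _ hv.rev hu.rev
  have hv0 : ‖1 / (2 * Complex.I) * v 0‖ ≤ γ := by
    rw [norm_mul, norm_one_div_two_I]; linarith [hv.norm_le 0]
  have e : (fun z => aFn u v z - aLim u v) = fun z =>
      (halfF u v z - Complex.exp (-1 * gaugeE u v 0)) *
        (halfF (rev v) (rev u) z - Complex.exp (-1 * gaugeE (rev v) (rev u) 0)) +
      Complex.exp (-1 * gaugeE u v 0) *
        (halfF (rev v) (rev u) z - Complex.exp (-1 * gaugeE (rev v) (rev u) 0)) +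
      Complex.exp (-1 * gaugeE (rev v) (rev u) 0) *
        (halfF u v z - Complex.exp (-1 * gaugeE u v 0)) +
      halfZ u v z * halfR (rev v) (rev u) z -
      1 / (2 * Complex.I) * v 0 * (halfF u v z * halfR (rev v) (rev u) z) := by
    funext z
    rw [aFn, aLim, halfZ]; ring
  rw [e]
  exact ((((h1.F.mul h4.F).add (h4.F.const_mul h1.exp)).add (h1.F.const_mul h4.exp)).add
    (h1.Z.mul h4.R)).sub ((h1.F.mul_of_sub_const h1.exp h4.R).const_mul hv0)

theorem rev_zero (u : ℝ → ℂ) : rev u 0 = u 0 := by simp [rev]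

/-- The combination of the half-line data in which the boundary terms at `0` cancel. -/
theorem mul_bFn_eq (u v : ℝ → ℂ) (z : ℝ) : z * bFn u v z =
    halfF (-rev u) (rev v) (-z) * halfZ u v z - halfF u v z * halfZ (-rev u) (rev v) (-z) := by
  rw [bFn, halfZ, halfZ, rev_zero]; push_cast; ring

theorem exists_sobBound_bFn (γ : ℝ≥0) : ∃ C : ℝ≥0, ∀ u u' v v' : ℝ → ℂ, W11 γ u u' → W11 γ v v' →
    SobBound C (bFn u v) ∧ SobBound C (fun z => z * bFn u v z) := by
  obtain ⟨C, hC⟩ := exists_halfBound γ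
  refine ⟨3 * C * C + 3 * C * C, fun u u' v v' hu hv => ?_⟩
  have h1 := hC u u' v v' hu hv
  have h3 := hC _ _ _ _ hu.rev.neg_fun hv.rev
  have f3 : SobBound C fun z => halfF (-rev u) (rev v) (-z) -
      Complex.exp (-1 * gaugeE (-rev u) (rev v) 0) := h3.F.comp_neg
  constructor
  · have e : bFn u v = fun z => halfF (-rev u) (rev v) (-z) * halfR u v z +
        halfF u v z * halfR (-rev u) (rev v) (-z) := by funext z; rw [bFn]; ring
    rw [e]
    exact (f3.mul_of_sub_const h3.exp h1.R).add (h1.F.mul_of_sub_const h1.exp h3.R.comp_neg)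
  · rw [funext (mul_bFn_eq u v)]
    exact (f3.mul_of_sub_const h3.exp h1.Z).sub (h1.F.mul_of_sub_const h1.exp h3.Z.comp_neg)

theorem HalfBound.norm_halfF_le (h : HalfBound C u v) (z : ℝ) : ‖halfF u v z‖ ≤ (2 * C : ℝ≥0) := by
  have h1 := h.F.bdd z
  have h2 := h.exp
  have := norm_add_le (halfF u v z - Complex.exp (-1 * gaugeE u v 0))
    (Complex.exp (-1 * gaugeE u v 0))
  rw [sub_add_cancel] at this
  push_cast
  linarith

theorem HalfBound.continuous_halfF (h : HalfBound C u v) : Continuous (halfF u v) := by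
  refine (h.F.cont.add (continuous_const (y := Complex.exp (-1 * gaugeE u v 0)))).congr fun z => ?_
  exact sub_add_cancel _ _

theorem eLpNorm_mul_add_mul_le {f g X Y : ℝ → ℂ} {D : ℝ≥0} (hf : Continuous f) (hg : Continuous g)
    (hX : Continuous X) (hY : Continuous Y) (bf : ∀ z, ‖f z‖ ≤ C) (bg : ∀ z, ‖g z‖ ≤ C)
    (nX : eLpNorm X 2 volume ≤ D) (nY : eLpNorm Y 2 volume ≤ D) :
    eLpNorm (fun z => f (-z) * X z + g z * Y (-z)) 2 volume ≤ (C * D + C * D : ℝ≥0) := by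
  refine (eLpNorm_add_le (Continuous.aestronglyMeasurable (by fun_prop))
    (Continuous.aestronglyMeasurable (by fun_prop)) (by norm_num)).trans ?_
  push_cast
  refine add_le_add ((eLpNorm_mul_le_of_bdd fun z => bf _).trans (mul_le_mul' le_rfl nX))
    ((eLpNorm_mul_le_of_bdd bg).trans (mul_le_mul' le_rfl ?_))
  exact (eLpNorm_comp_measurePreserving hY.aestronglyMeasurable
    (Measure.measurePreserving_neg volume)).trans_le nY

/-- The `H²` gain: the boundary terms of the two half-lines cancel once more. -/
theorem exists_eLpNorm_sq_mul_bFn_le (γ : ℝ≥0) : ∃ C : ℝ≥0, ∀ u u' u'' v v' v'' : ℝ → ℂ,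
    W211 γ u u' u'' → W211 γ v v' v'' →
    eLpNorm (fun z : ℝ => z * (z * bFn u v z)) 2 volume ≤ C := by
  obtain ⟨C, hC⟩ := exists_halfBound γ
  obtain ⟨D, hD⟩ := exists_eLpNorm_mul_halfZ_le γ
  refine ⟨2 * C * D + 2 * C * D, fun u u' u'' v v' v'' hu hv => ?_⟩
  have h1 := hC u u' v v' hu.toW11 hv.toW11
  have h3 := hC _ _ _ _ hu.rev.neg_fun.toW11 hv.rev.toW11
  have d1 := hD u u' v v' v'' hu.toW11 hv.toW11 hv.ac' hv.norm'
  have d3 := hD _ _ _ _ _ hu.rev.neg_fun.toW11 hv.rev.toW11 hv.rev.ac' hv.rev.norm'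
  have c1 := h1.continuous_halfF
  have c3 := h3.continuous_halfF
  have z1 := h1.Z.cont
  have z3 := h3.Z.cont
  set X₁ : ℝ → ℂ := fun z => z * halfZ u v z +
    1 / (2 * Complex.I) * (halfCoeff u v v' * halfF u v z) with hX1
  set X₃ : ℝ → ℂ := fun z => z * halfZ (-rev u) (rev v) z +
    1 / (2 * Complex.I) * (halfCoeff (-rev u) (rev v) (-rev v') * halfF (-rev u) (rev v) z) with hX3
  have x1 : Continuous X₁ := by rw [hX1]; fun_prop
  have x3 : Continuous X₃ := by rw [hX3]; fun_prop
  -- the coefficient of the boundary term changes sign under reflection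
  have hm : halfCoeff (-rev u) (rev v) (-rev v') = -halfCoeff u v v' := by
    simp only [halfCoeff, Pi.neg_apply, rev_zero]; ring
  have e : (fun z : ℝ => z * (z * bFn u v z)) = fun z => halfF (-rev u) (rev v) (-z) * X₁ z +
      halfF u v z * X₃ (-z) := by
    funext z
    simp only [mul_bFn_eq, hX1, hX3, hm]
    push_cast; ring
  rw [e]
  clear_value X₁ X₃
  exact eLpNorm_mul_add_mul_le c3 c1 x1 x3 h3.norm_halfF_le h1.norm_halfF_le d1 d3

theorem exists_sobBound_pairData (γ : ℝ≥0) : ∃ C : ℝ≥0, ∀ u u' v v' : ℝ → ℂ, W11 γ u u' →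
    W11 γ v v' → ∀ i, SobBound C (pairData u v i) := by
  obtain ⟨A, hA⟩ := exists_sobBound_aFn γ
  obtain ⟨B, hB⟩ := exists_sobBound_bFn γ
  refine ⟨A + B, fun u u' v v' hu hv i => ?_⟩
  have a1 := (hA u u' v v' hu hv).mono (le_self_add : A ≤ A + B)
  have a2 := ((hA _ _ u u' hv.neg_fun hu).mono (le_self_add : A ≤ A + B)).comp_neg
  obtain ⟨b1, b2⟩ := hB u u' v v' hu hv
  obtain ⟨b3, b4⟩ := hB _ _ u u' hv.neg_fun hu
  fin_cases i
  · exact a1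
  · exact a2
  · exact b2.mono le_add_self
  · exact b1.mono le_add_self
  · have := (b4.comp_neg.const_mul (c := -1) (D := 1) (by simp)).mono
      (C' := A + B) (by rw [one_mul]; exact le_add_self)
    simpa [pairData, offData] using this
  · exact b3.comp_neg.mono le_add_self

theorem exists_eLpNorm_mul_offData_le (γ : ℝ≥0) : ∃ C : ℝ≥0, ∀ u u' u'' v v' v'' : ℝ → ℂ,
    W211 γ u u' u'' → W211 γ v v' v'' → ∀ i,
    eLpNorm (fun z : ℝ => z * offData u v i z) 2 volume ≤ C := by
  obtain ⟨B, hB⟩ := exists_sobBound_bFn γ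
  obtain ⟨D, hD⟩ := exists_eLpNorm_sq_mul_bFn_le γ
  refine ⟨B + D, fun u u' u'' v v' v'' hu hv i => ?_⟩
  have b2 := (hB u u' v v' hu.toW11 hv.toW11).2
  have b4 := (hB _ _ u u' hv.toW11.neg_fun hu.toW11).2
  have d1 := hD u u' u'' v v' v'' hu hv
  have d2 := hD _ _ _ u u' u'' hv.neg_fun hu
  have hle : (D : ℝ≥0∞) ≤ (B + D : ℝ≥0) := by exact_mod_cast le_add_self
  have hle' : (B : ℝ≥0∞) ≤ (B + D : ℝ≥0) := by exact_mod_cast le_self_add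
  have hneg (f : ℝ → ℂ) (hf : Continuous f) (g : ℝ → ℂ) (h : ∀ z, ‖g z‖ = ‖f (-z)‖) :
      eLpNorm g 2 volume = eLpNorm f 2 volume :=
    (eLpNorm_congr_norm_ae (.of_forall h)).trans (eLpNorm_comp_measurePreserving
      hf.aestronglyMeasurable (Measure.measurePreserving_neg volume))
  have c4 := b4.cont
  fin_cases i
  · exact d1.trans hle
  · exact b2.l2.trans hle'
  · refine (hneg (fun z : ℝ => z * (z * bFn (-v) u z)) (by fun_prop) _ fun z => ?_).trans_le
      (d2.trans hle)
    simp [offData]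
  · refine (hneg (fun z : ℝ => z * bFn (-v) u z) c4 _ fun z => ?_).trans_le (b4.l2.trans hle')
    simp [offData]

end

/-! ### Analytic dependence on the potentials and Lipschitz estimates -/

section

variable {γ δ C : ℝ≥0} {u u' u'' v v' v'' d d' d'' e e' e'' : ℝ → ℂ}

/-- The complex line `τ ↦ u + τ d` through `u`. -/
def line (u d : ℝ → ℂ) (τ : ℂ) (x : ℝ) : ℂ := u x + τ * d x

theorem rev_line (u d : ℝ → ℂ) (τ : ℂ) : rev (line u d τ) = line (rev u) (rev d) τ := rfl

theorem neg_line (u d : ℝ → ℂ) (τ : ℂ) : -line u d τ = line (-u) (-d) τ := by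
  funext x; simp only [line, Pi.neg_apply]; ring

theorem line_zero (u d : ℝ → ℂ) : line u d 0 = u := by funext x; simp [line]

theorem line_one (u d : ℝ → ℂ) : line u d 1 = u + d := by funext x; simp [line]

theorem toLOne_modul_line (hu : Integrable u volume) (hd : Integrable d volume) (z : ℝ) (τ : ℂ) :
    toLOne (modul z (line u d τ)) = toLOne (modul z u) + τ • toLOne (modul z d) := by
  rw [← toLOne_const_mul τ (integrable_modul hd z),
    ← toLOne_add (integrable_modul hu z) ((integrable_modul hd z).const_mul τ)]
  congr 1; funext y
  simp only [modul, line]; ring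

theorem differentiable_toLOne_modul_line (hu : Integrable u volume) (hd : Integrable d volume)
    (z : ℝ) : Differentiable ℂ fun τ => toLOne (modul z (line u d τ)) := by
  simp only [toLOne_modul_line hu hd z]
  exact (differentiable_const _).add (differentiable_id.smul_const _)

theorem differentiable_half (hu : Integrable u volume) (hd : Integrable d volume)
    (hv : Integrable v volume) (he : Integrable e volume) (z : ℝ) :
    (Differentiable ℂ fun τ => halfF (line u d τ) (line v e τ) z) ∧
      Differentiable ℂ fun τ => halfR (line u d τ) (line v e τ) z := by
  have e1 (τ : ℂ) : (fun y => z * line u d τ y) = line (fun y => z * u y) (fun y => z * d y) τ := by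
    funext y; simp only [line]; ring
  have h1 := differentiable_toLOne_modul_line (hu.const_mul (z : ℂ)) (hd.const_mul (z : ℂ)) z
  have h2 := differentiable_toLOne_modul_line hv he (-z)
  have h := differentiable_volterraSol h1 h2
  have ev : Differentiable ℂ fun f : ℝ →ᵇ ℂ => f 0 :=
    (BoundedContinuousFunction.evalCLM ℂ (0 : ℝ) : (ℝ →ᵇ ℂ) →L[ℂ] ℂ).differentiable
  simp only [halfF, halfR, solF, solG, e1]
  exact ⟨ev.comp h.fst, ev.comp h.snd⟩

theorem gaugeE_line (h1 : Integrable (fun y => u y * v y) volume)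
    (h2 : Integrable (fun y => u y * e y) volume) (h3 : Integrable (fun y => d y * v y) volume)
    (h4 : Integrable (fun y => d y * e y) volume) (τ : ℂ) (x : ℝ) :
    gaugeE (line u d τ) (line v e τ) x = gaugeE u v x + τ * gaugeE u e x + τ * gaugeE d v x +
      τ ^ 2 * gaugeE d e x := by
  have i1 := h1.integrableOn (s := Iic x)
  have i2 := (h2.const_mul τ).integrableOn (s := Iic x)
  have i3 := (h3.const_mul τ).integrableOn (s := Iic x)
  have i4 := (h4.const_mul (τ ^ 2)).integrableOn (s := Iic x)
  have e1 : (fun y => line u d τ y * line v e τ y) = fun y =>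
      u y * v y + τ * (u y * e y) + τ * (d y * v y) + τ ^ 2 * (d y * e y) := by
    funext y; simp only [line]; ring
  have j2 : IntegrableOn (fun y => u y * v y + τ * (u y * e y)) (Iic x) := i1.add i2
  have j3 : IntegrableOn (fun y => u y * v y + τ * (u y * e y) + τ * (d y * v y)) (Iic x) :=
    j2.add i3
  simp only [gaugeE]
  rw [e1, integral_add j3 i4, integral_add j2 i3, integral_add i1 i2,
    integral_const_mul, integral_const_mul, integral_const_mul]
  ring

theorem W11.differentiable_exp_gaugeE (hu : W11 γ u u') (hd : W11 γ d d') (hv : W11 γ v v')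
    (he : W11 γ e e') :
    Differentiable ℂ fun τ => Complex.exp (-1 * gaugeE (line u d τ) (line v e τ) 0) := by
  simp only [gaugeE_line (hu.integrable_mul hv) (hu.integrable_mul he) (hd.integrable_mul hv)
    (hd.integrable_mul he)]
  fun_prop

theorem W11.differentiable_aFn (hu : W11 γ u u') (hd : W11 γ d d') (hv : W11 γ v v')
    (he : W11 γ e e') (z : ℝ) : Differentiable ℂ fun τ => aFn (line u d τ) (line v e τ) z := by
  have h1 := differentiable_half hu.fn.integrable hd.fn.integrable hv.fn.integrable
    he.fn.integrable z
  have h2 := differentiable_half hv.rev.fn.integrable he.rev.fn.integrable hu.rev.fn.integrable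
    hd.rev.fn.integrable z
  simp only [aFn, rev_line]
  exact (h1.1.mul h2.1).add ((h1.2.const_mul _).mul h2.2)

theorem W11.differentiable_aLim (hu : W11 γ u u') (hd : W11 γ d d') (hv : W11 γ v v')
    (he : W11 γ e e') : Differentiable ℂ fun τ => aLim (line u d τ) (line v e τ) := by
  simp only [aLim, rev_line]
  exact (hu.differentiable_exp_gaugeE hd hv he).mul
    (hv.rev.differentiable_exp_gaugeE he.rev hu.rev hd.rev)

theorem W11.differentiable_bFn (hu : W11 γ u u') (hd : W11 γ d d') (hv : W11 γ v v')
    (he : W11 γ e e') (z : ℝ) : Differentiable ℂ fun τ => bFn (line u d τ) (line v e τ) z := by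
  have h1 := differentiable_half hu.fn.integrable hd.fn.integrable hv.fn.integrable
    he.fn.integrable z
  have h2 := differentiable_half hu.rev.neg_fun.fn.integrable hd.rev.neg_fun.fn.integrable
    hv.rev.fn.integrable he.rev.fn.integrable (-z)
  simp only [bFn, rev_line, neg_line]
  exact (h2.1.mul h1.2).add (h2.2.mul h1.1)

theorem W11.differentiable_offData (hu : W11 γ u u') (hd : W11 γ d d') (hv : W11 γ v v')
    (he : W11 γ e e') (i : Fin 4) (z : ℝ) :
    Differentiable ℂ fun τ => offData (line u d τ) (line v e τ) i z := by
  have b1 := hu.differentiable_bFn hd hv he z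
  have b2 := hv.neg_fun.differentiable_bFn he.neg_fun hu hd (-z)
  simp only [← neg_line] at b2
  fin_cases i
  · exact b1.const_mul _
  · exact b1
  · exact b2.const_mul _
  · exact b2

theorem W11.differentiable_pairData (hu : W11 γ u u') (hd : W11 γ d d') (hv : W11 γ v v')
    (he : W11 γ e e') (i : Fin 6) (z : ℝ) :
    Differentiable ℂ fun τ => pairData (line u d τ) (line v e τ) i z := by
  have a2 := hv.neg_fun.differentiable_aFn he.neg_fun hu hd (-z)
  have l2 := hv.neg_fun.differentiable_aLim he.neg_fun hu hd
  simp only [← neg_line] at a2 l2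
  refine Fin.cases ?_ (fun i => Fin.cases ?_ (fun i => ?_) i) i
  · exact (hu.differentiable_aFn hd hv he z).sub (hu.differentiable_aLim hd hv he)
  · exact a2.sub l2
  · exact hu.differentiable_offData hd hv he i z

/-- On the disc of radius `1 + 1/δ` the perturbation `τ d` of a direction of norm `δ` has norm at most
`δ + 1`. -/
theorem nnnorm_mul_le {τ : ℂ} (hδ : 0 < δ) (hτ : ‖τ‖ ≤ 1 + 1 / δ) : ‖τ‖₊ * δ ≤ δ + 1 := by
  rw [← NNReal.coe_le_coe]
  push_cast
  have h : (0 : ℝ) < δ := hδ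
  refine (mul_le_mul_of_nonneg_right hτ h.le).trans (le_of_eq ?_)
  field_simp

theorem W11.line (hu : W11 γ u u') (hd : W11 δ d d') (τ : ℂ) :
    W11 (γ + ‖τ‖₊ * δ) (line u d τ) (line u' d' τ) := hu.add (hd.const_mul τ)

theorem W211.line (hu : W211 γ u u' u'') (hd : W211 δ d d' d'') (τ : ℂ) :
    W211 (γ + ‖τ‖₊ * δ) (line u d τ) (line u' d' τ) (line u'' d'' τ) := hu.add (hd.const_mul τ)

theorem add_nnnorm_mul_le {τ : ℂ} (hδ : 0 < δ) (hδγ : δ ≤ 2 * γ + 1) (hτ : ‖τ‖ ≤ 1 + 1 / δ) :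
    γ + ‖τ‖₊ * δ ≤ 3 * γ + 2 :=
  (add_le_add_right ((nnnorm_mul_le hδ hτ).trans (add_le_add_left hδγ 1)) γ).trans
    (le_of_eq (by ring))

/-- A family of functions, analytic on the whole plane and bounded on a disc of radius `1 + 1/δ`,
varies by at most a multiple of `δ` between the parameters `0` and `1`. -/
theorem eLpNorm_sub_le_mul {G : ℂ → ℝ → ℂ} (hδ : 0 < δ)
    (hd : ∀ z, Differentiable ℂ fun τ => G τ z) (hc : ∀ τ, Continuous (G τ)) {M : ℝ≥0∞}
    (hM : ∀ τ, ‖τ‖ ≤ 1 + 1 / δ → eLpNorm (G τ) 2 volume ≤ M) :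
    eLpNorm (fun z => G 1 z - G 0 z) 2 volume ≤ M * δ := by
  have h : (0 : ℝ) < δ := hδ
  refine (eLpNorm_sub_le_of_differentiable (R := 1 + 1 / δ) (by simpa using h) hd
    (fun τ => (hc τ).measurable) hM).trans (le_of_eq ?_)
  simp

/-- The data are Lipschitz continuous with values in `H¹_z`. -/
theorem exists_pairData_lipschitz (γ : ℝ≥0) : ∃ C : ℝ≥0, ∀ (u u' v v' d d' e e' : ℝ → ℂ) (δ : ℝ≥0),
    0 < δ → δ ≤ 2 * γ + 1 → W11 γ u u' → W11 γ v v' → W11 δ d d' → W11 δ e e' →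
    ∀ i F, F =ᵐ[volume] (fun z => pairData (u + d) (v + e) i z - pairData u v i z) →
      sobolevNorm 1 F ≤ C * δ := by
  obtain ⟨C, hC⟩ := exists_sobBound_pairData (3 * γ + 2)
  refine ⟨2 * C, fun u u' v v' d d' e e' δ hδ hδγ hu hv hd he i F hF => ?_⟩
  set G : ℂ → ℝ → ℂ := fun τ => pairData (line u d τ) (line v e τ) i with hG
  have hS (τ : ℂ) (hτ : ‖τ‖ ≤ 1 + 1 / δ) : SobBound C (G τ) :=
    hC _ _ _ _ ((hu.line hd τ).mono (add_nnnorm_mul_le hδ hδγ hτ))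
      ((hv.line he τ).mono (add_nnnorm_mul_le hδ hδγ hτ)) i
  have hc (τ : ℂ) : Continuous (G τ) := by
    obtain ⟨C', hC'⟩ := exists_sobBound_pairData (γ + ‖τ‖₊ * δ)
    exact (hC' _ _ _ _ (hu.line hd τ) (hv.line he τ) i).cont
  have hdiff (z : ℝ) : Differentiable ℂ fun τ => G τ z :=
    (hu.mono (le_max_left γ δ)).differentiable_pairData (hd.mono (le_max_right γ δ))
      (hv.mono (le_max_left γ δ)) (he.mono (le_max_right γ δ)) i z
  have h2 := eLpNorm_sub_le_mul hδ hdiff hc fun τ hτ => (hS τ hτ).l2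
  -- the difference quotients in `z` are analytic in `τ` as well, with the same bounds
  have hdq (h : ℝ) := eLpNorm_sub_le_mul (G := fun τ z => G τ (z + h) - G τ z) hδ
    (fun z => (hdiff _).sub (hdiff _)) (fun τ => by have := hc τ; fun_prop)
    fun τ hτ => (hS τ hτ).dq h
  have e1 : G 1 = pairData (u + d) (v + e) i := by simp only [hG, line_one]
  have e0 : G 0 = pairData u v i := by simp only [hG, line_zero]
  have hF' : F =ᵐ[volume] (fun z => G 1 z - G 0 z) := by rw [e1, e0]; exact hF
  refine (memSobolev_one_of_diffQuotient (C := C * δ) hF' ((hc 1).sub (hc 0)) ?_ fun h => ?_).2.trans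
    (le_of_eq (by push_cast; ring))
  · rw [ENNReal.coe_mul]; exact h2
  · rw [ENNReal.coe_mul, mul_right_comm]
    refine le_trans (le_of_eq ?_) (hdq h)
    congr 1; funext z; ring

/-- The off-diagonal data are Lipschitz continuous with values in `L^{2,1}_z`. -/
theorem exists_offData_lipschitz (γ : ℝ≥0) : ∃ C : ℝ≥0,
    ∀ (u u' u'' v v' v'' d d' d'' e e' e'' : ℝ → ℂ) (δ : ℝ≥0),
    0 < δ → δ ≤ 2 * γ + 1 → W211 γ u u' u'' → W211 γ v v' v'' → W211 δ d d' d'' → W211 δ e e' e'' →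
    ∀ i, eLpNorm (fun z : ℝ => z * (offData (u + d) (v + e) i z - offData u v i z)) 2 volume ≤
      C * δ := by
  obtain ⟨C, hC⟩ := exists_eLpNorm_mul_offData_le (3 * γ + 2)
  refine ⟨C, fun u u' u'' v v' v'' d d' d'' e e' e'' δ hδ hδγ hu hv hd he i => ?_⟩
  set G : ℂ → ℝ → ℂ := fun τ z => z * offData (line u d τ) (line v e τ) i z with hG
  have hc (τ : ℂ) : Continuous (G τ) := by
    obtain ⟨C', hC'⟩ := exists_sobBound_pairData (γ + ‖τ‖₊ * δ)
    have : Continuous (offData (line u d τ) (line v e τ) i) :=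
      (hC' _ _ _ _ (hu.toW11.line hd.toW11 τ) (hv.toW11.line he.toW11 τ) i.succ.succ).cont
    exact Complex.continuous_ofReal.mul this
  have hdiff (z : ℝ) : Differentiable ℂ fun τ => G τ z :=
    ((hu.toW11.mono (le_max_left γ δ)).differentiable_offData (hd.toW11.mono (le_max_right γ δ))
      (hv.toW11.mono (le_max_left γ δ)) (he.toW11.mono (le_max_right γ δ)) i z).const_mul _
  have h2 := eLpNorm_sub_le_mul hδ hdiff hc fun τ hτ =>
    hC _ _ _ _ _ _ ((hu.line hd τ).mono (add_nnnorm_mul_le hδ hδγ hτ))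
      ((hv.line he τ).mono (add_nnnorm_mul_le hδ hδγ hτ)) i
  refine le_trans (le_of_eq ?_) h2
  congr 1; funext z
  simp only [hG, line_one, line_zero]
  ring

end

/-! ### Identification of the Jost functions -/

section

variable {U a b f h u v : ℝ → ℂ} {k : ℂ} {w z : ℝ}

/-- The first component of the solution of the spectral problem normalised at `-∞`. -/
def jostF (a b : ℝ → ℂ) (w x : ℝ) : ℂ := solF (modul w fun y => w * a y) (modul (-w) b) x

/-- The second component, with its oscillation and a factor `k` removed, of the solution of the
spectral problem normalised at `-∞`. -/
def jostR (a b : ℝ → ℂ) (w x : ℝ) : ℂ := solG (modul w fun y => w * a y) (modul (-w) b) x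

/-- The common form of the systems of integral equations of the Jost functions: `f` is the component
with limit `1`, and `h` the one whose kernel oscillates with frequency `w`. For `φ` the coefficients
`(U, b)` are `(u, v)` and `w = z`; for `ψ` they are `(v, u)` and `w = -z`. -/
structure SideSystem (s : Side) (U b : ℝ → ℂ) (k : ℂ) (w : ℝ) (f h : ℝ → ℂ) : Prop where
  bddF : MemLp f ∞ volume
  bddH : MemLp h ∞ volume
  eqF : ∀ x, f x = 1 + k * integralFrom s (fun y => U y * h y) x
  eqH : ∀ x, h x = k * integralFrom s (fun y => osc w x * osc (-w) y * (b y * f y)) x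

/-- The system normalised at `-∞` is solved by `jostF` and `jostR`. The two factors `k` are moved to
one coefficient, so that only `k² = ±w` remains. -/
theorem sideSystem_minus_iff (hU : Integrable U volume) (hb : Integrable b volume)
    (hk : ∀ y, k ^ 2 * U y = w * a y) : SideSystem Side.minus U b k w f h ↔
      f = jostF a b w ∧ h = fun x => osc w x * (k * jostR a b w x) := by
  have iU : Integrable (fun y => k * modul w U y) volume := (integrable_modul hU w).const_mul k
  have ib : Integrable (fun y => k * modul (-w) b y) volume :=
    (integrable_modul hb (-w)).const_mul k
  have hs := sol_scale iU (integrable_modul hb (-w)) k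
  have e : (fun y => k * (k * modul w U y)) = modul w fun y => w * a y := by
    funext y; simp only [modul, ← hk y]; ring
  rw [e] at hs
  have hF : solF (fun y => k * modul w U y) (fun y => k * modul (-w) b y) = jostF a b w := hs.1
  have hG : solG (fun y => k * modul w U y) (fun y => k * modul (-w) b y) =
      fun x => k * jostR a b w x := hs.2
  have o (y : ℝ) : osc w y * osc (-w) y = 1 := by rw [mul_comm]; exact osc_neg_mul_self w y
  constructor
  · intro H
    have hg : MemLp (fun x => osc (-w) x * h x) ∞ volume := by
      refine H.bddH.mono ((by fun_prop : Continuous fun x => osc (-w) x).aestronglyMeasurable.mul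
        H.bddH.1) (.of_forall fun x => by simp)
    have := sol_unique iU ib H.bddF hg (fun x => ?_) fun x => ?_
    · refine ⟨this.1.trans hF, ?_⟩
      funext x
      have h2 := congrFun (this.2.trans hG) x
      rw [← h2, ← mul_assoc, o, one_mul]
    · rw [H.eqF x, integralFrom, ← integral_const_mul]
      congr 2; funext y
      simp only [modul]
      linear_combination (-k * U y * h y) * o y
    · rw [H.eqH x, integralFrom]
      rw [← integral_const_mul, ← integral_const_mul]
      congr 1; funext y
      simp only [modul]
      linear_combination (k * osc (-w) y * b y * f y) * o x
  · rintro ⟨rfl, rfl⟩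
    have m := memLp_solG (fun y => k * modul w U y) (fun y => k * modul (-w) b y)
    have m' := memLp_solF (fun y => k * modul w U y) (fun y => k * modul (-w) b y)
    have q1 := solF_eq (B := fun y => k * modul (-w) b y) iU
    have q2 := solG_eq (A := fun y => k * modul w U y) ib
    rw [hG] at m q1 q2
    rw [hF] at m' q1 q2
    refine ⟨m', m.mono ((by fun_prop : Continuous fun x => osc w x).aestronglyMeasurable.mul
        m.1) (.of_forall fun x => by simp), fun x => ?_, fun x => ?_⟩
    · rw [q1 x, integralFrom, ← integral_const_mul]
      congr 2; funext y
      simp only [modul]; ring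
    · refine (congrArg _ (q2 x)).trans ?_
      rw [integralFrom, ← integral_const_mul, ← integral_const_mul]
      congr 1; funext y
      simp only [modul]; ring

theorem integralFrom_plus (f : ℝ → ℂ) (x : ℝ) :
    integralFrom Side.plus f x = -integralFrom Side.minus (rev f) (-x) := by
  rw [integralFrom, integralFrom]
  have := integral_comp_neg_Iic (-x) f
  rw [neg_neg] at this
  rw [← this]; rfl

theorem rev_rev (f : ℝ → ℂ) : rev (rev f) = f := by funext x; simp [rev]

theorem MemLp.rev (hf : MemLp f ∞ volume) : MemLp (rev f) ∞ volume :=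
  hf.comp_measurePreserving (Measure.measurePreserving_neg volume)

/-- Reflection exchanges the normalisations at `+∞` and `-∞`. -/
theorem sideSystem_plus_iff : SideSystem Side.plus U b k w f h ↔
    SideSystem Side.minus (rev U) (rev b) k (-w) (rev f) (-rev h) := by
  have e1 (x : ℝ) : k * integralFrom Side.plus (fun y => U y * h y) x =
      k * integralFrom Side.minus (fun y => rev U y * (-rev h) y) (-x) := by
    rw [integralFrom_plus]
    simp only [integralFrom, ← integral_neg]
    congr 2; funext y
    simp only [rev, Pi.neg_apply]; ring
  have e2 (x : ℝ) : k * integralFrom Side.plus (fun y => osc w x * osc (-w) y * (b y * f y)) x =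
      -(k * integralFrom Side.minus
        (fun y => osc (-w) (-x) * osc (- -w) y * (rev b y * rev f y)) (-x)) := by
    rw [integralFrom_plus, mul_neg]
    simp only [integralFrom]
    congr 3; funext y
    simp only [rev, osc_neg_right, neg_neg]
  constructor
  · intro H
    refine ⟨MemLp.rev H.bddF, (MemLp.rev H.bddH).neg, fun x => ?_, fun x => ?_⟩
    · rw [rev, H.eqF, e1, neg_neg]
    · rw [Pi.neg_apply, rev, H.eqH, e2, neg_neg, neg_neg]
  · intro H
    refine ⟨?_, ?_, fun x => ?_, fun x => ?_⟩
    · simpa [rev_rev] using MemLp.rev H.bddF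
    · have := (MemLp.rev H.bddH).neg
      rwa [show -rev (-rev h) = h by funext x; simp [rev]] at this
    · rw [e1, ← H.eqF, rev, neg_neg]
    · rw [e2, ← H.eqH, Pi.neg_apply, rev, neg_neg, neg_neg]

theorem exp_eq_osc (hk : k ^ 2 = z) (x y : ℝ) :
    Complex.exp (2 * Complex.I * k ^ 2 * (x - y)) = osc z x * osc (-z) y := by
  rw [osc, osc, ← Complex.exp_add, hk]; congr 1; push_cast; ring

theorem exp_neg_eq_osc (hk : k ^ 2 = z) (x y : ℝ) :
    Complex.exp (-(2 * Complex.I * k ^ 2 * (x - y))) = osc (-z) x * osc (- -z) y := by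
  rw [osc, osc, ← Complex.exp_add, hk]; congr 1; push_cast; ring

theorem isJostPhi_iff {σ : ℝ} {s : Side} {φ : ℝ → Fin 2 → ℂ} (hk : k ^ 2 = z) :
    IsJostPhi σ s u k φ ↔
      SideSystem s u (nonlocalPartner σ u) k z (fun x => φ x 0) (fun x => φ x 1) := by
  constructor
  · intro H
    refine ⟨H.bounded 0, H.bounded 1, H.eq_fst, fun x => ?_⟩
    simpa only [exp_eq_osc hk] using H.eq_snd x
  · intro H
    refine ⟨Fin.forall_fin_two.2 ⟨H.bddF, H.bddH⟩, H.eqF, fun x => ?_⟩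
    simpa only [exp_eq_osc hk] using H.eqH x

theorem isJostPsi_iff {σ : ℝ} {s : Side} {ψ : ℝ → Fin 2 → ℂ} (hk : k ^ 2 = z) :
    IsJostPsi σ s u k ψ ↔
      SideSystem s (nonlocalPartner σ u) u k (-z) (fun x => ψ x 1) (fun x => ψ x 0) := by
  constructor
  · intro H
    refine ⟨H.bounded 1, H.bounded 0, H.eq_snd, fun x => ?_⟩
    simpa only [exp_neg_eq_osc hk] using H.eq_fst x
  · intro H
    refine ⟨Fin.forall_fin_two.2 ⟨H.bddH, H.bddF⟩, fun x => ?_, H.eqF⟩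
    simpa only [exp_neg_eq_osc hk] using H.eqH x

/-- The explicit Jost function `φ_±` of the pair `(u, v)`. -/
def phiFn (u v : ℝ → ℂ) (k : ℂ) (z : ℝ) : Side → ℝ → Fin 2 → ℂ
  | Side.minus, x => ![jostF u v z x, osc z x * (k * jostR u v z x)]
  | Side.plus, x => ![jostF (-rev u) (rev v) (-z) (-x),
      -(osc (-z) (-x) * (k * jostR (-rev u) (rev v) (-z) (-x)))]

/-- The explicit Jost function `ψ_±` of the pair `(u, v)`. -/
def psiFn (u v : ℝ → ℂ) (k : ℂ) (z : ℝ) : Side → ℝ → Fin 2 → ℂ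
  | Side.minus, x => ![osc (-z) x * (k * jostR (-v) u (-z) x), jostF (-v) u (-z) x]
  | Side.plus, x => ![-(osc z (-x) * (k * jostR (rev v) (rev u) z (-x))),
      jostF (rev v) (rev u) z (-x)]

theorem funext_fin_two {φ χ : ℝ → Fin 2 → ℂ} :
    φ = χ ↔ (fun x => φ x 0) = (fun x => χ x 0) ∧ (fun x => φ x 1) = fun x => χ x 1 := by
  constructor
  · rintro rfl; exact ⟨rfl, rfl⟩
  · rintro ⟨h0, h1⟩
    funext x i
    fin_cases i
    · exact congrFun h0 x
    · exact congrFun h1 x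

theorem rev_eq_iff {g : ℝ → ℂ} : rev f = g ↔ f = rev g := by
  constructor
  · rintro rfl; exact (rev_rev f).symm
  · rintro rfl; exact rev_rev g

theorem neg_rev_eq_iff {g : ℝ → ℂ} : -rev f = g ↔ f = -rev g := by
  rw [neg_eq_iff_eq_neg, rev_eq_iff]; rfl

theorem Integrable.rev (hu : Integrable u volume) : Integrable (rev u) volume := hu.comp_neg

theorem isJostPhi_iff_eq {σ : ℝ} {s : Side} {φ : ℝ → Fin 2 → ℂ} (hk : k ^ 2 = z)
    (hu : Integrable u volume) (hv : Integrable (nonlocalPartner σ u) volume) :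
    IsJostPhi σ s u k φ ↔ φ = phiFn u (nonlocalPartner σ u) k z s := by
  rw [isJostPhi_iff hk, funext_fin_two]
  cases s with
  | minus => exact sideSystem_minus_iff hu hv fun y => by rw [hk]
  | plus =>
    rw [sideSystem_plus_iff, sideSystem_minus_iff (a := -rev u) (Integrable.rev hu)
      (Integrable.rev hv) fun y => by rw [hk]; simp, rev_eq_iff, neg_rev_eq_iff]
    rfl

theorem isJostPsi_iff_eq {σ : ℝ} {s : Side} {ψ : ℝ → Fin 2 → ℂ} (hk : k ^ 2 = z)
    (hu : Integrable u volume) (hv : Integrable (nonlocalPartner σ u) volume) :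
    IsJostPsi σ s u k ψ ↔ ψ = psiFn u (nonlocalPartner σ u) k z s := by
  rw [isJostPsi_iff hk, funext_fin_two, and_comm]
  cases s with
  | minus =>
    rw [sideSystem_minus_iff (a := -nonlocalPartner σ u) hv hu fun y => by rw [hk]; simp]
    rfl
  | plus =>
    rw [sideSystem_plus_iff, sideSystem_minus_iff (a := rev (nonlocalPartner σ u))
      (Integrable.rev hv) (Integrable.rev hu) fun y => by rw [hk, neg_neg], rev_eq_iff,
      neg_rev_eq_iff, neg_neg]
    rfl

theorem jostPhi_eq {σ : ℝ} {s : Side} (hk : k ^ 2 = z)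
    (hu : Integrable u volume) (hv : Integrable (nonlocalPartner σ u) volume) :
    jostPhi σ s u k = phiFn u (nonlocalPartner σ u) k z s := by
  have h : ∃ φ, IsJostPhi σ s u k φ := ⟨_, (isJostPhi_iff_eq hk hu hv).2 rfl⟩
  rw [jostPhi, dif_pos h]
  exact (isJostPhi_iff_eq hk hu hv).1 h.choose_spec

theorem jostPsi_eq {σ : ℝ} {s : Side} (hk : k ^ 2 = z)
    (hu : Integrable u volume) (hv : Integrable (nonlocalPartner σ u) volume) :
    jostPsi σ s u k = psiFn u (nonlocalPartner σ u) k z s := by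
  have h : ∃ φ, IsJostPsi σ s u k φ := ⟨_, (isJostPsi_iff_eq hk hu hv).2 rfl⟩
  rw [jostPsi, dif_pos h]
  exact (isJostPsi_iff_eq hk hu hv).1 h.choose_spec

end

/-! ### Identification of the scattering data -/

section

variable {U b f h u v : ℝ → ℂ} {k : ℂ} {w z σ : ℝ} {s : Side}

theorem SideSystem.minus_aux (H : SideSystem Side.minus U b k w f h) (hU : Integrable U volume)
    (hb : Integrable b volume) :
    (HasACDeriv f (fun x => k * (U x * h x)) ∧
      HasACDeriv h (fun x => 2 * Complex.I * w * h x + k * (b x * f x))) ∧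
    Tendsto f atBot (𝓝 1) ∧ Tendsto h atBot (𝓝 0) := by
  have i1 : Integrable (fun y => U y * h y) volume := hU.mul_memLp_top H.bddH
  have i2 : Integrable (fun y => modul (-w) b y * f y) volume :=
    (integrable_modul hb (-w)).mul_memLp_top H.bddF
  have ef : f = fun x => 1 + k * ∫ y in Iic x, U y * h y := funext H.eqF
  have eh : h = fun x => osc w x * (k * ∫ y in Iic x, modul (-w) b y * f y) := by
    funext x
    rw [H.eqH x, integralFrom, ← integral_const_mul, ← integral_const_mul, ← integral_const_mul]
    congr 1; funext y
    simp only [modul]; ring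
  have o (y : ℝ) : osc (-w) y * osc w y = 1 := osc_neg_mul_self w y
  refine ⟨⟨?_, ?_⟩, ?_, ?_⟩
  · have := (HasACDeriv.const 1).add ((hasACDeriv_integral_Iic i1).const_mul k)
    rw [← ef] at this
    exact this.congr_deriv (.of_forall fun x => by simp)
  · have := (hasACDeriv_osc w).mul ((hasACDeriv_integral_Iic i2).const_mul k)
    rw [← eh] at this
    refine this.congr_deriv (.of_forall fun x => ?_)
    have ehx := congrFun eh x
    simp only [modul] at ehx ⊢
    linear_combination (k * b x * f x) * o x - 2 * Complex.I * w * ehx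
  · have := ((tendsto_integral_Iic_atBot i1).const_mul k).const_add 1
    rwa [← ef, mul_zero, add_zero] at this
  · have := (tendsto_integral_Iic_atBot i2).const_mul k
    rw [mul_zero] at this
    rw [tendsto_zero_iff_norm_tendsto_zero] at this ⊢
    refine this.congr fun x => ?_
    rw [congrFun eh x, norm_mul (osc w x), norm_osc, one_mul]

theorem SideSystem.hasACDeriv (H : SideSystem s U b k w f h) (hU : Integrable U volume)
    (hb : Integrable b volume) : HasACDeriv f (fun x => k * (U x * h x)) ∧
      HasACDeriv h (fun x => 2 * Complex.I * w * h x + k * (b x * f x)) := by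
  cases s with
  | minus => exact (H.minus_aux hU hb).1
  | plus =>
    obtain ⟨⟨h1, h2⟩, -⟩ := (sideSystem_plus_iff.1 H).minus_aux (Integrable.rev hU)
      (Integrable.rev hb)
    have d1 := h1.comp_neg
    have d2 := h2.comp_neg.const_mul (-1)
    simp only [rev, neg_neg, Pi.neg_apply, neg_mul, one_mul, mul_neg] at d1 d2
    refine ⟨d1, d2.congr_deriv (.of_forall fun x => ?_)⟩
    push_cast; ring

theorem SideSystem.tendsto_atTop (H : SideSystem Side.plus U b k w f h) (hU : Integrable U volume)
    (hb : Integrable b volume) : Tendsto f atTop (𝓝 1) ∧ Tendsto h atTop (𝓝 0) := by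
  obtain ⟨-, h1, h2⟩ := (sideSystem_plus_iff.1 H).minus_aux (Integrable.rev hU) (Integrable.rev hb)
  have d1 := h1.comp tendsto_neg_atTop_atBot
  have d2 := (h2.comp tendsto_neg_atTop_atBot).neg
  rw [neg_zero] at d2
  refine ⟨d1.congr fun x => ?_, d2.congr fun x => ?_⟩ <;> simp [rev]

/-- `(y₁, y₂)` solves `y₁' = -ik² y₁ + k u y₂`, `y₂' = ik² y₂ + k v y₁`. -/
structure SpectralSolution (u v : ℝ → ℂ) (k : ℂ) (y₁ y₂ : ℝ → ℂ) : Prop where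
  fst : HasACDeriv y₁ (fun x => -(Complex.I * k ^ 2) * y₁ x + k * (u x * y₂ x))
  snd : HasACDeriv y₂ (fun x => Complex.I * k ^ 2 * y₂ x + k * (v x * y₁ x))

/-- The Wronskian of two solutions is constant. -/
theorem SpectralSolution.wronskian_eq {y₁ y₂ w₁ w₂ : ℝ → ℂ} (hy : SpectralSolution u v k y₁ y₂)
    (hw : SpectralSolution u v k w₁ w₂) (x t : ℝ) :
    y₁ x * w₂ x - y₂ x * w₁ x = y₁ t * w₂ t - y₂ t * w₁ t := by
  have h := ((hy.fst.mul hw.snd).sub (hy.snd.mul hw.fst)).congr_deriv (g := fun _ => 0)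
    (.of_forall fun x => by ring)
  have := h.integral_eq t x
  rw [intervalIntegral.integral_zero] at this
  exact (sub_eq_zero.1 this.symm)

theorem hasACDeriv_exp_mul (c : ℂ) :
    HasACDeriv (fun x : ℝ => Complex.exp (c * x)) (fun x => c * Complex.exp (c * x)) := by
  refine .of_hasDerivAt (fun x => ?_) (by fun_prop)
  have h1 : HasDerivAt (fun x : ℝ => c * (x : ℂ)) (c * 1) x :=
    (Complex.ofRealCLM.hasDerivAt (x := x)).const_mul c
  convert! h1.cexp using 1
  ring

theorem SideSystem.spectralSolution_phi (hk : k ^ 2 = z) (H : SideSystem s u v k z f h)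
    (hu : Integrable u volume) (hv : Integrable v volume) :
    SpectralSolution u v k (fun x => f x * Complex.exp (-(Complex.I * k ^ 2 * x)))
      (fun x => h x * Complex.exp (-(Complex.I * k ^ 2 * x))) := by
  obtain ⟨h1, h2⟩ := H.hasACDeriv hu hv
  have hE := hasACDeriv_exp_mul (-(Complex.I * k ^ 2))
  simp only [neg_mul] at hE
  refine ⟨(h1.mul hE).congr_deriv (.of_forall fun x => ?_),
    (h2.mul hE).congr_deriv (.of_forall fun x => ?_)⟩
  · simp only; ring
  · simp only; rw [← hk]; ring

theorem SideSystem.spectralSolution_psi (hk : k ^ 2 = z) (H : SideSystem s v u k (-z) f h)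
    (hu : Integrable u volume) (hv : Integrable v volume) :
    SpectralSolution u v k (fun x => h x * Complex.exp (Complex.I * k ^ 2 * x))
      (fun x => f x * Complex.exp (Complex.I * k ^ 2 * x)) := by
  obtain ⟨h1, h2⟩ := H.hasACDeriv hv hu
  have hE := hasACDeriv_exp_mul (Complex.I * k ^ 2)
  refine ⟨(h2.mul hE).congr_deriv (.of_forall fun x => ?_),
    (h1.mul hE).congr_deriv (.of_forall fun x => ?_)⟩
  · simp only; push_cast; rw [← hk]; ring
  · simp only; ring

/-- Changing the sign of either potential gives the same half-line data up to sign. This identifies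
the half-line data in `d` and `c` with those in `a` and `b` for the pair `(-v, u)`. -/
theorem half_neg_comm (hu : Integrable u volume) (hv : Integrable v volume) (z : ℝ) :
    halfF (-u) v z = halfF u (-v) z ∧ halfR (-u) v z = -halfR u (-v) z := by
  have h := sol_scale (integrable_modul (hu.const_mul (z : ℂ)) z) (integrable_modul hv (-z)) (-1)
  have e1 : (fun y => -1 * modul z (fun y => z * u y) y) = modul z fun y => z * (-u) y := by
    funext y; simp [modul]
  have e2 : (fun y => -1 * modul (-z) v y) = modul (-z) (-v) := by
    funext y; simp [modul]
  rw [e1, e2] at h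
  refine ⟨(congrFun h.1 0).symm, ?_⟩
  have := congrFun h.2 0
  simp only [neg_mul, one_mul] at this
  rw [halfR, halfR, this, neg_neg]

/-- The scattering matrix in terms of the half-line data. -/
def scatFn (u v : ℝ → ℂ) (k : ℂ) (z : ℝ) : Matrix (Fin 2) (Fin 2) ℂ :=
  !![aFn u v z, k * bFn (-v) u (-z); k * bFn u v z, aFn (-v) u (-z)]

/-- Uniqueness holds because the Jost matrix at `+∞` has determinant `1`. -/
theorem isScatteringMatrix_iff {S : Matrix (Fin 2) (Fin 2) ℂ} (hk : k ^ 2 = z)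
    (hu : Integrable u volume) (hv : Integrable (nonlocalPartner σ u) volume) :
    IsScatteringMatrix σ u k S ↔ S = scatFn u (nonlocalPartner σ u) k z := by
  have jφ (s : Side) : SideSystem s u (nonlocalPartner σ u) k z
      (fun x => phiFn u (nonlocalPartner σ u) k z s x 0)
      (fun x => phiFn u (nonlocalPartner σ u) k z s x 1) :=
    (isJostPhi_iff hk).1 ((isJostPhi_iff_eq hk hu hv).2 rfl)
  have jψ (s : Side) : SideSystem s (nonlocalPartner σ u) u k (-z)
      (fun x => psiFn u (nonlocalPartner σ u) k z s x 1)
      (fun x => psiFn u (nonlocalPartner σ u) k z s x 0) :=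
    (isJostPsi_iff hk).1 ((isJostPsi_iff_eq hk hu hv).2 rfl)
  set v := nonlocalPartner σ u with hvdef
  have sφ (s : Side) := (jφ s).spectralSolution_phi hk hu hv
  have sψ (s : Side) := (jψ s).spectralSolution_psi hk hu hv
  have hM (s : Side) (x : ℝ) (i : Fin 2) :
      jostMatrix σ s u k x i 0 = phiFn u v k z s x i * Complex.exp (-(Complex.I * k ^ 2 * x)) ∧
      jostMatrix σ s u k x i 1 = psiFn u v k z s x i * Complex.exp (Complex.I * k ^ 2 * x) := by
    rw [jostMatrix, jostPhi_eq hk hu hv, jostPsi_eq hk hu hv]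
    simp [← hvdef]
  have hE (x : ℝ) : Complex.exp (-(Complex.I * k ^ 2 * x)) * Complex.exp (Complex.I * k ^ 2 * x)
      = 1 := by rw [← Complex.exp_add]; simp
  -- the determinant of the fundamental matrix normalised at `+∞` is `1`
  have hdet (x : ℝ) : jostMatrix σ Side.plus u k x 0 0 * jostMatrix σ Side.plus u k x 1 1 -
      jostMatrix σ Side.plus u k x 1 0 * jostMatrix σ Side.plus u k x 0 1 = 1 := by
    simp only [(hM _ _ _).1, (hM _ _ _).2]
    obtain ⟨t1, t2⟩ := (jφ Side.plus).tendsto_atTop hu hv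
    obtain ⟨t3, t4⟩ := (jψ Side.plus).tendsto_atTop hv hu
    have t := (t1.mul t3).sub (t2.mul t4)
    rw [mul_one, mul_zero, sub_zero] at t
    refine tendsto_nhds_unique ?_ t
    refine (tendsto_const_nhds (f := atTop)).congr fun y => ?_
    rw [(sφ Side.plus).wronskian_eq (sψ Side.plus) x y]
    linear_combination (phiFn u v k z Side.plus y 0 * psiFn u v k z Side.plus y 1 -
      phiFn u v k z Side.plus y 1 * psiFn u v k z Side.plus y 0) * hE y
  have hn1 := half_neg_comm (Integrable.rev hu) (Integrable.rev hv) (-z)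
  have hsol : IsScatteringMatrix σ u k (scatFn u v k z) := by
    intro x
    have d := hdet x
    -- the entries of the scattering matrix are Wronskians, evaluated at `0`
    have wa := (sφ Side.minus).wronskian_eq (sψ Side.plus) x 0
    have wb := (sφ Side.plus).wronskian_eq (sφ Side.minus) x 0
    have wc := (sψ Side.minus).wronskian_eq (sψ Side.plus) x 0
    have wd := (sφ Side.plus).wronskian_eq (sψ Side.minus) x 0
    simp only [← (hM _ _ _).1, ← (hM _ _ _).2] at wa wb wc wd
    have va : jostMatrix σ Side.minus u k 0 0 0 * jostMatrix σ Side.plus u k 0 1 1 -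
        jostMatrix σ Side.minus u k 0 1 0 * jostMatrix σ Side.plus u k 0 0 1 = aFn u v z := by
      simp only [(hM _ _ _).1, (hM _ _ _).2, phiFn, psiFn, aFn]
      simp [osc_zero_right]
      rw [← hk]
      simp only [halfF, halfR, jostF, jostR]
      ring
    have vb : jostMatrix σ Side.plus u k 0 0 0 * jostMatrix σ Side.minus u k 0 1 0 -
        jostMatrix σ Side.plus u k 0 1 0 * jostMatrix σ Side.minus u k 0 0 0 = k * bFn u v z := by
      simp only [(hM _ _ _).1, phiFn, bFn]
      simp [osc_zero_right]
      simp only [halfF, halfR, jostF, jostR]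
      ring
    have vc : jostMatrix σ Side.minus u k 0 0 1 * jostMatrix σ Side.plus u k 0 1 1 -
        jostMatrix σ Side.minus u k 0 1 1 * jostMatrix σ Side.plus u k 0 0 1 =
        k * bFn (-v) u (-z) := by
      have e : -rev (-v) = rev v := by funext y; simp [rev]
      simp only [(hM _ _ _).2, psiFn, bFn, e, neg_neg]
      simp [osc_zero_right]
      simp only [halfF, halfR, jostF, jostR]
      ring
    have vd : jostMatrix σ Side.plus u k 0 0 0 * jostMatrix σ Side.minus u k 0 1 1 -
        jostMatrix σ Side.plus u k 0 1 0 * jostMatrix σ Side.minus u k 0 0 1 =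
        aFn (-v) u (-z) := by
      have e : rev (-v) = -rev v := by funext y; simp [rev]
      rw [aFn, e, ← hn1.1, show halfR (rev u) (-rev v) (-z) = -halfR (-rev u) (rev v) (-z) by
        rw [hn1.2, neg_neg]]
      simp only [(hM _ _ _).1, (hM _ _ _).2, phiFn, psiFn]
      push_cast
      simp [osc_zero_right]
      rw [← hk]
      simp only [halfF, halfR, jostF, jostR]
      ring
    rw [va] at wa
    rw [vb] at wb
    rw [vc] at wc
    rw [vd] at wd
    ext i j
    rw [Matrix.mul_apply, Fin.sum_univ_two]
    fin_cases i <;> fin_cases j <;> simp only [scatFn, Matrix.of_apply, Matrix.cons_val_zero,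
      Matrix.cons_val_one, Matrix.cons_val', Matrix.cons_val_fin_one, Fin.zero_eta, Fin.mk_one]
    · rw [← wa, ← wb]
      linear_combination (-jostMatrix σ Side.minus u k x 0 0) * d
    · rw [← wc, ← wd]
      linear_combination (-jostMatrix σ Side.minus u k x 0 1) * d
    · rw [← wa, ← wb]
      linear_combination (-jostMatrix σ Side.minus u k x 1 0) * d
    · rw [← wc, ← wd]
      linear_combination (-jostMatrix σ Side.minus u k x 1 1) * d
  constructor
  · intro hS
    have h0 : jostMatrix σ Side.plus u k 0 * S = jostMatrix σ Side.plus u k 0 * scatFn u v k z :=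
      (hS 0).symm.trans (hsol 0)
    have hdu : IsUnit (jostMatrix σ Side.plus u k 0).det := by
      rw [Matrix.det_fin_two, mul_comm (jostMatrix σ Side.plus u k 0 0 1), hdet 0]
      exact isUnit_one
    have := congrArg (fun M => (jostMatrix σ Side.plus u k 0)⁻¹ * M) h0
    simpa only [Matrix.nonsing_inv_mul_cancel_left _ _ hdu] using this
  · rintro rfl
    exact hsol

theorem scatteringMatrix_eq (hk : k ^ 2 = z)
    (hu : Integrable u volume) (hv : Integrable (nonlocalPartner σ u) volume) :
    scatteringMatrix σ u k = scatFn u (nonlocalPartner σ u) k z := by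
  have h : ∃ S, IsScatteringMatrix σ u k S := ⟨_, (isScatteringMatrix_iff hk hu hv).2 rfl⟩
  rw [scatteringMatrix, dif_pos h]
  exact (isScatteringMatrix_iff hk hu hv).1 h.choose_spec

end

/-! ### The scattering data of the nonlocal reduction -/

section

variable {γ δ : ℝ≥0} {u u' u'' v w U U' U'' V W W' W'' : ℝ → ℂ} {σ : ℝ} {κ : ℝ → ℂ}

theorem rev_ae_eq (h : u =ᵐ[volume] U) : rev u =ᵐ[volume] rev U :=
  (Measure.measurePreserving_neg (volume : Measure ℝ)).quasiMeasurePreserving.ae_eq_comp h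

theorem half_congr (hu : u =ᵐ[volume] U) (hv : v =ᵐ[volume] V) :
    halfF u v = halfF U V ∧ halfR u v = halfR U V := by
  have h (z : ℝ) := sol_congr (modul_congr (U := fun y => z * u y) (V := fun y => z * U y)
    (by filter_upwards [hu] with y hy; rw [hy]) z) (modul_congr hv (-z))
  exact ⟨funext fun z => congrFun (h z).1 0, funext fun z => congrFun (h z).2 0⟩

theorem aFn_congr (hu : u =ᵐ[volume] U) (hv : v =ᵐ[volume] V) : aFn u v = aFn U V := by
  have h1 := half_congr hu hv
  have h2 := half_congr (rev_ae_eq hv) (rev_ae_eq hu)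
  funext z
  simp only [aFn, h1, h2]

theorem bFn_congr (hu : u =ᵐ[volume] U) (hv : v =ᵐ[volume] V) : bFn u v = bFn U V := by
  have h1 := half_congr hu hv
  have h2 := half_congr (rev_ae_eq hu).neg (rev_ae_eq hv)
  funext z
  simp only [bFn, h1, h2]

theorem offData_congr (hu : u =ᵐ[volume] U) (hv : v =ᵐ[volume] V) : offData u v = offData U V := by
  rw [offData, offData, bFn_congr hu hv, bFn_congr hv.neg hu]

theorem partner_ae_eq (hu : u =ᵐ[volume] U) :
    nonlocalPartner σ u =ᵐ[volume] nonlocalPartner σ U := by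
  filter_upwards [rev_ae_eq hu] with x hx
  have hx' : u (-x) = U (-x) := hx
  rw [nonlocalPartner, nonlocalPartner, hx']

theorem norm_I_mul (hσ : σ = 1 ∨ σ = -1) : ‖Complex.I * (σ : ℂ)‖₊ = 1 := by
  rcases hσ with rfl | rfl <;> simp

theorem W11.partner (hσ : σ = 1 ∨ σ = -1) (h : W11 γ U U') :
    ∃ V', W11 γ (nonlocalPartner σ U) V' := by
  have := h.rev.conj.const_mul (Complex.I * σ)
  rw [norm_I_mul hσ, one_mul] at this
  exact ⟨_, this⟩

theorem W211.partner (hσ : σ = 1 ∨ σ = -1) (h : W211 γ U U' U'') :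
    ∃ V' V'', W211 γ (nonlocalPartner σ U) V' V'' := by
  have := h.rev.conj.const_mul (Complex.I * σ)
  rw [norm_I_mul hσ, one_mul] at this
  exact ⟨_, _, this⟩

/-- The phases on the two half-lines add up to the integral over the whole line. -/
theorem aLim_eq (hi : Integrable (fun y => u y * v y) volume) :
    aLim u v = Complex.exp (-(1 / (2 * Complex.I) * ∫ y, u y * v y)) := by
  have h1 : ∫ y in Iic 0, rev v y * rev u y = ∫ y in Ioi 0, u y * v y := by
    have := integral_comp_neg_Iic 0 fun y => u y * v y
    rw [neg_zero] at this
    rw [← this]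
    congr 1; funext y
    exact mul_comm _ _
  rw [aLim, gaugeE, gaugeE, h1, ← Complex.exp_add, ← mul_add, ← mul_add,
    intervalIntegral.integral_Iic_add_Ioi hi.integrableOn hi.integrableOn, neg_one_mul]

/-- The identification fails at most at `z = 0`, where `k⁻¹` is not defined. -/
theorem offDiagonalData_ae_eq (hκ : ∀ z : ℝ, κ z ^ 2 = (z : ℂ)) (hu : Integrable u volume)
    (hv : Integrable (nonlocalPartner σ u) volume) (i : Fin 4) :
    offDiagonalData σ κ u i =ᵐ[volume] offData u (nonlocalPartner σ u) i := by
  have hne : ∀ᵐ z : ℝ, κ z ≠ 0 := by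
    filter_upwards [Measure.ae_ne volume (0 : ℝ)] with z hz h0
    have := hκ z
    rw [h0] at this
    exact hz (by simpa using this.symm)
  filter_upwards [hne] with z hz
  have h := scatteringMatrix_eq (σ := σ) (hκ z) hu hv
  have hsq := hκ z
  fin_cases i <;>
    simp only [offDiagonalData, offData, scatB, scatC, h, scatFn, Matrix.of_apply,
      Matrix.cons_val_zero, Matrix.cons_val_one, Matrix.cons_val', Matrix.cons_val_fin_one,
      Fin.zero_eta, Fin.mk_one, Fin.reduceFinMk, Matrix.cons_val]
  · rw [← hsq]; ring
  · rw [inv_mul_cancel_left₀ hz]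
  · rw [← hsq]; ring
  · rw [inv_mul_cancel_left₀ hz]

theorem scatteringData_ae_eq (hκ : ∀ z : ℝ, κ z ^ 2 = (z : ℂ)) (hu : Integrable u volume)
    (hv : Integrable (nonlocalPartner σ u) volume)
    (hi : Integrable (fun y => u y * nonlocalPartner σ u y) volume) (i : Fin 6) :
    scatteringData σ κ u i =ᵐ[volume] pairData u (nonlocalPartner σ u) i := by
  have h (z : ℝ) := scatteringMatrix_eq (σ := σ) (hκ z) hu hv
  refine Fin.cases ?_ (fun i => Fin.cases ?_ (fun i => ?_) i) i
  · refine .of_forall fun z => ?_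
    simp only [scatteringData, pairData, Matrix.cons_val_zero, scatA, h, aInfty, aLim_eq hi]
    simp [scatFn]
  · refine .of_forall fun z => ?_
    have e : (fun y => (-nonlocalPartner σ u) y * u y) =
        fun y => -(u y * nonlocalPartner σ u y) := by
      funext y; simp only [Pi.neg_apply]; ring
    have hl : aLim (-nonlocalPartner σ u) u = dInfty σ u := by
      rw [aLim_eq (by rw [e]; exact hi.neg), e, integral_neg, mul_neg, neg_neg, dInfty]
    simp only [scatteringData, pairData, Matrix.cons_val_succ, Matrix.cons_val_zero, scatD, h, hl]
    simp [scatFn]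
  · exact offDiagonalData_ae_eq hκ hu hv i

theorem W11.integrable_congr (hσ : σ = 1 ∨ σ = -1) (hu : u =ᵐ[volume] U) (h : W11 γ U U') :
    Integrable u volume ∧ Integrable (nonlocalPartner σ u) volume ∧
      Integrable (fun y => u y * nonlocalPartner σ u y) volume := by
  obtain ⟨V', hV⟩ := h.partner hσ
  refine ⟨h.fn.integrable.congr hu.symm, hV.fn.integrable.congr (partner_ae_eq hu).symm, ?_⟩
  refine (h.integrable_mul hV).congr ?_
  filter_upwards [hu, partner_ae_eq (σ := σ) hu] with y h1 h2
  rw [h1, h2]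

theorem W11.offDiagonalData_ae_eq (hσ : σ = 1 ∨ σ = -1) (hκ : ∀ z : ℝ, κ z ^ 2 = (z : ℂ))
    (hu : u =ᵐ[volume] U) (h : W11 γ U U') (i : Fin 4) :
    offDiagonalData σ κ u i =ᵐ[volume] offData U (nonlocalPartner σ U) i := by
  obtain ⟨h1, h2, -⟩ := h.integrable_congr hσ hu
  rw [← offData_congr hu (partner_ae_eq hu)]
  exact NDNLS.offDiagonalData_ae_eq hκ h1 h2 i

theorem aLim_congr (hu : u =ᵐ[volume] U) (hv : v =ᵐ[volume] V) : aLim u v = aLim U V := by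
  have e {f g F G : ℝ → ℂ} (hf : f =ᵐ[volume] F) (hg : g =ᵐ[volume] G) :
      gaugeE f g 0 = gaugeE F G 0 := by
    rw [gaugeE, gaugeE]
    congr 1
    refine integral_congr_ae (ae_restrict_of_ae ?_)
    filter_upwards [hf, hg] with y h1 h2
    rw [h1, h2]
  rw [aLim, aLim, e hu hv, e (rev_ae_eq hv) (rev_ae_eq hu)]

theorem pairData_congr (hu : u =ᵐ[volume] U) (hv : v =ᵐ[volume] V) :
    pairData u v = pairData U V := by
  rw [pairData, pairData, offData_congr hu hv, aFn_congr hu hv, aFn_congr hv.neg hu,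
    aLim_congr hu hv, aLim_congr hv.neg hu]

theorem W11.scatteringData_ae_eq (hσ : σ = 1 ∨ σ = -1) (hκ : ∀ z : ℝ, κ z ^ 2 = (z : ℂ))
    (hu : u =ᵐ[volume] U) (h : W11 γ U U') (i : Fin 6) :
    scatteringData σ κ u i =ᵐ[volume] pairData U (nonlocalPartner σ U) i := by
  obtain ⟨h1, h2, h3⟩ := h.integrable_congr hσ hu
  rw [← pairData_congr hu (partner_ae_eq hu)]
  exact NDNLS.scatteringData_ae_eq hκ h1 h2 h3 i

theorem wellDefined (hσ : σ = 1 ∨ σ = -1) (hu : MemWeightedSobolev 1 1 u) {k : ℂ}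
    (hk : ∃ z : ℝ, k ^ 2 = (z : ℂ)) :
    (∀ s : Side, (∃! φ, IsJostPhi σ s u k φ) ∧ (∃! ψ, IsJostPsi σ s u k ψ)) ∧
      (∃! S, IsScatteringMatrix σ u k S) := by
  obtain ⟨U, U', γ, hU, hW⟩ := hu.exists_W11
  obtain ⟨z, hz⟩ := hk
  obtain ⟨h1, h2, -⟩ := hW.integrable_congr hσ hU
  refine ⟨fun s => ⟨⟨_, (isJostPhi_iff_eq hz h1 h2).2 rfl, fun φ hφ =>
    (isJostPhi_iff_eq hz h1 h2).1 hφ⟩, ⟨_, (isJostPsi_iff_eq hz h1 h2).2 rfl, fun φ hφ =>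
    (isJostPsi_iff_eq hz h1 h2).1 hφ⟩⟩, ⟨_, (isScatteringMatrix_iff hz h1 h2).2 rfl, fun φ hφ =>
    (isScatteringMatrix_iff hz h1 h2).1 hφ⟩⟩

theorem memSobolev_scatteringData (hσ : σ = 1 ∨ σ = -1) (hκ : ∀ z : ℝ, κ z ^ 2 = (z : ℂ))
    (hu : MemWeightedSobolev 1 1 u) (i : Fin 6) : MemSobolev 1 (scatteringData σ κ u i) := by
  obtain ⟨U, U', γ, hU, hW⟩ := hu.exists_W11
  obtain ⟨V', hV⟩ := hW.partner hσ
  obtain ⟨C, hC⟩ := exists_sobBound_pairData γ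
  have h := hC _ _ _ _ hW hV i
  exact (memSobolev_one_of_diffQuotient (hW.scatteringData_ae_eq hσ hκ hU i) h.cont h.l2 h.dq).1

/-- Reduction of a Lipschitz estimate to bounds by positive finite numbers `δ`, the distance `N` being
possibly zero or infinite. -/
theorem le_mul_of_forall_pos {A N : ℝ≥0∞} {C : ℝ≥0}
    (h : ∀ δ : ℝ≥0, 0 < δ → N ≤ δ → A ≤ C * δ) : A ≤ (C + 1 : ℝ≥0) * N := by
  rcases eq_or_ne N ⊤ with rfl | hN
  · rw [ENNReal.mul_top (by simp)]; exact le_top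
  rcases eq_or_ne N 0 with rfl | hN0
  · rw [mul_zero, nonpos_iff_eq_zero]
    by_contra hA
    obtain ⟨n, hn, hlt⟩ := ENNReal.exists_nnreal_pos_mul_lt (ENNReal.coe_ne_top (r := C)) hA
    have := h n hn (by simp)
    rw [mul_comm] at this
    exact absurd hlt this.not_gt
  · lift N to ℝ≥0 using hN
    refine (h N (pos_iff_ne_zero.2 (by simpa using hN0)) le_rfl).trans ?_
    gcongr
    exact le_self_add

theorem partner_add (U W : ℝ → ℂ) : nonlocalPartner σ W + nonlocalPartner σ (fun x => U x + -W x) =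
    nonlocalPartner σ U := by
  funext x
  simp only [Pi.add_apply, nonlocalPartner, map_add, map_neg]
  ring

theorem fun_add_sub (U W : ℝ → ℂ) : (W + fun x => U x + -W x) = U := by
  funext x; simp

theorem scatteringData_lipschitz (hσ : σ = 1 ∨ σ = -1) (hκ : ∀ z : ℝ, κ z ^ 2 = (z : ℂ))
    (γ : ℝ≥0) : ∃ C : ℝ≥0, ∀ u w : ℝ → ℂ,
      MemWeightedSobolev 1 1 u → MemWeightedSobolev 1 1 w →
      weightedSobolevNorm 1 1 u ≤ γ → weightedSobolevNorm 1 1 w ≤ γ →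
      ∀ i, sobolevNorm 1 (scatteringData σ κ u i - scatteringData σ κ w i) ≤
        C * weightedSobolevNorm 1 1 (u - w) := by
  obtain ⟨C, hC⟩ := exists_pairData_lipschitz γ
  refine ⟨C + 1, fun u w hu hw nu nw i => le_mul_of_forall_pos fun δ hδ hN => ?_⟩
  obtain ⟨U, U', γ₁, hU, hWU⟩ := hu.exists_W11
  obtain ⟨W, W', γ₂, hW, hWW⟩ := hw.exists_W11
  replace hWU := hWU.of_norm_le hU nu
  replace hWW := hWW.of_norm_le hW nw
  have hd := hWU.add hWW.neg
  have hae : u - w =ᵐ[volume] fun x => U x + -W x := by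
    filter_upwards [hU, hW] with x h1 h2
    rw [Pi.sub_apply, h1, h2, sub_eq_add_neg]
  -- a difference of potentials has norm at most `2 γ`, so that `δ` can be truncated
  have hd' : W11 (min δ (2 * γ + 1)) (fun x => U x + -W x) (fun x => U' x + -W' x) := by
    rcases min_choice δ (2 * γ + 1) with h | h <;> rw [h]
    · exact hd.of_norm_le hae hN
    · exact hd.mono (by rw [two_mul]; exact le_self_add)
  obtain ⟨V', hV⟩ := hWW.partner hσ
  obtain ⟨E', hE⟩ := hd'.partner hσ
  refine (hC W W' _ V' _ _ _ E' (min δ (2 * γ + 1)) (lt_min hδ (by positivity)) (min_le_right _ _)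
    hWW hV hd' hE i _ ?_).trans (by gcongr; exact min_le_left _ _)
  rw [fun_add_sub, partner_add]
  exact (hWU.scatteringData_ae_eq hσ hκ hU i).sub (hWW.scatteringData_ae_eq hσ hκ hW i)

theorem weightedLpNorm_le_add {f g : ℝ → ℂ} (hfg : f =ᵐ[volume] g) (hg : Continuous g) :
    weightedLpNorm 2 1 f ≤ eLpNorm g 2 volume + eLpNorm (fun z : ℝ => z * g z) 2 volume := by
  have h1 : weightedLpNorm 2 1 f = eLpNorm (fun x => bracket x • g x) 2 volume := by
    rw [weightedLpNorm_one]
    refine eLpNorm_congr_ae ?_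
    filter_upwards [hfg] with x hx
    rw [hx]
  rw [h1, ← eLpNorm_norm g, ← eLpNorm_norm fun z : ℝ => (z : ℂ) * g z]
  refine (eLpNorm_mono_real fun x => ?_).trans (eLpNorm_add_le
    (f := fun x => ‖g x‖) (g := fun z : ℝ => ‖(z : ℂ) * g z‖)
    (Continuous.aestronglyMeasurable (by fun_prop))
    (Continuous.aestronglyMeasurable (by fun_prop)) (by norm_num))
  rw [norm_smul, Pi.add_apply, norm_mul, Complex.norm_real, Real.norm_of_nonneg (bracket_pos x).le,
    ← one_add_mul, Real.norm_eq_abs]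
  refine mul_le_mul_of_nonneg_right ?_ (norm_nonneg _)
  rw [bracket]
  refine Real.sqrt_le_iff.2 ⟨by positivity, ?_⟩
  nlinarith [sq_abs x, abs_nonneg x]

theorem MemSobolev.exists_W211 (h2 : MemSobolev 2 u) (h : MemWeightedSobolev 1 1 u) :
    ∃ U U' U'' γ, u =ᵐ[volume] U ∧ W211 γ U U' U'' := by
  obtain ⟨U, U', U'', γ, hU, hW, hac, hn⟩ := MemSobolev.exists_W11_hasACDeriv h2 h
  exact ⟨U, U', U'', γ, hU, hW, hac, hn⟩

theorem W211.of_norm_le (hu : u =ᵐ[volume] U) (h : W211 γ U U' U'')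
    (hδ : sobolevNorm 2 u + weightedSobolevNorm 1 1 u ≤ δ) : W211 δ U U' U'' :=
  ⟨h.toW11.of_norm_le hu (le_add_self.trans hδ), h.ac',
    eLpNorm_le_of_sobolevNorm_two_le hu h.ac h.ac' (le_self_add.trans hδ)⟩

theorem memWeightedLp_offDiagonalData (hσ : σ = 1 ∨ σ = -1) (hκ : ∀ z : ℝ, κ z ^ 2 = (z : ℂ))
    (h2 : MemSobolev 2 u) (hu : MemWeightedSobolev 1 1 u) (i : Fin 4) :
    MemWeightedLp 2 1 (offDiagonalData σ κ u i) := by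
  obtain ⟨U, U', U'', γ, hU, hW⟩ := MemSobolev.exists_W211 h2 hu
  obtain ⟨V', V'', hV⟩ := hW.partner hσ
  obtain ⟨C, hC⟩ := exists_sobBound_pairData γ
  obtain ⟨D, hD⟩ := exists_eLpNorm_mul_offData_le γ
  have h : SobBound C (offData U (nonlocalPartner σ U) i) :=
    hC _ _ _ _ hW.toW11 hV.toW11 i.succ.succ
  have hae := hW.toW11.offDiagonalData_ae_eq hσ hκ hU i
  refine ⟨?_, ((weightedLpNorm_le_add hae h.cont).trans
    (add_le_add h.l2 (hD _ _ _ _ _ _ hW hV i))).trans_lt (by finiteness)⟩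
  have hb := continuous_bracket
  exact (by fun_prop : Continuous fun x => bracket x ^ 1).aestronglyMeasurable.smul
    (h.cont.aestronglyMeasurable.congr hae.symm)

theorem eLpNorm_le_sobolevNorm (f : ℝ → ℂ) : eLpNorm f 2 volume ≤ sobolevNorm 1 f := by
  refine le_trans (le_of_eq ?_) le_self_add
  simp [weightedLpNorm]

theorem offDiagonalData_lipschitz (hσ : σ = 1 ∨ σ = -1) (hκ : ∀ z : ℝ, κ z ^ 2 = (z : ℂ))
    (γ : ℝ≥0) : ∃ C : ℝ≥0, ∀ u w : ℝ → ℂ,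
      MemSobolev 2 u → MemWeightedSobolev 1 1 u → MemSobolev 2 w → MemWeightedSobolev 1 1 w →
      sobolevNorm 2 u + weightedSobolevNorm 1 1 u ≤ γ →
      sobolevNorm 2 w + weightedSobolevNorm 1 1 w ≤ γ →
      ∀ i, weightedLpNorm 2 1 (offDiagonalData σ κ u i - offDiagonalData σ κ w i) ≤
        C * (sobolevNorm 2 (u - w) + weightedSobolevNorm 1 1 (u - w)) := by
  obtain ⟨C, hC⟩ := exists_pairData_lipschitz γ
  obtain ⟨D, hD⟩ := exists_offData_lipschitz γ
  refine ⟨C + D + 1, fun u w hu2 hu hw2 hw nu nw i => le_mul_of_forall_pos fun δ hδ hN => ?_⟩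
  obtain ⟨U, U', U'', γ₁, hU, hWU⟩ := MemSobolev.exists_W211 hu2 hu
  obtain ⟨W, W', W'', γ₂, hW, hWW⟩ := MemSobolev.exists_W211 hw2 hw
  replace hWU := hWU.of_norm_le hU nu
  replace hWW := hWW.of_norm_le hW nw
  have hd : W211 (γ + γ) (fun x => U x + -W x) (fun x => U' x + -W' x) (fun x => U'' x + -W'' x) :=
    hWU.add hWW.neg_fun
  have hae : u - w =ᵐ[volume] fun x => U x + -W x := by
    filter_upwards [hU, hW] with x h1 h2
    rw [Pi.sub_apply, h1, h2, sub_eq_add_neg]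
  -- a difference of potentials has norm at most `2 γ`, so that `δ` can be truncated
  have hd' : W211 (min δ (2 * γ + 1)) (fun x => U x + -W x) (fun x => U' x + -W' x)
      (fun x => U'' x + -W'' x) := by
    rcases min_choice δ (2 * γ + 1) with h | h <;> rw [h]
    · exact hd.of_norm_le hae hN
    · exact hd.mono (by rw [two_mul]; exact le_self_add)
  obtain ⟨V', V'', hV⟩ := hWW.partner hσ
  obtain ⟨E', E'', hE⟩ := hd'.partner hσ
  obtain ⟨B, hB⟩ := exists_sobBound_pairData γ
  obtain ⟨Y', Y'', hY⟩ := hWU.partner hσ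
  have cU : Continuous (offData U (nonlocalPartner σ U) i) :=
    (hB _ _ _ _ hWU.toW11 hY.toW11 i.succ.succ).cont
  have cW : Continuous (offData W (nonlocalPartner σ W) i) :=
    (hB _ _ _ _ hWW.toW11 hV.toW11 i.succ.succ).cont
  have hpos : 0 < min δ (2 * γ + 1) := lt_min hδ (by positivity)
  have h1 := hC W W' _ V' _ _ _ E' (min δ (2 * γ + 1)) hpos (min_le_right _ _)
    hWW.toW11 hV.toW11 hd'.toW11 hE.toW11 i.succ.succ _ (ae_eq_refl _)
  have h2 := hD W W' W'' _ V' V'' _ _ _ _ E' E'' (min δ (2 * γ + 1)) hpos (min_le_right _ _)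
    hWW hV hd' hE i
  rw [fun_add_sub, partner_add] at h1 h2
  have hdata := (hWU.toW11.offDiagonalData_ae_eq hσ hκ hU i).sub
    (hWW.toW11.offDiagonalData_ae_eq hσ hκ hW i)
  refine (weightedLpNorm_le_add hdata (cU.sub cW)).trans ?_
  refine (add_le_add ((eLpNorm_le_sobolevNorm _).trans h1) h2).trans ?_
  rw [← add_mul]
  push_cast
  gcongr
  exact min_le_left _ _

end

end NDNLS

end

theorem mainTheorem4 (σ : ℝ) (hσ : σ = 1 ∨ σ = -1)
    (κ : ℝ → ℂ) (hκ : ∀ z : ℝ, κ z ^ 2 = (z : ℂ)) :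
    -- the Jost functions and the scattering data are well defined for `k ∈ ℝ ∪ iℝ`
    (∀ u : ℝ → ℂ, NDNLS.MemWeightedSobolev 1 1 u → ∀ k : ℂ, (∃ z : ℝ, k ^ 2 = (z : ℂ)) →
      (∀ s : NDNLS.Side, (∃! φ, NDNLS.IsJostPhi σ s u k φ) ∧ (∃! ψ, NDNLS.IsJostPsi σ s u k ψ)) ∧
      (∃! S, NDNLS.IsScatteringMatrix σ u k S)) ∧
    -- membership in `H¹_z` for `u ∈ H^{1,1}`
    (∀ u : ℝ → ℂ, NDNLS.MemWeightedSobolev 1 1 u →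
      ∀ i, NDNLS.MemSobolev 1 (NDNLS.scatteringData σ κ u i)) ∧
    -- Lipschitz continuity from `H^{1,1}` to `H¹_z` on bounded sets
    (∀ γ : ℝ≥0, ∃ C : ℝ≥0, ∀ u w : ℝ → ℂ,
      NDNLS.MemWeightedSobolev 1 1 u → NDNLS.MemWeightedSobolev 1 1 w →
      NDNLS.weightedSobolevNorm 1 1 u ≤ γ → NDNLS.weightedSobolevNorm 1 1 w ≤ γ →
      ∀ i, NDNLS.sobolevNorm 1
          (NDNLS.scatteringData σ κ u i - NDNLS.scatteringData σ κ w i) ≤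
        C * NDNLS.weightedSobolevNorm 1 1 (u - w)) ∧
    -- membership in `L^{2,1}_z` for `u ∈ H² ∩ H^{1,1}`
    (∀ u : ℝ → ℂ, NDNLS.MemSobolev 2 u → NDNLS.MemWeightedSobolev 1 1 u →
      ∀ i, NDNLS.MemWeightedLp 2 1 (NDNLS.offDiagonalData σ κ u i)) ∧
    -- Lipschitz continuity from `H² ∩ H^{1,1}` to `L^{2,1}_z` on bounded sets
    (∀ γ : ℝ≥0, ∃ C : ℝ≥0, ∀ u w : ℝ → ℂ,
      NDNLS.MemSobolev 2 u → NDNLS.MemWeightedSobolev 1 1 u →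
      NDNLS.MemSobolev 2 w → NDNLS.MemWeightedSobolev 1 1 w →
      NDNLS.sobolevNorm 2 u + NDNLS.weightedSobolevNorm 1 1 u ≤ γ →
      NDNLS.sobolevNorm 2 w + NDNLS.weightedSobolevNorm 1 1 w ≤ γ →
      ∀ i, NDNLS.weightedLpNorm 2 1
          (NDNLS.offDiagonalData σ κ u i - NDNLS.offDiagonalData σ κ w i) ≤
        C * (NDNLS.sobolevNorm 2 (u - w) + NDNLS.weightedSobolevNorm 1 1 (u - w))) :=
  ⟨fun _ hu _ hk => NDNLS.wellDefined hσ hu hk,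
    fun _ hu i => NDNLS.memSobolev_scatteringData hσ hκ hu i,
    NDNLS.scatteringData_lipschitz hσ hκ,
    fun _ h2 hu i => NDNLS.memWeightedLp_offDiagonalData hσ hκ h2 hu i,
    NDNLS.offDiagonalData_lipschitz hσ hκ⟩
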